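/- **Conventions.** A *locally $C^*$-algebra* is a complete Hausdorff complex topological $*$-algebra $A$ in which a net converges to $0$ if and only if $p$ of it converges to $0$ for every $p\in S(A)$, the set of continuous $C^*$-seminorms on $A$; its morphisms are the continuous $*$-homomorphisms. A *Hilbert $A$-module* is a right $A$-module $E$ with an $A$-valued inner product (linear in the second variable, Hermitian, positive and definite) that is complete for the topology of the seminorms $\bar p_E(\xi)=p(\langle\xi,\xi\rangle)^{1/2}$, $p\in S(A)$. It is *full* if $\operatorname{span}\{\langle\xi,\eta\rangle\}$ is dense in $A$. For Hilbert $A$-modules $E,F$, let $L(E,F)$ be the space of adjointable module morphisms $E\to F$, with the topology of the seminorms $\tilde p(T)=\sup\{\bar p_F(T\xi):\bar p_E(\xi)\le 1\}$, $p\in S(A)$; let $\theta_{\eta,\xi}(\zeta)=\eta\langle\xi,\zeta\rangle$ for $\eta\in F$, $\xi\in E$, let $K(E,F)$ be the closure in $L(E,F)$ of the span of these operators, and $K(E)=K(E,E)$. The algebra $A$ is regarded as a Hilbert $A$-module with $\langle a,b\rangle=a^*b$. A map $u:E\to F$ from a Hilbert $A$-module to a Hilbert $B$-module is a *morphism of Hilbert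 modules* if there is a morphism of locally $C^*$-algebras $\alpha:A\to B$ with $\langle u\xi,u\eta\rangle=\alpha(\langle\xi,\eta\rangle)$ for all $\xi,\eta\in E$. An *action* of a locally compact group $G$ on $E$ is a group homomorphism $g\mapsto u_g$ from $G$ into the group $\operatorname{Aut}(E)$ of bijections $u$ of $E$ such that $u$ and $u^{-1}$ are morphisms of Hilbert modules; an action of $G$ on $A$ is a group homomorphism from $G$ into the group of automorphisms of the locally $C^*$-algebra $A$. The action $u$ is *continuous* if $g\mapsto u_g(\xi)$ is continuous for every $\xi\in E$, and an *inverse limit action* if $E$ (with $A$) can be written as the inverse limit, over a directed set, of Hilbert $C^*$-modules $E_\lambda$ (over $C^*$-algebras $A_\lambda$) so that $u_g=\varprojlim_\lambda u_g^\lambda$ for all $g\in G$, for some actions $u^\lambda$ of $G$ on $E_\lambda$. **Proposition.** Let $G$ be a locally compact group and let $g\mapsto u_g$ be an action of $G$ on a full Hilbert $A$-module $E$ over a locally $C^*$-algebra $A$. Let $g\mapsto\alpha^u_g$ be the action of $G$ on $A$ induced by $u$, that is, the unique action with $\alpha^u_g(\langle\xi,\eta\rangle)=\langle u_g(\xi),u_g(\eta)\rangle$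 for all $g\in G$, $\xi,\eta\in E$ (it exists). Then $K(E)$, with composition and adjoint, is a locally $C^*$-algebra, and $\widetilde E=K(E,A)$ is a Hilbert $K(E)$-module with the right action $T\cdot k=T\circ k$ and the inner product $\langle S,T\rangle=S^*\circ T$; and there is a unique action $g\mapsto\widetilde u_g$ of $G$ on the Hilbert $K(E)$-module $\widetilde E$ such that $$\widetilde u_g(\theta_{a,\xi})=\theta_{\alpha^u_g(a),\,u_g(\xi)}\qquad(g\in G,\ a\in A,\ \xi\in E).$$ Moreover, if $u$ is a continuous inverse limit action, then $\widetilde u$ is a continuous inverse limit action. -/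

import Mathlib

open Filter Topology UniformSpace
open scoped RightActions

noncomputable section

set_option linter.unusedSectionVars false

/-- A C⋆-seminorm on a complex ⋆-algebra. -/
structure CStarSeminorm (A : Type*) [NonUnitalRing A] [StarRing A] [Module ℂ A]
    extends Seminorm ℂ A where
  mul_le : ∀ a b : A, toFun (a * b) ≤ toFun a * toFun b
  star_mul_self : ∀ a : A, toFun (star a * a) = toFun a ^ 2

namespace CStarSeminorm

variable {A : Type*} [NonUnitalRing A] [StarRing A] [Module ℂ A]

instance : CoeFun (CStarSeminorm A) (fun _ => A → ℝ) := ⟨fun p => p.toSeminorm⟩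

theorem mul_le' (p : CStarSeminorm A) (a b : A) : p (a * b) ≤ p a * p b := p.mul_le a b

theorem star_mul_self' (p : CStarSeminorm A) (a : A) : p (star a * a) = p a ^ 2 :=
  p.star_mul_self a

theorem nonneg (p : CStarSeminorm A) (a : A) : 0 ≤ p a := apply_nonneg p.toSeminorm a

theorem le_star (p : CStarSeminorm A) (a : A) : p a ≤ p (star a) := by
  have h1 := p.mul_le' (star a) a
  rw [p.star_mul_self'] at h1
  by_contra h
  push Not at h
  nlinarith [p.nonneg (star a), p.nonneg a]

theorem star_eq (p : CStarSeminorm A) (a : A) : p (star a) = p a :=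
  le_antisymm (by simpa using p.le_star (star a)) (p.le_star a)

/-- The algebra `A`, equipped with the C⋆-seminorm `p`. -/
def WithSeminorm (_ : CStarSeminorm A) : Type _ := A

variable (p : CStarSeminorm A)

instance : NonUnitalRing p.WithSeminorm := inferInstanceAs (NonUnitalRing A)
instance : StarRing p.WithSeminorm := inferInstanceAs (StarRing A)

instance : Module ℂ p.WithSeminorm := inferInstanceAs (Module ℂ A)

instance : SeminormedAddCommGroup p.WithSeminorm :=
  AddGroupSeminorm.toSeminormedAddCommGroup (E := p.WithSeminorm) p.toSeminorm.toAddGroupSeminorm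

instance : NonUnitalSeminormedRing p.WithSeminorm where
  __ := (inferInstance : NonUnitalRing p.WithSeminorm)
  __ := (inferInstance : SeminormedAddCommGroup p.WithSeminorm)
  norm_mul_le a b := p.mul_le a b

instance : NormedSpace ℂ p.WithSeminorm where
  norm_smul_le c a := (map_smul_eq_mul p.toSeminorm c a).le

instance [StarModule ℂ A] : StarModule ℂ p.WithSeminorm := inferInstanceAs (StarModule ℂ A)
instance [IsScalarTower ℂ A A] : IsScalarTower ℂ p.WithSeminorm p.WithSeminorm :=
  inferInstanceAs (IsScalarTower ℂ A A)
instance [SMulCommClass ℂ A A] : SMulCommClass ℂ p.WithSeminorm p.WithSeminorm :=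
  inferInstanceAs (SMulCommClass ℂ A A)

theorem norm_withSeminorm (a : p.WithSeminorm) : ‖a‖ = p a := rfl

instance : NormedStarGroup p.WithSeminorm where
  norm_star_le a := (p.star_eq a).le

/-- The Hausdorff completion of `A` with respect to `p`. -/
abbrev Compl : Type _ := Completion p.WithSeminorm

instance : Mul p.Compl :=
  ⟨Function.curry <| (Completion.isDenseInducing_coe.prodMap
    Completion.isDenseInducing_coe).extend ((↑) ∘ Function.uncurry (· * ·))⟩

theorem coe_mul_compl (a b : p.WithSeminorm) : ((a * b : p.WithSeminorm) : p.Compl) = a * b :=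
  ((Completion.isDenseInducing_coe.prodMap Completion.isDenseInducing_coe).extend_eq
      ((Completion.continuous_coe _).comp (@continuous_mul p.WithSeminorm _ _ _)) (a, b)).symm

instance : ContinuousMul p.Compl where
  continuous_mul := by
    let m := (AddMonoidHom.mul : p.WithSeminorm →+ p.WithSeminorm →+ p.WithSeminorm).compr₂
      Completion.toCompl
    have : Continuous fun x : p.WithSeminorm × p.WithSeminorm => m x.1 x.2 :=
      (Completion.continuous_coe _).comp continuous_mul
    have di : IsDenseInducing (Completion.toCompl : p.WithSeminorm → p.Compl) :=
      Completion.isDenseInducing_coe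
    exact (di.extend_Z_bilin di this :)

instance : NonUnitalRing p.Compl where
  __ := (inferInstance : AddCommGroup p.Compl)
  __ := (inferInstance : Mul p.Compl)
  zero_mul a := Completion.induction_on a (isClosed_eq (by fun_prop) continuous_const)
    fun a => by rw [← Completion.coe_zero, ← coe_mul_compl, zero_mul]
  mul_zero a := Completion.induction_on a (isClosed_eq (by fun_prop) continuous_const)
    fun a => by rw [← Completion.coe_zero, ← coe_mul_compl, mul_zero]
  mul_assoc a b c := Completion.induction_on₃ a b c (isClosed_eq (by fun_prop) (by fun_prop))
    fun a b c => by simp only [← coe_mul_compl, mul_assoc]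
  left_distrib a b c := Completion.induction_on₃ a b c (isClosed_eq (by fun_prop) (by fun_prop))
    fun a b c => by simp only [← Completion.coe_add, ← coe_mul_compl, mul_add]
  right_distrib a b c := Completion.induction_on₃ a b c (isClosed_eq (by fun_prop) (by fun_prop))
    fun a b c => by simp only [← Completion.coe_add, ← coe_mul_compl, add_mul]

instance : NonUnitalNormedRing p.Compl where
  __ := (inferInstance : NonUnitalRing p.Compl)
  __ := (inferInstance : NormedAddCommGroup p.Compl)
  norm_mul_le a b := Completion.induction_on₂ a b (isClosed_le (by fun_prop) (by fun_prop))
    fun a b => by simpa only [← coe_mul_compl, Completion.norm_coe] using norm_mul_le a b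

instance : Star p.Compl := ⟨Completion.map star⟩

theorem uniformContinuous_star : UniformContinuous (star : p.WithSeminorm → p.WithSeminorm) :=
  uniformContinuous_addMonoidHom_of_continuous
    (f := (starAddEquiv : p.WithSeminorm ≃+ p.WithSeminorm)) continuous_star

theorem coe_star_compl (a : p.WithSeminorm) :
    ((star a : p.WithSeminorm) : p.Compl) = star (a : p.Compl) :=
  (Completion.map_coe p.uniformContinuous_star a).symm

instance : ContinuousStar p.Compl := ⟨Completion.continuous_map⟩

instance : StarRing p.Compl where
  star_involutive a := Completion.induction_on a (isClosed_eq (by fun_prop) (by fun_prop))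
    fun a => by simp only [← coe_star_compl, star_star]
  star_mul a b := Completion.induction_on₂ a b (isClosed_eq (by fun_prop) (by fun_prop))
    fun a b => by simp only [← coe_star_compl, ← coe_mul_compl, star_mul]
  star_add a b := Completion.induction_on₂ a b (isClosed_eq (by fun_prop) (by fun_prop))
    fun a b => by simp only [← coe_star_compl, ← Completion.coe_add, star_add]

theorem smul_mul_compl [IsScalarTower ℂ A A] (c : ℂ) (a b : p.Compl) :
    c • a * b = c • (a * b) :=
  Completion.induction_on₂ a b
    (isClosed_eq ((continuous_fst.const_smul c).mul continuous_snd)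
      ((continuous_fst.mul continuous_snd).const_smul c))
    fun a b => by rw [← Completion.coe_smul, ← coe_mul_compl, ← coe_mul_compl,
      ← Completion.coe_smul, smul_mul_assoc]

theorem mul_smul_compl [SMulCommClass ℂ A A] (c : ℂ) (a b : p.Compl) :
    a * c • b = c • (a * b) :=
  Completion.induction_on₂ a b
    (isClosed_eq (continuous_fst.mul (continuous_snd.const_smul c))
      ((continuous_fst.mul continuous_snd).const_smul c))
    fun a b => by rw [← Completion.coe_smul, ← coe_mul_compl, ← coe_mul_compl,
      ← Completion.coe_smul, mul_smul_comm]

theorem star_smul_compl [StarModule ℂ A] (c : ℂ) (a : p.Compl) :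
    star (c • a) = star c • star a :=
  Completion.induction_on a
    (isClosed_eq (continuous_id.const_smul c).star (continuous_star.const_smul (star c)))
    fun a => by rw [← Completion.coe_smul, ← coe_star_compl, ← coe_star_compl,
      ← Completion.coe_smul, star_smul]

instance [IsScalarTower ℂ A A] [SMulCommClass ℂ A A] [StarModule ℂ A] :
    NonUnitalCStarAlgebra p.Compl where
  __ := (inferInstance : NonUnitalNormedRing p.Compl)
  __ := (inferInstance : StarRing p.Compl)
  __ := (inferInstance : NormedSpace ℂ p.Compl)
  __ := (inferInstance : CompleteSpace p.Compl)
  norm_mul_self_le a := Completion.induction_on a (isClosed_le (by fun_prop) (by fun_prop))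
    fun a => by
      simp only [← coe_star_compl, ← coe_mul_compl, Completion.norm_coe, norm_withSeminorm]
      exact (by rw [← sq]; exact (p.star_mul_self' a).ge)
  smul_assoc c a b := p.smul_mul_compl c a b
  smul_comm c a b := (p.mul_smul_compl c a b).symm
  star_smul c a := p.star_smul_compl c a

theorem le_add_of_star_mul_self [IsScalarTower ℂ A A] [SMulCommClass ℂ A A] [StarModule ℂ A]
    (a b : A) : p (star a * a) ≤ p (star a * a + star b * b) := by
  let _ := CStarAlgebra.spectralOrder p.Compl
  have := CStarAlgebra.spectralOrderedRing p.Compl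
  let x : p.WithSeminorm := a
  let y : p.WithSeminorm := b
  have h := CStarAlgebra.norm_le_norm_of_nonneg_of_le (star_mul_self_nonneg (x : p.Compl))
    (le_add_of_nonneg_right (star_mul_self_nonneg (y : p.Compl)))
  simp only [← coe_star_compl, ← coe_mul_compl, ← Completion.coe_add, Completion.norm_coe] at h
  exact h

end CStarSeminorm

/-- A continuous C⋆-seminorm; the elements of this type form the set `S(A)`. -/
structure ContCStarSeminorm (A : Type*) [NonUnitalRing A] [StarRing A] [Module ℂ A]
    [TopologicalSpace A] extends CStarSeminorm A where
  continuous_toFun : Continuous toFun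

/-- Locally C⋆-algebras: complete Hausdorff complex topological ⋆-algebras in which a net tends to
`0` iff `p` of it tends to `0` for every continuous C⋆-seminorm `p`. (Joint continuity of the
product and continuity of the involution follow from this.) -/
class IsLocallyCStarAlgebra (A : Type*) [NonUnitalRing A] [StarRing A] [Module ℂ A]
    [UniformSpace A] : Prop extends IsScalarTower ℂ A A, SMulCommClass ℂ A A, StarModule ℂ A,
    IsUniformAddGroup A, CompleteSpace A, T2Space A where
  nhds_zero : 𝓝 (0 : A) = ⨅ p : ContCStarSeminorm A, comap p.toCStarSeminorm (𝓝 0)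

/-- For a C⋆-seminorm `p` on `A`, the function `ξ ↦ p(⟨ξ, ξ⟩)^{1/2}` on an `A`-module with
`A`-valued inner product. -/
def modNorm {A E : Type*} [NonUnitalRing A] [StarRing A] [Module ℂ A] [Inner A E]
    (p : CStarSeminorm A) (ξ : E) : ℝ := √(p (inner A ξ ξ))

/-- Hilbert modules over `A`. The right action of `a` on `ξ` is written `ξ <• a`, and `inner A` is
linear in the second variable; an element of `A` is positive if it has the form `b⋆ b`. -/
class IsHilbertModule (A E : Type*) [NonUnitalRing A] [StarRing A] [Module ℂ A] [UniformSpace A]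
    [AddCommGroup E] [Module ℂ E] [SMul Aᵐᵒᵖ E] [Inner A E] [UniformSpace E] :
    Prop where
  isUniformAddGroup : IsUniformAddGroup E
  completeSpace : CompleteSpace E
  add_rsmul : ∀ (ξ η : E) (a : A), (ξ + η) <• a = ξ <• a + η <• a
  rsmul_add : ∀ (ξ : E) (a b : A), ξ <• (a + b) = ξ <• a + ξ <• b
  rsmul_mul : ∀ (ξ : E) (a b : A), ξ <• (a * b) = (ξ <• a) <• b
  smul_rsmul : ∀ (c : ℂ) (ξ : E) (a : A), (c • ξ) <• a = c • (ξ <• a)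
  rsmul_smul : ∀ (c : ℂ) (ξ : E) (a : A), ξ <• (c • a) = c • (ξ <• a)
  ip_add_right : ∀ ξ η ζ : E, inner A ξ (η + ζ) = inner A ξ η + inner A ξ ζ
  ip_smul_right : ∀ (c : ℂ) (ξ η : E), inner A ξ (c • η) = c • inner A ξ η
  inner_rsmul_right : ∀ (ξ η : E) (a : A), inner A ξ (η <• a) = inner A ξ η * a
  star_inner : ∀ ξ η : E, star (inner A ξ η) = inner A η ξ
  inner_self_pos : ∀ ξ : E, ∃ b : A, inner A ξ ξ = star b * b
  inner_self_eq_zero : ∀ ξ : E, inner A ξ ξ = 0 ↔ ξ = 0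
  nhds_zero : 𝓝 (0 : E) = ⨅ p : ContCStarSeminorm A, comap (modNorm p.toCStarSeminorm) (𝓝 0)

/-- A Hilbert `A`-module is full if the inner products span a dense subspace of `A`. -/
def IsFull (A E : Type*) [NonUnitalRing A] [Module ℂ A] [TopologicalSpace A] [Inner A E] : Prop :=
  Dense (Submodule.span ℂ {a : A | ∃ ξ η : E, a = inner A ξ η} : Set A)

namespace IsHilbertModule

variable {A E : Type*} [NonUnitalRing A] [StarRing A] [Module ℂ A] [UniformSpace A]
  [IsLocallyCStarAlgebra A]
  [AddCommGroup E] [Module ℂ E] [SMul Aᵐᵒᵖ E] [Inner A E] [UniformSpace E] [IsHilbertModule A E]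

theorem ip_add_left (ξ η ζ : E) : inner A (ξ + η) ζ = inner A ξ ζ + inner A η ζ := by
  rw [← star_inner, ip_add_right, star_add, star_inner, star_inner]

theorem ip_smul_left (c : ℂ) (ξ η : E) : inner A (c • ξ) η = star c • inner A ξ η := by
  rw [← star_inner, ip_smul_right, star_smul, star_inner]

theorem inner_rsmul_left (ξ η : E) (a : A) : inner A (ξ <• a) η = star a * inner A ξ η := by
  rw [← star_inner, inner_rsmul_right, star_mul, star_inner]

theorem ip_neg_right (ξ η : E) : inner A ξ (-η) = -inner A ξ η := by
  rw [← neg_one_smul ℂ, ip_smul_right, neg_one_smul]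

theorem ip_sub_right (ξ η ζ : E) : inner A ξ (η - ζ) = inner A ξ η - inner A ξ ζ := by
  rw [sub_eq_add_neg, ip_add_right, ip_neg_right, sub_eq_add_neg]

theorem ip_neg_left (ξ η : E) : inner A (-ξ) η = -inner A ξ η := by
  rw [← star_inner, ip_neg_right, star_neg, star_inner]

theorem ip_sub_left (ξ η ζ : E) : inner A (ξ - η) ζ = inner A ξ ζ - inner A η ζ := by
  rw [sub_eq_add_neg, ip_add_left, ip_neg_left, sub_eq_add_neg]

/-- The inner product separates points. -/
theorem ext_inner {ξ η : E} (h : ∀ ζ : E, inner A ζ ξ = inner A ζ η) : ξ = η := by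
  rw [← sub_eq_zero, ← inner_self_eq_zero (A := A), ip_sub_right, h, sub_self]

theorem modNorm_nonneg (p : CStarSeminorm A) (ξ : E) : 0 ≤ modNorm p ξ := Real.sqrt_nonneg _

theorem modNorm_sq (p : CStarSeminorm A) (ξ : E) : modNorm p ξ ^ 2 = p (inner A ξ ξ) :=
  Real.sq_sqrt (p.nonneg _)

theorem cauchy_schwarz_aux (p : CStarSeminorm A) (ξ η : E) (s : ℝ) (hs : 0 ≤ s) :
    2 * s * p (inner A ξ η) ^ 2 ≤
      p (inner A η η) + s ^ 2 * (p (inner A ξ ξ) * p (inner A ξ η) ^ 2) := by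
  set a := inner A ξ η with ha
  obtain ⟨c, hc⟩ := inner_self_pos (A := A) ((s : ℂ) • (ξ <• a) - η)
  have e : inner A η η + (s : ℂ) ^ 2 • (star a * (inner A ξ ξ * a))
      = star (((√(2 * s) : ℝ) : ℂ) • a) * (((√(2 * s) : ℝ) : ℂ) • a) + star c * c := by
    have h2 : ((√(2 * s) : ℝ) : ℂ) * ((√(2 * s) : ℝ) : ℂ) = 2 * s := by
      rw [← Complex.ofReal_mul, Real.mul_self_sqrt (by positivity)]; simp
    have h3 : inner A η ξ = star a := by rw [ha, star_inner]
    rw [← hc, star_smul, smul_mul_smul_comm, Complex.star_def, Complex.conj_ofReal, h2]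
    simp only [ip_sub_left, ip_sub_right, ip_smul_left, ip_smul_right,
      inner_rsmul_left, inner_rsmul_right, ← ha, h3, sub_mul, smul_mul_assoc, smul_sub,
      Complex.star_def, Complex.conj_ofReal, mul_assoc]
    rw [mul_smul, two_smul, sq, mul_smul]
    abel
  have h1 := p.le_add_of_star_mul_self (((√(2 * s) : ℝ) : ℂ) • a) c
  rw [← e, p.star_mul_self', map_smul_eq_mul, mul_pow] at h1
  have h4 : ‖((√(2 * s) : ℝ) : ℂ)‖ ^ 2 = 2 * s := by
    rw [Complex.norm_real, Real.norm_eq_abs, sq_abs, Real.sq_sqrt (by positivity)]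
  rw [h4] at h1
  refine h1.trans ((map_add_le_add p.toSeminorm _ _).trans ?_)
  rw [map_smul_eq_mul, norm_pow, Complex.norm_real, Real.norm_eq_abs, sq_abs]
  gcongr
  calc p (star a * (inner A ξ ξ * a)) ≤ p (star a) * (p (inner A ξ ξ) * p a) :=
        (p.mul_le' _ _).trans (mul_le_mul_of_nonneg_left (p.mul_le' _ _) (p.nonneg _))
    _ = p (inner A ξ ξ) * p a ^ 2 := by rw [p.star_eq]; ring

/-- The Cauchy–Schwarz inequality. -/
theorem cauchy_schwarz (p : CStarSeminorm A) (ξ η : E) :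
    p (inner A ξ η) ≤ modNorm p ξ * modNorm p η := by
  have h := cauchy_schwarz_aux p ξ η
  have key : p (inner A ξ η) ^ 2 ≤ p (inner A ξ ξ) * p (inner A η η) := by
    rcases (p.nonneg (inner A ξ ξ)).eq_or_lt with h0 | h0
    · rw [← h0, zero_mul]
      simp only [← h0, zero_mul, mul_zero, add_zero] at h
      by_contra hlt
      push Not at hlt
      have h5 := h ((p (inner A η η) + 1) / p (inner A ξ η) ^ 2)
        (div_nonneg (by linarith [p.nonneg (inner A η η)]) hlt.le)
      rw [mul_assoc, div_mul_cancel₀ _ hlt.ne'] at h5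
      linarith [p.nonneg (inner A η η)]
    · have h5 := h (p (inner A ξ ξ))⁻¹ (by positivity)
      field_simp at h5
      nlinarith
  rw [modNorm, modNorm, ← Real.sqrt_mul (p.nonneg _)]
  exact Real.le_sqrt_of_sq_le key

theorem modNorm_add_le (p : CStarSeminorm A) (ξ η : E) :
    modNorm p (ξ + η) ≤ modNorm p ξ + modNorm p η := by
  refine abs_le_of_sq_le_sq' ?_ (add_nonneg (modNorm_nonneg p ξ) (modNorm_nonneg p η)) |>.2
  have e : inner A (ξ + η) (ξ + η)
      = (inner A ξ ξ + inner A ξ η) + (inner A η ξ + inner A η η) := by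
    rw [ip_add_left, ip_add_right, ip_add_right]
  rw [modNorm_sq, e]
  have h1 := map_add_le_add p.toSeminorm (inner A ξ ξ + inner A ξ η) (inner A η ξ + inner A η η)
  have h2 := map_add_le_add p.toSeminorm (inner A ξ ξ) (inner A ξ η)
  have h3 := map_add_le_add p.toSeminorm (inner A η ξ) (inner A η η)
  have h4 := cauchy_schwarz p ξ η
  have h5 := cauchy_schwarz p η ξ
  have h6 := modNorm_sq p ξ
  have h7 := modNorm_sq p η
  nlinarith

theorem modNorm_smul (p : CStarSeminorm A) (c : ℂ) (ξ : E) :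
    modNorm p (c • ξ) = ‖c‖ * modNorm p ξ := by
  rw [modNorm, ip_smul_left, ip_smul_right, smul_smul, map_smul_eq_mul, norm_mul,
    norm_star, Real.sqrt_mul (by positivity), Real.sqrt_mul_self (norm_nonneg c), modNorm]

theorem modNorm_zero (p : CStarSeminorm A) : modNorm p (0 : E) = 0 := by
  simpa using modNorm_smul p 0 (0 : E)

theorem modNorm_neg (p : CStarSeminorm A) (ξ : E) : modNorm p (-ξ) = modNorm p ξ := by
  simpa using modNorm_smul p (-1) ξ

theorem modNorm_rsmul_le (p : CStarSeminorm A) (ξ : E) (a : A) :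
    modNorm p (ξ <• a) ≤ modNorm p ξ * p a := by
  refine abs_le_of_sq_le_sq' ?_ (mul_nonneg (modNorm_nonneg p ξ) (p.nonneg a)) |>.2
  rw [modNorm_sq, inner_rsmul_left, inner_rsmul_right, mul_pow, modNorm_sq]
  calc p (star a * (inner A ξ ξ * a)) ≤ p (star a) * (p (inner A ξ ξ) * p a) :=
        (p.mul_le' _ _).trans (mul_le_mul_of_nonneg_left (p.mul_le' _ _) (p.nonneg _))
    _ = p (inner A ξ ξ) * p a ^ 2 := by rw [p.star_eq]; ring

end IsHilbertModule

/-- The inner product `⟨a, b⟩ = a⋆ b` of `A` as a module over itself. -/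
instance selfInner (A : Type*) [NonUnitalRing A] [StarRing A] : Inner A A := ⟨fun a b => star a * b⟩

theorem inner_self_def {A : Type*} [NonUnitalRing A] [StarRing A] (a b : A) :
    inner A a b = star a * b := rfl

/-- A locally C⋆-algebra is a Hilbert module over itself. -/
instance selfHilbertModule (A : Type*) [NonUnitalRing A] [StarRing A] [Module ℂ A] [UniformSpace A]
    [IsLocallyCStarAlgebra A] : IsHilbertModule A A where
  isUniformAddGroup := inferInstance
  completeSpace := inferInstance
  add_rsmul ξ η a := add_mul ξ η a
  rsmul_add ξ a b := mul_add ξ a b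
  rsmul_mul ξ a b := (mul_assoc ξ a b).symm
  smul_rsmul c ξ a := smul_mul_assoc c ξ a
  rsmul_smul c ξ a := mul_smul_comm c ξ a
  ip_add_right ξ η ζ := mul_add _ _ _
  ip_smul_right c ξ η := mul_smul_comm _ _ _
  inner_rsmul_right ξ η a := (mul_assoc _ _ _).symm
  star_inner ξ η := by simp [inner_self_def]
  inner_self_pos ξ := ⟨ξ, rfl⟩
  inner_self_eq_zero a := by
    refine ⟨fun h => ?_, fun h => by simp [h, inner_self_def]⟩
    have h0 : ∀ p : ContCStarSeminorm A, p.toCStarSeminorm a = 0 := fun p => by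
      have := p.star_mul_self' a
      rw [← inner_self_def, h, map_zero] at this
      exact pow_eq_zero_iff (two_ne_zero) |>.1 this.symm
    have h1 : Tendsto (fun _ : ℕ => a) atTop (𝓝 0) := by
      rw [IsLocallyCStarAlgebra.nhds_zero, tendsto_iInf]
      intro p
      rw [tendsto_comap_iff]
      simp [Function.comp_def, h0]
    exact tendsto_nhds_unique tendsto_const_nhds h1
  nhds_zero := by
    rw [IsLocallyCStarAlgebra.nhds_zero]
    congr! 3 with p
    ext a
    rw [modNorm, inner_self_def, p.star_mul_self', Real.sqrt_sq (p.nonneg a)]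

section Operators

open IsHilbertModule

variable (A E F : Type*) [NonUnitalRing A] [StarRing A] [Module ℂ A] [UniformSpace A]
  [IsLocallyCStarAlgebra A]
  [AddCommGroup E] [Module ℂ E] [SMul Aᵐᵒᵖ E] [Inner A E] [UniformSpace E] [IsHilbertModule A E]
  [AddCommGroup F] [Module ℂ F] [SMul Aᵐᵒᵖ F] [Inner A F] [UniformSpace F] [IsHilbertModule A F]
  {E' F' : Type*}
  [AddCommGroup E'] [Module ℂ E'] [SMul Aᵐᵒᵖ E'] [Inner A E'] [UniformSpace E']
  [IsHilbertModule A E']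
  [AddCommGroup F'] [Module ℂ F'] [SMul Aᵐᵒᵖ F'] [Inner A F'] [UniformSpace F']
  [IsHilbertModule A F']

/-- The adjointable module morphisms, as a space of linear maps. -/
def adjointableSubmodule : Submodule ℂ (E →ₗ[ℂ] F) where
  carrier := {T | (∀ (ξ : E) (a : A), T (ξ <• a) = T ξ <• a) ∧
    ∃ S : F →ₗ[ℂ] E, (∀ (η : F) (a : A), S (η <• a) = S η <• a) ∧
      ∀ ξ η, inner A (T ξ) η = inner A ξ (S η)}
  add_mem' := by
    rintro T T' ⟨h, S, hS, hTS⟩ ⟨h', S', hS', hTS'⟩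
    refine ⟨fun ξ a => by simp [h, h', add_rsmul], S + S',
      fun η a => by simp [hS, hS', add_rsmul], fun ξ η => ?_⟩
    simp [ip_add_left, ip_add_right, hTS, hTS']
  zero_mem' := by
    have hE : ∀ a : A, (0 : E) <• a = 0 := fun a => by
      simpa using smul_rsmul (0 : ℂ) (0 : E) a
    have hF : ∀ a : A, (0 : F) <• a = 0 := fun a => by
      simpa using smul_rsmul (0 : ℂ) (0 : F) a
    refine ⟨fun ξ a => by simp [hF], 0, fun η a => by simp [hE], fun ξ η => ?_⟩
    have h1 : inner A (0 : F) η = 0 := by simpa using ip_smul_left (A := A) 0 (0 : F) η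
    have h2 : inner A ξ (0 : E) = 0 := by simpa using ip_smul_right (A := A) 0 ξ (0 : E)
    simp [h1, h2]
  smul_mem' := by
    rintro c T ⟨h, S, hS, hTS⟩
    refine ⟨fun ξ a => by simp [h, smul_rsmul], star c • S,
      fun η a => by simp [hS, smul_rsmul], fun ξ η => ?_⟩
    simp [ip_smul_left, ip_smul_right, hTS]

/-- `L(E, F)`: the adjointable module morphisms from `E` to `F`. -/
def Adjointable : Type _ := adjointableSubmodule A E F

namespace Adjointable

instance : AddCommGroup (Adjointable A E F) :=
  inferInstanceAs (AddCommGroup (adjointableSubmodule A E F))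

instance : Module ℂ (Adjointable A E F) :=
  inferInstanceAs (Module ℂ (adjointableSubmodule A E F))

instance : CoeFun (Adjointable A E F) (fun _ => E → F) := ⟨fun T => T.1⟩

variable {A E F}

@[ext]
theorem ext {S T : Adjointable A E F} (h : ∀ ξ, S ξ = T ξ) : S = T :=
  Subtype.ext (LinearMap.ext h)

theorem map_rsmul (T : Adjointable A E F) (ξ : E) (a : A) : T (ξ <• a) = T ξ <• a := T.2.1 ξ a

theorem add_apply (S T : Adjointable A E F) (ξ : E) : (S + T) ξ = S ξ + T ξ := rfl
theorem sub_apply (S T : Adjointable A E F) (ξ : E) : (S - T) ξ = S ξ - T ξ := rfl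
theorem neg_apply (T : Adjointable A E F) (ξ : E) : (-T) ξ = -T ξ := rfl
theorem zero_apply (ξ : E) : (0 : Adjointable A E F) ξ = 0 := rfl
theorem smul_apply (c : ℂ) (T : Adjointable A E F) (ξ : E) : (c • T) ξ = c • T ξ := rfl

/-- The adjoint `T⋆` of an adjointable module morphism `T`. -/
def adj (T : Adjointable A E F) : Adjointable A F E :=
  ⟨Classical.choose T.2.2, (Classical.choose_spec T.2.2).1, T.1, T.2.1, fun η ξ => by
    rw [← star_inner, ← (Classical.choose_spec T.2.2).2, star_inner]⟩

theorem inner_apply_left (T : Adjointable A E F) (ξ : E) (η : F) :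
    inner A (T ξ) η = inner A ξ (T.adj η) := (Classical.choose_spec T.2.2).2 ξ η

theorem inner_apply_right (T : Adjointable A E F) (η : F) (ξ : E) :
    inner A η (T ξ) = inner A (T.adj η) ξ := by
  rw [← star_inner, inner_apply_left, star_inner]

theorem eq_adj {T : Adjointable A E F} {S : Adjointable A F E}
    (h : ∀ ξ η, inner A (T ξ) η = inner A ξ (S η)) : S = T.adj :=
  ext fun η => ext_inner (A := A) fun ξ => by rw [← h, inner_apply_left]

theorem adj_adj (T : Adjointable A E F) : T.adj.adj = T :=
  (eq_adj fun η ξ => (inner_apply_right T η ξ).symm).symm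

/-- Composition of adjointable module morphisms. -/
def comp (S : Adjointable A F F') (T : Adjointable A E F) : Adjointable A E F' :=
  ⟨S.1 ∘ₗ T.1, fun ξ a => by
    change S (T (ξ <• a)) = S (T ξ) <• a
    rw [map_rsmul, map_rsmul], T.adj.1 ∘ₗ S.adj.1, fun η a => by
    change T.adj (S.adj (η <• a)) = T.adj (S.adj η) <• a
    rw [map_rsmul, map_rsmul], fun ξ η => by
    change inner A (S (T ξ)) η = inner A ξ (T.adj (S.adj η))
    rw [inner_apply_left, inner_apply_left]⟩

theorem comp_apply (S : Adjointable A F F') (T : Adjointable A E F) (ξ : E) :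
    S.comp T ξ = S (T ξ) := rfl

theorem map_add (T : Adjointable A E F) (ξ η : E) : T (ξ + η) = T ξ + T η := T.1.map_add ξ η
theorem map_smul (T : Adjointable A E F) (c : ℂ) (ξ : E) : T (c • ξ) = c • T ξ :=
  T.1.map_smul c ξ

theorem adj_comp (S : Adjointable A F F') (T : Adjointable A E F) :
    (S.comp T).adj = T.adj.comp S.adj :=
  (eq_adj fun ξ η => by rw [comp_apply, comp_apply, inner_apply_left, inner_apply_left]).symm

theorem adj_add (S T : Adjointable A E F) : (S + T).adj = S.adj + T.adj :=
  (eq_adj fun ξ η => by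
    rw [add_apply, add_apply, ip_add_left, ip_add_right, inner_apply_left,
      inner_apply_left]).symm

theorem adj_smul (c : ℂ) (T : Adjointable A E F) : (c • T).adj = star c • T.adj :=
  (eq_adj fun ξ η => by
    rw [smul_apply, smul_apply, ip_smul_left, ip_smul_right, inner_apply_left]).symm

/-- The rank one operator `θ_{η, ξ}`, `ζ ↦ η ⟨ξ, ζ⟩`. -/
def theta (η : F) (ξ : E) : Adjointable A E F :=
  ⟨{ toFun := fun ζ => η <• inner A ξ ζ
     map_add' := fun ζ ζ' => by rw [ip_add_right, rsmul_add]
     map_smul' := fun c ζ => by rw [ip_smul_right, rsmul_smul]; rfl },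
   fun ζ a => by
    change η <• inner A ξ (ζ <• a) = (η <• inner A ξ ζ) <• a
    rw [inner_rsmul_right, rsmul_mul],
   { toFun := fun ζ => ξ <• inner A η ζ
     map_add' := fun ζ ζ' => by rw [ip_add_right, rsmul_add]
     map_smul' := fun c ζ => by rw [ip_smul_right, rsmul_smul]; rfl },
   fun ζ a => by
    change ξ <• inner A η (ζ <• a) = (ξ <• inner A η ζ) <• a
    rw [inner_rsmul_right, rsmul_mul],
   fun ζ ζ' => by
    change inner A (η <• inner A ξ ζ) ζ' = inner A ζ (ξ <• inner A η ζ')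
    rw [inner_rsmul_left, inner_rsmul_right, star_inner]⟩

theorem theta_apply (η : F) (ξ ζ : E) : (theta η ξ : Adjointable A E F) ζ = η <• inner A ξ ζ := rfl

theorem adj_theta (η : F) (ξ : E) : (theta η ξ : Adjointable A E F).adj = theta ξ η :=
  (eq_adj fun ζ ζ' => by
    rw [theta_apply, theta_apply, inner_rsmul_left, inner_rsmul_right, star_inner]).symm

theorem comp_theta (S : Adjointable A F F') (η : F) (ξ : E) :
    S.comp (theta η ξ : Adjointable A E F) = theta (S η) ξ :=
  ext fun ζ => by rw [comp_apply, theta_apply, theta_apply, map_rsmul]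

/-- The operator seminorm on `L(E, F)` attached to `p`: the supremum of the `p`-seminorms of `T ξ`
over the `ξ` of `p`-seminorm at most one. It is the norm of the operator induced by `T` between the
quotients of `E` and `F` by the kernels of the `p`-seminorms. -/
def opNorm (p : CStarSeminorm A) (T : Adjointable A E F) : ENNReal :=
  ⨆ (ξ : E) (_ : modNorm p ξ ≤ 1), ENNReal.ofReal (modNorm p (T ξ))

theorem opNorm_le {p : CStarSeminorm A} {T : Adjointable A E F} {C : ℝ} (hC : 0 ≤ C)
    (h : ∀ ξ, modNorm p (T ξ) ≤ C * modNorm p ξ) : opNorm p T ≤ ENNReal.ofReal C :=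
  iSup₂_le fun ξ hξ => ENNReal.ofReal_le_ofReal
    ((h ξ).trans (mul_le_of_le_one_right hC hξ))

theorem le_opNorm {p : CStarSeminorm A} {T : Adjointable A E F} (hT : opNorm p T ≠ ⊤) (ξ : E) :
    modNorm p (T ξ) ≤ (opNorm p T).toReal * modNorm p ξ := by
  have h1 : ∀ ζ : E, modNorm p ζ ≤ 1 → modNorm p (T ζ) ≤ (opNorm p T).toReal := fun ζ hζ =>
    (ENNReal.ofReal_le_iff_le_toReal hT).1
      (le_iSup₂ (f := fun (ζ : E) (_ : modNorm p ζ ≤ 1) => ENNReal.ofReal (modNorm p (T ζ))) ζ hζ)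
  have h2 : ∀ t : ℝ, 0 ≤ t → t * modNorm p ξ ≤ 1 → t * modNorm p (T ξ) ≤ (opNorm p T).toReal := by
    intro t ht h
    have := h1 ((t : ℂ) • ξ) (by
      rwa [modNorm_smul, Complex.norm_real, Real.norm_of_nonneg ht])
    rwa [map_smul, modNorm_smul, Complex.norm_real, Real.norm_of_nonneg ht] at this
  rcases (modNorm_nonneg p ξ).eq_or_lt with h0 | h0
  · rw [← h0, mul_zero]
    by_contra hlt
    push Not at hlt
    have := h2 (((opNorm p T).toReal + 1) / modNorm p (T ξ)) (by positivity) (by simp [← h0])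
    rw [div_mul_cancel₀ _ hlt.ne'] at this
    linarith
  · have := h2 (modNorm p ξ)⁻¹ (by positivity) (by rw [inv_mul_cancel₀ h0.ne'])
    rwa [inv_mul_le_iff₀ h0, mul_comm] at this

theorem opNorm_zero (p : CStarSeminorm A) : opNorm p (0 : Adjointable A E F) = 0 := by
  simp [opNorm, zero_apply, modNorm_zero]

theorem opNorm_neg (p : CStarSeminorm A) (T : Adjointable A E F) : opNorm p (-T) = opNorm p T := by
  simp [opNorm, neg_apply, modNorm_neg]

theorem opNorm_add_le (p : CStarSeminorm A) (S T : Adjointable A E F) :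
    opNorm p (S + T) ≤ opNorm p S + opNorm p T :=
  iSup₂_le fun ξ hξ => by
    rw [add_apply]
    refine (ENNReal.ofReal_le_ofReal (modNorm_add_le p _ _)).trans ?_
    rw [ENNReal.ofReal_add (modNorm_nonneg p _) (modNorm_nonneg p _)]
    exact add_le_add
      (le_iSup₂ (f := fun (ζ : E) (_ : modNorm p ζ ≤ 1) => ENNReal.ofReal (modNorm p (S ζ))) ξ hξ)
      (le_iSup₂ (f := fun (ζ : E) (_ : modNorm p ζ ≤ 1) => ENNReal.ofReal (modNorm p (T ζ))) ξ hξ)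

theorem opNorm_smul_le (p : CStarSeminorm A) (c : ℂ) (T : Adjointable A E F) :
    opNorm p (c • T) ≤ ‖c‖₊ * opNorm p T :=
  iSup₂_le fun ξ hξ => by
    rw [smul_apply, modNorm_smul, ENNReal.ofReal_mul (norm_nonneg c), ofReal_norm]
    exact mul_le_mul_right
      (le_iSup₂ (f := fun (ζ : E) (_ : modNorm p ζ ≤ 1) => ENNReal.ofReal (modNorm p (T ζ))) ξ hξ) _

theorem opNorm_comp_le (p : CStarSeminorm A) {S : Adjointable A F F'} (hS : opNorm p S ≠ ⊤)
    (T : Adjointable A E F) : opNorm p (S.comp T) ≤ (opNorm p S).toNNReal * opNorm p T :=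
  iSup₂_le fun ξ hξ => by
    rw [comp_apply]
    refine (ENNReal.ofReal_le_ofReal (le_opNorm hS _)).trans ?_
    rw [ENNReal.ofReal_mul ENNReal.toReal_nonneg, ENNReal.ofReal_toReal hS,
      ENNReal.coe_toNNReal hS]
    exact mul_le_mul_right
      (le_iSup₂ (f := fun (ζ : E) (_ : modNorm p ζ ≤ 1) => ENNReal.ofReal (modNorm p (T ζ))) ξ hξ) _

theorem opNorm_adj_le (p : CStarSeminorm A) (T : Adjointable A E F) :
    opNorm p T.adj ≤ opNorm p T := by
  by_cases hT : opNorm p T = ⊤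
  · simp [hT]
  rw [← ENNReal.ofReal_toReal hT]
  refine opNorm_le ENNReal.toReal_nonneg fun η => ?_
  have h1 : modNorm p (T.adj η) ^ 2 ≤ modNorm p (T (T.adj η)) * modNorm p η := by
    rw [modNorm_sq, ← inner_apply_left]
    exact cauchy_schwarz p _ _
  have h2 := le_opNorm hT (T.adj η)
  have h3 := modNorm_nonneg p η
  rcases (modNorm_nonneg p (T.adj η)).eq_or_lt with h0 | h0
  · rw [← h0]; positivity
  · refine le_of_mul_le_mul_right ?_ h0
    nlinarith

theorem opNorm_theta_ne_top (p : CStarSeminorm A) (η : F) (ξ : E) :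
    opNorm p (theta η ξ : Adjointable A E F) ≠ ⊤ := by
  refine ((opNorm_le (mul_nonneg (modNorm_nonneg p η) (modNorm_nonneg p ξ)) fun ζ => ?_).trans_lt
    ENNReal.ofReal_lt_top).ne
  rw [theta_apply, mul_assoc]
  exact (modNorm_rsmul_le p _ _).trans
    (mul_le_mul_of_nonneg_left (cauchy_schwarz p _ _) (modNorm_nonneg p η))

variable (E F) in
/-- The (pseudo-)distance `(S, T) ↦ ‖S - T‖_p` on `L(E, F)`. -/
@[reducible]
def opDist (p : CStarSeminorm A) : PseudoEMetricSpace (Adjointable A E F) where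
  edist S T := opNorm p (S - T)
  edist_self T := by rw [sub_self, opNorm_zero]
  edist_comm S T := by rw [← opNorm_neg, neg_sub]
  edist_triangle S T R := by
    rw [← sub_add_sub_cancel S T R]
    exact opNorm_add_le p _ _

theorem isUniformAddGroup_opDist (p : CStarSeminorm A) :
    @IsUniformAddGroup (Adjointable A E F) (opDist E F p).toUniformSpace _ := by
  let _ := opDist E F p
  refine ⟨EMetric.uniformContinuous_iff.2 fun ε hε => ⟨ε / 2, ENNReal.half_pos hε.ne', ?_⟩⟩
  rintro ⟨S, T⟩ ⟨S', T'⟩ h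
  rw [Prod.edist_eq, max_lt_iff] at h
  change opNorm _ (S - T - (S' - T')) < ε
  have e : S - T - (S' - T') = (S - S') + -(T - T') := by abel
  rw [e]
  refine (opNorm_add_le _ _ _).trans_lt ?_
  rw [opNorm_neg, ← ENNReal.add_halves ε]
  exact ENNReal.add_lt_add h.1 h.2

/-- The topology (and uniformity) of `L(E, F)` is given by the operator seminorms attached to the
continuous C⋆-seminorms of `A`. -/
instance : UniformSpace (Adjointable A E F) :=
  ⨅ p : ContCStarSeminorm A, (opDist E F p.toCStarSeminorm).toUniformSpace

theorem continuous_of_bound (f : Adjointable A E F →+ Adjointable A E' F')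
    (h : ∀ p : ContCStarSeminorm A, ∃ C : NNReal,
      ∀ T, opNorm p.toCStarSeminorm (f T) ≤ C * opNorm p.toCStarSeminorm T) :
    Continuous f := by
  refine UniformContinuous.continuous (uniformContinuous_iInf_rng.2 fun p => ?_)
  refine uniformContinuous_iInf_dom (i := p) ?_
  obtain ⟨C, hC⟩ := h p
  let _ := opDist E F p.toCStarSeminorm
  let _ := opDist E' F' p.toCStarSeminorm
  refine LipschitzWith.uniformContinuous (K := C) fun S T => ?_
  change opNorm _ (f S - f T) ≤ C * opNorm _ (S - T)
  rw [← _root_.map_sub]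
  exact hC _

instance : IsUniformAddGroup (Adjointable A E F) :=
  isUniformAddGroup_iInf fun p => isUniformAddGroup_opDist p.toCStarSeminorm

instance : ContinuousConstSMul ℂ (Adjointable A E F) :=
  ⟨fun c => continuous_of_bound (DistribSMul.toAddMonoidHom (Adjointable A E F) c)
    fun _ => ⟨‖c‖₊, opNorm_smul_le _ c⟩⟩

end Adjointable

open Adjointable

/-- `Θ(E, F)`: the span of the rank one operators. -/
def finiteRank : Submodule ℂ (Adjointable A E F) :=
  Submodule.span ℂ {T | ∃ (η : F) (ξ : E), T = theta η ξ}

/-- `K(E, F)`: the closure of `Θ(E, F)` in `L(E, F)`. -/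
def compacts : Submodule ℂ (Adjointable A E F) := (finiteRank A E F).topologicalClosure

/-- `K(E, F)` as a type, with the topology inherited from `L(E, F)`. -/
abbrev CompactOp : Type _ := compacts A E F

variable {A E F}

theorem opNorm_ne_top_of_finiteRank (p : CStarSeminorm A) {T : Adjointable A E F}
    (hT : T ∈ finiteRank A E F) : opNorm p T ≠ ⊤ := by
  refine Submodule.span_induction (p := fun T _ => opNorm p T ≠ ⊤) ?_ ?_ ?_ ?_ hT
  · rintro _ ⟨η, ξ, rfl⟩
    exact opNorm_theta_ne_top p η ξ
  · simp [opNorm_zero]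
  · intro S T _ _ hS hT
    exact ((opNorm_add_le p S T).trans_lt (ENNReal.add_lt_top.2 ⟨hS.lt_top, hT.lt_top⟩)).ne
  · intro c T _ hT
    exact ((opNorm_smul_le p c T).trans_lt (ENNReal.mul_lt_top (by simp) hT.lt_top)).ne

theorem opNorm_ne_top (p : ContCStarSeminorm A) {T : Adjointable A E F}
    (hT : T ∈ compacts A E F) : opNorm p.toCStarSeminorm T ≠ ⊤ := by
  have hU : {S : Adjointable A E F | opNorm p.toCStarSeminorm (S - T) < 1} ∈ 𝓝 T := by
    have h1 : (instUniformSpace : UniformSpace (Adjointable A E F)) ≤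
      (opDist E F p.toCStarSeminorm).toUniformSpace := iInf_le _ p
    refine nhds_mono (UniformSpace.toTopologicalSpace_mono h1) ?_
    let _ := opDist E F p.toCStarSeminorm
    exact Metric.eball_mem_nhds T one_pos
  obtain ⟨S, hS, hS'⟩ := mem_closure_iff_nhds.1 hT _ hU
  have e : T = S + -(S - T) := by abel
  rw [e]
  refine ((opNorm_add_le _ _ _).trans_lt (ENNReal.add_lt_top.2
    ⟨(opNorm_ne_top_of_finiteRank _ hS').lt_top, ?_⟩)).ne
  rw [opNorm_neg]
  exact lt_trans hS ENNReal.one_lt_top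

theorem theta_mem_compacts (η : F) (ξ : E) : theta η ξ ∈ compacts A E F :=
  Submodule.le_topologicalClosure _ (Submodule.subset_span ⟨η, ξ, rfl⟩)

theorem continuous_comp_left {S : Adjointable A F F'} (hS : S ∈ compacts A F F') :
    Continuous fun T : Adjointable A E F => S.comp T :=
  continuous_of_bound (AddMonoidHom.mk' (fun T : Adjointable A E F => S.comp T)
    fun T T' => Adjointable.ext fun ξ => S.map_add (T ξ) (T' ξ))
    fun p => ⟨(opNorm p.toCStarSeminorm S).toNNReal, opNorm_comp_le _ (opNorm_ne_top p hS)⟩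

theorem comp_mem_compacts {S : Adjointable A F F'} {T : Adjointable A E F}
    (hS : S ∈ compacts A F F') (hT : T ∈ compacts A E F) : S.comp T ∈ compacts A E F' := by
  let f : Adjointable A E F →ₗ[ℂ] Adjointable A E F' :=
    { toFun := fun T => S.comp T
      map_add' := fun T T' => Adjointable.ext fun ξ => S.map_add (T ξ) (T' ξ)
      map_smul' := fun c T => Adjointable.ext fun ξ => S.map_smul c (T ξ) }
  have hf : Continuous f := continuous_comp_left hS
  refine map_mem_closure hf hT fun R hR => ?_
  have : finiteRank A E F ≤ (finiteRank A E F').comap f := by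
    refine Submodule.span_le.2 ?_
    rintro _ ⟨η, ξ, rfl⟩
    exact Submodule.subset_span ⟨S η, ξ, comp_theta S η ξ⟩
  exact this hR

theorem adj_mem_compacts {T : Adjointable A E F} (hT : T ∈ compacts A E F) :
    T.adj ∈ compacts A F E := by
  let f : Adjointable A E F →+ Adjointable A F E := AddMonoidHom.mk' adj adj_add
  have hf : Continuous f := continuous_of_bound f fun p =>
    ⟨1, fun T => by rw [ENNReal.coe_one, one_mul]; exact opNorm_adj_le _ T⟩
  refine map_mem_closure hf hT fun R hR => ?_
  refine Submodule.span_induction (p := fun R _ => R.adj ∈ finiteRank A F E) ?_ ?_ ?_ ?_ hR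
  · rintro _ ⟨η, ξ, rfl⟩
    exact Submodule.subset_span ⟨ξ, η, adj_theta η ξ⟩
  · have : (0 : Adjointable A E F).adj = 0 := f.map_zero
    rw [this]; exact Submodule.zero_mem _
  · intro S T _ _ hS hT
    rw [adj_add]; exact Submodule.add_mem _ hS hT
  · intro c T _ hT
    rw [adj_smul]; exact Submodule.smul_mem _ _ hT

namespace CompactOp

/-- `θ_{η, ξ}` as an element of `K(E, F)`. -/
def theta (η : F) (ξ : E) : CompactOp A E F := ⟨Adjointable.theta η ξ, theta_mem_compacts η ξ⟩

/-- Composition `K(F, F') × K(E, F) → K(E, F')`. -/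
def comp (S : CompactOp A F F') (T : CompactOp A E F) : CompactOp A E F' :=
  ⟨S.1.comp T.1, comp_mem_compacts S.2 T.2⟩

/-- The adjoint `K(E, F) → K(F, E)`. -/
def adj (T : CompactOp A E F) : CompactOp A F E := ⟨T.1.adj, adj_mem_compacts T.2⟩

@[ext]
theorem ext {S T : CompactOp A E F} (h : ∀ ξ, S.1 ξ = T.1 ξ) : S = T :=
  Subtype.ext (Adjointable.ext h)

instance : Mul (CompactOp A E E) := ⟨comp⟩

/-- `K(E)` is a ring under composition. -/
instance : NonUnitalRing (CompactOp A E E) where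
  __ := (inferInstance : AddCommGroup (CompactOp A E E))
  __ := (inferInstance : Mul (CompactOp A E E))
  zero_mul _ := ext fun _ => rfl
  mul_zero S := ext fun _ => S.1.1.map_zero
  mul_assoc _ _ _ := ext fun _ => rfl
  left_distrib S T T' := ext fun ξ => S.1.map_add (T.1 ξ) (T'.1 ξ)
  right_distrib _ _ _ := ext fun _ => rfl

/-- The involution of `K(E)` is the adjoint. -/
instance : StarRing (CompactOp A E E) where
  star := adj
  star_involutive T := Subtype.ext T.1.adj_adj
  star_mul S T := Subtype.ext (adj_comp S.1 T.1)
  star_add S T := Subtype.ext (adj_add S.1 T.1)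

/-- The right action of `K(E)` on `K(E, A)` is composition. -/
instance : SMul (CompactOp A E E)ᵐᵒᵖ (CompactOp A E A) := ⟨fun k T => T.comp k.unop⟩

/-- The `K(E)`-valued inner product of `K(E, A)` is `⟨S, T⟩ = S⋆ T`. -/
instance : Inner (CompactOp A E E) (CompactOp A E A) := ⟨fun S T => S.adj.comp T⟩

end CompactOp

end Operators

section Actions

/-- The group of automorphisms of the locally C⋆-algebra `A`: the ⋆-isomorphisms of `A` onto itself
that are continuous along with their inverses. -/
def AlgAut (A : Type*) [NonUnitalRing A] [StarRing A] [Module ℂ A] [TopologicalSpace A] :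
    Subgroup (A ≃⋆ₐ[ℂ] A) where
  carrier := {f | Continuous f ∧ Continuous f.symm}
  mul_mem' := fun hf hg => ⟨hf.1.comp hg.1, hg.2.comp hf.2⟩
  one_mem' := ⟨continuous_id, continuous_id⟩
  inv_mem' := fun hf => ⟨hf.2, hf.1⟩

/-- `u : E → F` is a morphism of Hilbert modules (over `A` and `B`) if there is a morphism
`α : A → B` of locally C⋆-algebras with `⟨u ξ, u η⟩ = α ⟨ξ, η⟩`. -/
def IsHilbertMorphism (A B : Type*) {E F : Type*} [NonUnitalRing A] [StarRing A] [Module ℂ A]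
    [TopologicalSpace A] [NonUnitalRing B] [StarRing B] [Module ℂ B] [TopologicalSpace B]
    [Inner A E] [Inner B F] (u : E → F) : Prop :=
  ∃ α : A →⋆ₙₐ[ℂ] B, Continuous α ∧ ∀ ξ η : E, inner B (u ξ) (u η) = α (inner A ξ η)

variable (A E : Type*) [NonUnitalRing A] [StarRing A] [Module ℂ A] [TopologicalSpace A] [Inner A E]

/-- `Aut(E)`: the bijections `u` of `E` such that `u` and `u⁻¹` are morphisms of Hilbert
modules. -/
def HilbertAut : Subgroup (Equiv.Perm E) where
  carrier := {u | IsHilbertMorphism A A u ∧ IsHilbertMorphism A A u.symm}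
  mul_mem' := by
    rintro u v ⟨⟨α, hα, h⟩, α', hα', h'⟩ ⟨⟨β, hβ, k⟩, β', hβ', k'⟩
    exact ⟨⟨α.comp β, hα.comp hβ, fun ξ η => by simp [h, k]⟩,
      ⟨β'.comp α', hβ'.comp hα', fun ξ η => by
        change inner A (v.symm (u.symm ξ)) (v.symm (u.symm η)) = _
        simp [h', k']⟩⟩
  one_mem' := ⟨⟨NonUnitalStarAlgHom.id ℂ A, continuous_id, fun _ _ => rfl⟩,
    ⟨NonUnitalStarAlgHom.id ℂ A, continuous_id, fun _ _ => rfl⟩⟩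
  inv_mem' := fun h => ⟨h.2, h.1⟩

/-- An action of `G` on the Hilbert `A`-module `E` is a group homomorphism `G → Aut(E)`. -/
abbrev HilbertAction (G : Type*) [Group G] : Type _ := G →* HilbertAut A E

/-- An action of `G` on the locally C⋆-algebra `A` is a group homomorphism `G → Aut(A)`. -/
abbrev AlgAction (G A : Type*) [Group G] [NonUnitalRing A] [StarRing A] [Module ℂ A]
    [TopologicalSpace A] : Type _ := G →* AlgAut A

end Actions

set_option linter.checkUnivs false in
/-- An inverse system of Hilbert C⋆-modules `mod i` over C⋆-algebras `alg i`, indexed by `Λ`. -/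
structure HilbertSystem.{uΛ, uA, uE} (Λ : Type uΛ) [Preorder Λ] where
  alg : Λ → Type uA
  mod : Λ → Type uE
  [cstar : ∀ i, NonUnitalCStarAlgebra (alg i)]
  [addCommGroup : ∀ i, AddCommGroup (mod i)]
  [module : ∀ i, Module ℂ (mod i)]
  [rsmul : ∀ i, SMul (alg i)ᵐᵒᵖ (mod i)]
  [innerProd : ∀ i, Inner (alg i) (mod i)]
  [uniformSpace : ∀ i, UniformSpace (mod i)]
  [hilbert : ∀ i, IsHilbertModule (alg i) (mod i)]
  algMap : ∀ {i j : Λ}, i ≤ j → alg j →⋆ₙₐ[ℂ] alg i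
  modMap : ∀ {i j : Λ}, i ≤ j → mod j →ₗ[ℂ] mod i
  algMap_refl : ∀ i (a : alg i), algMap (le_refl i) a = a
  algMap_comp : ∀ {i j k} (hij : i ≤ j) (hjk : j ≤ k) (a : alg k),
    algMap hij (algMap hjk a) = algMap (hij.trans hjk) a
  modMap_refl : ∀ i (ξ : mod i), modMap (le_refl i) ξ = ξ
  modMap_comp : ∀ {i j k} (hij : i ≤ j) (hjk : j ≤ k) (ξ : mod k),
    modMap hij (modMap hjk ξ) = modMap (hij.trans hjk) ξ
  modMap_rsmul : ∀ {i j} (hij : i ≤ j) (ξ : mod j) (a : alg j),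
    modMap hij (ξ <• a) = modMap hij ξ <• algMap hij a
  inner_modMap : ∀ {i j} (hij : i ≤ j) (ξ η : mod j),
    inner (alg i) (modMap hij ξ) (modMap hij η) = algMap hij (inner (alg j) ξ η)

attribute [instance] HilbertSystem.cstar HilbertSystem.addCommGroup HilbertSystem.module
  HilbertSystem.rsmul HilbertSystem.innerProd HilbertSystem.uniformSpace HilbertSystem.hilbert

/-- An identification of the locally C⋆-algebra `A` and of the Hilbert `A`-module `E` with the
inverse limits of an inverse system of Hilbert C⋆-modules. The maps `a ↦ (π i a)ᵢ` and
`ξ ↦ (σ i ξ)ᵢ` are bijections onto the sets of coherent families, homeomorphic for the product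
topologies, and respect the algebraic structure. -/
structure HilbertSystem.Limit {Λ : Type*} [Preorder Λ] (D : HilbertSystem Λ) (A E : Type*)
    [NonUnitalRing A] [StarRing A] [Module ℂ A] [TopologicalSpace A]
    [AddCommGroup E] [Module ℂ E] [SMul Aᵐᵒᵖ E] [Inner A E] [TopologicalSpace E] where
  π : ∀ i, A →⋆ₙₐ[ℂ] D.alg i
  σ : ∀ i, E →ₗ[ℂ] D.mod i
  algMap_π : ∀ {i j} (hij : i ≤ j) (a : A), D.algMap hij (π j a) = π i a
  modMap_σ : ∀ {i j} (hij : i ≤ j) (ξ : E), D.modMap hij (σ j ξ) = σ i ξ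
  σ_rsmul : ∀ i (ξ : E) (a : A), σ i (ξ <• a) = σ i ξ <• π i a
  inner_σ : ∀ i (ξ η : E), inner (D.alg i) (σ i ξ) (σ i η) = π i (inner A ξ η)
  existsUnique_alg : ∀ x : ∀ i, D.alg i, (∀ i j (hij : i ≤ j), D.algMap hij (x j) = x i) →
    ∃! a : A, ∀ i, π i a = x i
  existsUnique_mod : ∀ x : ∀ i, D.mod i, (∀ i j (hij : i ≤ j), D.modMap hij (x j) = x i) →
    ∃! ξ : E, ∀ i, σ i ξ = x i
  isInducing_alg : IsInducing fun (a : A) (i : Λ) => π i a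
  isInducing_mod : IsInducing fun (ξ : E) (i : Λ) => σ i ξ

section Limits

universe uA uE

variable {A : Type uA} {E : Type uE} [NonUnitalRing A] [StarRing A] [Module ℂ A]
  [TopologicalSpace A] [AddCommGroup E] [Module ℂ E] [SMul Aᵐᵒᵖ E] [Inner A E]
  [TopologicalSpace E] {G : Type*} [Group G]

/-- The action `u` is continuous if `g ↦ u g ξ` is continuous for each `ξ`. -/
def IsContinuousAction [TopologicalSpace G] (u : HilbertAction A E G) : Prop :=
  ∀ ξ : E, Continuous fun g => (u g).1 ξ

/-- The action `u` is an inverse limit action if `E` can be written as the inverse limit of Hilbert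
C⋆-modules over a directed set in such a way that `u` is the inverse limit of actions `v i` on
these. -/
def IsInverseLimitAction (u : HilbertAction A E G) : Prop :=
  ∃ (Λ : Type uA) (_ : Preorder Λ) (_ : IsDirectedOrder Λ) (_ : Nonempty Λ)
    (D : HilbertSystem.{uA, uA, uE} Λ) (L : D.Limit A E)
    (v : ∀ i, HilbertAction (D.alg i) (D.mod i) G),
    (∀ {i j} (hij : i ≤ j) (g : G) (x : D.mod j),
      D.modMap hij ((v j g).1 x) = (v i g).1 (D.modMap hij x)) ∧
    ∀ i (g : G) (ξ : E), L.σ i ((u g).1 ξ) = (v i g).1 (L.σ i ξ)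

end Limits

end

/-! The action is conjugation: `T` goes to `α_g T u_g⁻¹`, where `α_g` is the automorphism of `A`
induced by `u_g`. A bijection that multiplies inner products by a morphism is automatically linear
and compatible with the right action, since inner products separate points (`IsCovariant`). Hence
the conjugate of `T` is again adjointable, `θ_{a,ξ}` is sent to `θ_{α_g(a),u_g(ξ)}`, and `S⋆T` is
sent to its conjugate by `u_g`. For uniqueness, an automorphism of the Hilbert module `K(E, A)` is
linear and continuous, so its values on rank one operators determine it
(`CompactOp.hilbertAut_ext`).

Two facts about `K(E)` are not formal. First, for `T` in `K(E, A)` the operator `T⋆T` must be of the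
form `b⋆b` with `b` in `K(E)`. Positivity in a C⋆-algebra is detected by a norm inequality
(`exists_eq_star_mul_self`), which `CompactOp.knorm_star_mul_self_le` verifies for `T⋆T`; this gives
positivity in each completion of `K(E)`. Positive square roots there are unique, hence coherent,
hence come from one element of the inverse limit (`IsLocallyCStarAlgebra.exists_eq_star_mul_self`).
Second, operator seminorms for different `p` are suprema over different balls and are not comparable
at sight. `CompactOp.knorm_mono` compares them by a spectral radius argument on the powers
`(T⋆T)^(2^n)`, which also removes multiplicative constants.

For the inverse limit property, write `π_i : A → A_i` for the projections. Each `α_g` is covered by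
a morphism of the C⋆-algebra `A_i`, which is contractive, so the seminorms `‖π_i(·)‖` are invariant
under `α` (`IsInverseLimitAction.exists_invariant_family`). Their operator seminorms generate the
topology of `K(E)` and are invariant under conjugation. Any action whose invariant C⋆-seminorms
generate the topology is the limit of the actions on the corresponding completions
(`isInverseLimitAction_of_invariant`).

For continuity, invariance of a generating family makes the set of points with continuous orbit map
closed, so rank one operators suffice. There `θ_{a,ξ}` is the operator `ζ ↦ ⟨ξa⋆, ζ⟩`, so its orbit
is the image of `g ↦ u_g(ξa⋆)` under a continuous map; continuity of `g ↦ α_g(a)` is never needed.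
-/

noncomputable section

set_option linter.unusedSectionVars false

/-! ### Topology of Hilbert modules. -/

namespace IsHilbertModule

variable {A E : Type*} [NonUnitalRing A] [StarRing A] [Module ℂ A] [UniformSpace A]
  [IsLocallyCStarAlgebra A]
  [AddCommGroup E] [Module ℂ E] [SMul Aᵐᵒᵖ E] [Inner A E] [UniformSpace E] [IsHilbertModule A E]

/-- `modNorm p` as a seminorm. -/
def modSeminorm (p : CStarSeminorm A) : Seminorm ℂ E :=
  Seminorm.of (modNorm p) (modNorm_add_le p) (modNorm_smul p)

theorem modNorm_sub_rev (p : CStarSeminorm A) (ξ η : E) :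
    modNorm p (ξ - η) = modNorm p (η - ξ) := by
  rw [← modNorm_neg, neg_sub]

theorem modNorm_self (p : CStarSeminorm A) (a : A) : modNorm p a = p a := by
  rw [modNorm, inner_self_def, p.star_mul_self', Real.sqrt_sq (p.nonneg a)]

theorem tendsto_zero_iff {ι : Type*} {l : Filter ι} {f : ι → E} :
    Tendsto f l (𝓝 0) ↔
      ∀ p : ContCStarSeminorm A, Tendsto (fun i => modNorm p.toCStarSeminorm (f i)) l (𝓝 0) := by
  rw [nhds_zero (A := A), tendsto_iInf]
  simp only [tendsto_comap_iff, Function.comp_def]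

theorem continuous_modNorm (p : ContCStarSeminorm A) :
    Continuous (modNorm p.toCStarSeminorm : E → ℝ) := by
  have := isUniformAddGroup (A := A) (E := E)
  refine Seminorm.continuous_of_continuousAt_zero (p := modSeminorm (E := E) p.toCStarSeminorm) ?_
  rw [ContinuousAt, map_zero]
  exact (tendsto_zero_iff (A := A)).1 tendsto_id p

/-- Separation is inherited from `A`: the constant sequence `⟨ξ, ξ⟩` tends to `0` in the Hausdorff
space `A`, hence vanishes, and definiteness passes this on to `ξ`. -/
theorem eq_zero_of_modNorm {ξ : E}
    (h : ∀ p : ContCStarSeminorm A, modNorm p.toCStarSeminorm ξ = 0) : ξ = 0 := by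
  rw [← inner_self_eq_zero (A := A), ← inner_self_eq_zero (A := A)]
  have h1 : Tendsto (fun _ : ℕ => inner A ξ ξ) atTop (𝓝 0) := by
    rw [tendsto_zero_iff (A := A)]
    intro p
    rw [modNorm_self, ← modNorm_sq, h]
    simp
  rw [tendsto_nhds_unique tendsto_const_nhds h1]
  simp [inner_self_def]

theorem t2Space (A E : Type*) [NonUnitalRing A] [StarRing A] [Module ℂ A] [UniformSpace A]
    [IsLocallyCStarAlgebra A] [AddCommGroup E] [Module ℂ E] [SMul Aᵐᵒᵖ E] [Inner A E]
    [UniformSpace E] [IsHilbertModule A E] : T2Space E := by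
  have := isUniformAddGroup (A := A) (E := E)
  refine IsTopologicalAddGroup.t2Space_of_zero_sep fun ξ hξ => ?_
  have : ∃ p : ContCStarSeminorm A, modNorm p.toCStarSeminorm ξ ≠ 0 := by
    by_contra! h
    exact hξ (eq_zero_of_modNorm h)
  obtain ⟨p, hp⟩ := this
  -- The separating neighbourhood of `0` is the set where the seminorm differs from its nonzero
  -- value at `ξ`.
  refine ⟨_, ((continuous_modNorm p).tendsto (0 : E)).eventually_ne
    (b₂ := modNorm p.toCStarSeminorm ξ) ?_, fun h => h rfl⟩
  rw [modNorm_zero]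
  exact hp.symm

theorem continuous_inner_right (ξ : E) : Continuous fun η : E => inner A ξ η := by
  have := isUniformAddGroup (A := A) (E := E)
  refine continuous_of_continuousAt_zero
    (AddMonoidHom.mk' (fun η : E => inner A ξ η) (ip_add_right ξ)) ?_
  rw [ContinuousAt, map_zero, tendsto_zero_iff (A := A)]
  intro p
  refine squeeze_zero (fun _ => modNorm_nonneg _ _)
    (fun η => (modNorm_self _ _).trans_le (cauchy_schwarz _ ξ η)) ?_
  simpa using ((tendsto_zero_iff (A := A)).1 tendsto_id p).const_mul (modNorm p.toCStarSeminorm ξ)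

theorem continuous_inner_left (ξ : E) : Continuous fun η : E => inner A η ξ := by
  have := isUniformAddGroup (A := A) (E := E)
  refine continuous_of_continuousAt_zero
    (AddMonoidHom.mk' (fun η : E => inner A η ξ) (ip_add_left · · ξ)) ?_
  rw [ContinuousAt, map_zero, tendsto_zero_iff (A := A)]
  intro p
  refine squeeze_zero (fun _ => modNorm_nonneg _ _)
    (fun η => (modNorm_self _ _).trans_le (cauchy_schwarz _ η ξ)) ?_
  simpa using ((tendsto_zero_iff (A := A)).1 tendsto_id p).mul_const (modNorm p.toCStarSeminorm ξ)

theorem continuous_rsmul_const (a : A) : Continuous fun ξ : E => ξ <• a := by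
  have := isUniformAddGroup (A := A) (E := E)
  refine continuous_of_continuousAt_zero
    (AddMonoidHom.mk' (fun ξ : E => ξ <• a) (add_rsmul · · a)) ?_
  rw [ContinuousAt, map_zero, tendsto_zero_iff (A := A)]
  intro p
  refine squeeze_zero (fun _ => modNorm_nonneg _ _) (fun ξ => modNorm_rsmul_le _ ξ a) ?_
  simpa using ((tendsto_zero_iff (A := A)).1 tendsto_id p).mul_const (p.toCStarSeminorm a)

theorem continuousConstSMul (A E : Type*) [NonUnitalRing A] [StarRing A] [Module ℂ A]
    [UniformSpace A] [IsLocallyCStarAlgebra A] [AddCommGroup E] [Module ℂ E] [SMul Aᵐᵒᵖ E]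
    [Inner A E] [UniformSpace E] [IsHilbertModule A E] : ContinuousConstSMul ℂ E := by
  have := isUniformAddGroup (A := A) (E := E)
  refine ⟨fun c => continuous_of_continuousAt_zero (DistribSMul.toAddMonoidHom E c) ?_⟩
  rw [ContinuousAt, map_zero, tendsto_zero_iff (A := A)]
  intro p
  simp only [DistribSMul.toAddMonoidHom_apply, modNorm_smul]
  simpa using ((tendsto_zero_iff (A := A)).1 tendsto_id p).const_mul ‖c‖

end IsHilbertModule

/-! ### The space `L(E, F)` is Hausdorff and complete. -/

namespace Adjointable

open IsHilbertModule

variable {A E F F' : Type*} [NonUnitalRing A] [StarRing A] [Module ℂ A] [UniformSpace A]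
  [IsLocallyCStarAlgebra A]
  [AddCommGroup E] [Module ℂ E] [SMul Aᵐᵒᵖ E] [Inner A E] [UniformSpace E] [IsHilbertModule A E]
  [AddCommGroup F] [Module ℂ F] [SMul Aᵐᵒᵖ F] [Inner A F] [UniformSpace F] [IsHilbertModule A F]
  [AddCommGroup F'] [Module ℂ F'] [SMul Aᵐᵒᵖ F'] [Inner A F'] [UniformSpace F']
  [IsHilbertModule A F']

theorem ofReal_modNorm_le_opNorm {p : CStarSeminorm A} (T : Adjointable A E F) {ξ : E}
    (hξ : modNorm p ξ ≤ 1) : ENNReal.ofReal (modNorm p (T ξ)) ≤ opNorm p T :=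
  le_iSup₂ (f := fun (ζ : E) (_ : modNorm p ζ ≤ 1) => ENNReal.ofReal (modNorm p (T ζ))) ξ hξ

theorem nhds_zero_eq : 𝓝 (0 : Adjointable A E F) =
    ⨅ p : ContCStarSeminorm A, comap (opNorm p.toCStarSeminorm) (𝓝 0) := by
  change @nhds _ (⨅ p : ContCStarSeminorm A,
    (opDist E F p.toCStarSeminorm).toUniformSpace).toTopologicalSpace 0 = _
  rw [UniformSpace.toTopologicalSpace_iInf, nhds_iInf]
  refine iInf_congr fun p => ?_
  let _ := opDist E F p.toCStarSeminorm
  refine Metric.nhds_basis_eball.eq_of_same_basis ?_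
  have := (ENNReal.nhds_zero_basis).comap (opNorm p.toCStarSeminorm : Adjointable A E F → ENNReal)
  refine this.congr (fun _ => Iff.rfl) fun ε _ => ?_
  ext T
  change opNorm _ T < ε ↔ opNorm _ (T - 0) < ε
  rw [sub_zero]

theorem tendsto_zero_iff {ι : Type*} {l : Filter ι} {f : ι → Adjointable A E F} :
    Tendsto f l (𝓝 0) ↔
      ∀ p : ContCStarSeminorm A, Tendsto (fun i => opNorm p.toCStarSeminorm (f i)) l (𝓝 0) := by
  rw [nhds_zero_eq, tendsto_iInf]
  simp only [tendsto_comap_iff, Function.comp_def]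

variable (F) in
/-- Evaluation at `ξ`. -/
def evalHom (ξ : E) : Adjointable A E F →+ F :=
  AddMonoidHom.mk' (fun T => T ξ) fun S T => add_apply S T ξ

theorem continuous_eval (ξ : E) : Continuous fun T : Adjointable A E F => T ξ := by
  have := isUniformAddGroup (A := A) (E := F)
  refine continuous_of_continuousAt_zero (evalHom F ξ) ?_
  rw [ContinuousAt, map_zero, IsHilbertModule.tendsto_zero_iff (A := A)]
  intro p
  have h := (tendsto_zero_iff (E := E) (F := F)).1 tendsto_id p
  have h1 : Tendsto (fun T : Adjointable A E F => (opNorm p.toCStarSeminorm T).toReal) (𝓝 0)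
      (𝓝 0) := by
    exact (ENNReal.tendsto_toReal ENNReal.zero_ne_top).comp h
  have h2 := h1.mul_const (modNorm p.toCStarSeminorm ξ)
  rw [zero_mul] at h2
  -- The operator seminorm can be infinite on `L(E, F)`; it is finite near `0`, so the bound holds
  -- only eventually.
  refine squeeze_zero' (.of_forall fun _ => modNorm_nonneg _ _) ?_ h2
  filter_upwards [h.eventually (gt_mem_nhds ENNReal.zero_lt_top)] with T hT
  exact le_opNorm hT.ne ξ

theorem continuous_adj : Continuous (adj : Adjointable A E F → Adjointable A F E) :=
  continuous_of_bound (AddMonoidHom.mk' adj adj_add) fun p =>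
    ⟨1, fun T => by rw [ENNReal.coe_one, one_mul]; exact opNorm_adj_le _ T⟩

instance : T2Space (Adjointable A E F) := by
  have := t2Space A F
  refine IsTopologicalAddGroup.t2Space_of_zero_sep fun T hT => ?_
  have : ∃ ξ, T ξ ≠ 0 := by
    by_contra! h
    exact hT (ext h)
  obtain ⟨ξ, hξ⟩ := this
  refine ⟨_, ((continuous_eval (F := F) ξ).tendsto (0 : Adjointable A E F)).eventually_ne
    (b₂ := T ξ) ?_, fun h => h rfl⟩
  rw [zero_apply]
  exact hξ.symm

/-- A Cauchy filter converges pointwise, and so do the adjoints because taking adjoints is uniformly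
continuous. The two pointwise limits are adjoint to each other by continuity of the inner product in
each variable, so the limit stays adjointable. -/
instance : CompleteSpace (Adjointable A E F) := by
  have := isUniformAddGroup (A := A) (E := E)
  have := isUniformAddGroup (A := A) (E := F)
  have := completeSpace (A := A) (E := E)
  have := completeSpace (A := A) (E := F)
  have := t2Space A E
  have := t2Space A F
  have := continuousConstSMul A E
  have := continuousConstSMul A F
  refine ⟨fun {f} hf => ?_⟩
  have := hf.1
  have hT : ∀ ξ : E, ∃ η : F, Tendsto (fun T : Adjointable A E F => T ξ) f (𝓝 η) := fun ξ =>
    CompleteSpace.complete (hf.map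
      (uniformContinuous_addMonoidHom_of_continuous (f := evalHom F ξ) (continuous_eval ξ)))
  have hS : ∀ η : F, ∃ ξ : E, Tendsto (fun T : Adjointable A E F => T.adj η) f (𝓝 ξ) := fun η =>
    CompleteSpace.complete (hf.map (uniformContinuous_addMonoidHom_of_continuous
      (f := (evalHom E η).comp (AddMonoidHom.mk' (adj (A := A) (E := E) (F := F)) adj_add))
      ((continuous_eval η).comp continuous_adj)))
  choose t ht using hT
  choose s hs using hS
  let T₀ : Adjointable A E F :=
    ⟨{ toFun := t
       map_add' := fun ξ η => tendsto_nhds_unique (ht (ξ + η)) <| by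
         simpa only [map_add] using (ht ξ).add (ht η)
       map_smul' := fun c ξ => tendsto_nhds_unique (ht (c • ξ)) <| by
         simpa only [map_smul, RingHom.id_apply] using (ht ξ).const_smul c },
     fun ξ a => tendsto_nhds_unique (ht (ξ <• a)) <| by
       simp only [map_rsmul]
       exact ((continuous_rsmul_const a).tendsto _).comp (ht ξ),
     { toFun := s
       map_add' := fun ξ η => tendsto_nhds_unique (hs (ξ + η)) <| by
         simpa only [map_add] using (hs ξ).add (hs η)
       map_smul' := fun c ξ => tendsto_nhds_unique (hs (c • ξ)) <| by
         simpa only [map_smul, RingHom.id_apply] using (hs ξ).const_smul c },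
     fun ξ a => tendsto_nhds_unique (hs (ξ <• a)) <| by
       simp only [map_rsmul]
       exact ((continuous_rsmul_const a).tendsto _).comp (hs ξ),
     fun ξ η => tendsto_nhds_unique
         (((continuous_inner_left (A := A) η).tendsto _).comp (ht ξ)) <| by
       simp only [Function.comp_def, inner_apply_left]
       exact ((continuous_inner_right (A := A) ξ).tendsto _).comp (hs η)⟩
  refine ⟨T₀, ?_⟩
  change Tendsto id f (𝓝 T₀)
  rw [← tendsto_sub_nhds_zero_iff, tendsto_zero_iff]
  intro p
  have hc : Tendsto (fun x : Adjointable A E F × Adjointable A E F => x.2 - x.1) (f ×ˢ f) (𝓝 0) := by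
    have := hf.2
    rwa [uniformity_eq_comap_nhds_zero, ← tendsto_iff_comap] at this
  rw [tendsto_zero_iff] at hc
  rw [ENNReal.tendsto_nhds_zero]
  intro ε hε
  -- For most `S`, most `T` are within `ε` of `S`. Fixing `S` and a vector of the unit ball, the
  -- limit in `T` keeps the bound, with `ε` independent of the vector.
  have h1 := ((ENNReal.tendsto_nhds_zero.1 (hc p)) ε hε).curry
  filter_upwards [h1] with S hS
  refine iSup₂_le fun ξ hξ => ?_
  have h2 : Tendsto (fun T : Adjointable A E F =>
      ENNReal.ofReal (modNorm p.toCStarSeminorm (T ξ - S ξ))) f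
      (𝓝 (ENNReal.ofReal (modNorm p.toCStarSeminorm (t ξ - S ξ)))) :=
    (ENNReal.continuous_ofReal.tendsto _).comp (((continuous_modNorm p).tendsto _).comp
      ((ht ξ).sub_const (S ξ)))
  have h3 : (id S - T₀ : Adjointable A E F) ξ = S ξ - t ξ := rfl
  rw [h3, modNorm_sub_rev]
  refine le_of_tendsto h2 ?_
  filter_upwards [hS] with T hT
  exact (ofReal_modNorm_le_opNorm (T - S) hξ).trans hT

theorem opNorm_adj (p : CStarSeminorm A) (T : Adjointable A E F) : opNorm p T.adj = opNorm p T :=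
  le_antisymm (opNorm_adj_le p T) (by simpa only [adj_adj] using opNorm_adj_le p T.adj)

end Adjointable

/-! ### Operator seminorms on compact operators; `K(E)` as a locally C⋆-algebra. -/

/-- Numerical core of the spectral radius argument. Iterating the first bound gives `(x 0 / t)^(2^n)
≤ x n / t ≤ (D / t) r^(2^n)`. If `x 0 / t` exceeded `r`, the left side would outgrow the right,
whatever the constant `D`. -/
theorem le_mul_of_sq_le_of_le_pow {x : ℕ → ℝ} {t r D : ℝ} (hx : ∀ n, 0 ≤ x n) (ht : 0 ≤ t)
    (hr : 0 ≤ r) (h : ∀ n, x n ^ 2 ≤ t * x (n + 1)) (hD : ∀ n, x n ≤ D * r ^ 2 ^ n) :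
    x 0 ≤ r * t := by
  rcases ht.eq_or_lt with rfl | ht
  · have := h 0
    nlinarith [hx 0]
  have key : ∀ n, (x 0 / t) ^ 2 ^ n ≤ x n / t := by
    intro n
    induction n with
    | zero => simp
    | succ n ih =>
      rw [pow_succ 2, pow_mul]
      refine (pow_le_pow_left₀ (pow_nonneg (div_nonneg (hx 0) ht.le) _) ih 2).trans ?_
      rw [div_pow, sq t, ← div_div, div_le_div_iff_of_pos_right ht, div_le_iff₀' ht]
      exact h n
  have key' : ∀ n, (x 0 / t) ^ 2 ^ n ≤ D / t * r ^ 2 ^ n := fun n =>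
    (key n).trans ((div_le_div_of_nonneg_right (hD n) ht.le).trans_eq (by ring))
  rw [← div_le_iff₀ ht]
  by_contra! hlt
  rcases hr.eq_or_lt with rfl | hr
  · have := key' 0
    simp only [pow_zero, pow_one, mul_zero] at this
    linarith
  obtain ⟨m, hm⟩ := pow_unbounded_of_one_lt (D / t) ((one_lt_div hr).2 hlt)
  -- Only exponents `2^n` are available; `m ≤ 2^m` makes the exponent `2^m` large enough.
  have h1 := pow_le_pow_right₀ ((one_lt_div hr).2 hlt).le (Nat.lt_two_pow_self (n := m)).le
  have h2 := key' m
  rw [← div_le_iff₀ (by positivity), ← div_pow] at h2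
  linarith

namespace CompactOp

open IsHilbertModule Adjointable

variable {A E F F' : Type*} [NonUnitalRing A] [StarRing A] [Module ℂ A] [UniformSpace A]
  [IsLocallyCStarAlgebra A]
  [AddCommGroup E] [Module ℂ E] [SMul Aᵐᵒᵖ E] [Inner A E] [UniformSpace E] [IsHilbertModule A E]
  [AddCommGroup F] [Module ℂ F] [SMul Aᵐᵒᵖ F] [Inner A F] [UniformSpace F] [IsHilbertModule A F]
  [AddCommGroup F'] [Module ℂ F'] [SMul Aᵐᵒᵖ F'] [Inner A F'] [UniformSpace F']
  [IsHilbertModule A F']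

instance : CompleteSpace (CompactOp A E F) :=
  (Submodule.isClosed_topologicalClosure (finiteRank A E F)).completeSpace_coe

theorem star_adj_comp_self (T : CompactOp A E F) : star (T.adj.comp T) = T.adj.comp T :=
  Subtype.ext ((Adjointable.adj_comp T.1.adj T.1).trans (by rw [Adjointable.adj_adj]; rfl))

/-- The (finite) operator seminorm of a compact operator. -/
def knorm (p : ContCStarSeminorm A) (T : CompactOp A E F) : ℝ :=
  (opNorm p.toCStarSeminorm T.1).toReal

theorem knorm_nonneg (p : ContCStarSeminorm A) (T : CompactOp A E F) : 0 ≤ knorm p T :=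
  ENNReal.toReal_nonneg

theorem ofReal_knorm (p : ContCStarSeminorm A) (T : CompactOp A E F) :
    ENNReal.ofReal (knorm p T) = opNorm p.toCStarSeminorm T.1 :=
  ENNReal.ofReal_toReal (opNorm_ne_top p T.2)

theorem le_knorm (p : ContCStarSeminorm A) (T : CompactOp A E F) (ξ : E) :
    modNorm p.toCStarSeminorm (T.1 ξ) ≤ knorm p T * modNorm p.toCStarSeminorm ξ :=
  le_opNorm (opNorm_ne_top p T.2) ξ

theorem knorm_le {p : ContCStarSeminorm A} {T : CompactOp A E F} {C : ℝ} (hC : 0 ≤ C)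
    (h : ∀ ξ, modNorm p.toCStarSeminorm (T.1 ξ) ≤ C * modNorm p.toCStarSeminorm ξ) :
    knorm p T ≤ C :=
  ENNReal.toReal_le_of_le_ofReal hC (opNorm_le hC h)

theorem knorm_add_le (p : ContCStarSeminorm A) (S T : CompactOp A E F) :
    knorm p (S + T) ≤ knorm p S + knorm p T :=
  knorm_le (add_nonneg (knorm_nonneg p S) (knorm_nonneg p T)) fun ξ => by
    rw [add_mul]
    exact (modNorm_add_le _ _ _).trans (add_le_add (le_knorm p S ξ) (le_knorm p T ξ))

theorem knorm_smul_le (p : ContCStarSeminorm A) (c : ℂ) (T : CompactOp A E F) :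
    knorm p (c • T) ≤ ‖c‖ * knorm p T :=
  knorm_le (mul_nonneg (norm_nonneg c) (knorm_nonneg p T)) fun ξ => by
    rw [mul_assoc]
    exact (modNorm_smul _ _ _).trans_le
      (mul_le_mul_of_nonneg_left (le_knorm p T ξ) (norm_nonneg c))

theorem knorm_comp_le (p : ContCStarSeminorm A) (S : CompactOp A F F') (T : CompactOp A E F) :
    knorm p (S.comp T) ≤ knorm p S * knorm p T :=
  knorm_le (mul_nonneg (knorm_nonneg p S) (knorm_nonneg p T)) fun ξ => by
    rw [mul_assoc]
    exact (le_knorm p S (T.1 ξ)).trans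
      (mul_le_mul_of_nonneg_left (le_knorm p T ξ) (knorm_nonneg p S))

theorem knorm_adj (p : ContCStarSeminorm A) (T : CompactOp A E F) : knorm p T.adj = knorm p T :=
  congrArg ENNReal.toReal (opNorm_adj _ _)

/-- The lower bound is Cauchy–Schwarz applied to `⟨Tξ, Tξ⟩ = ⟨ξ, T⋆Tξ⟩`. Allowing `F ≠ E` gives both
the C⋆-identity on `K(E)` and the seminorms of the Hilbert module `K(E, A)`. -/
theorem knorm_adj_comp_self (p : ContCStarSeminorm A) (T : CompactOp A E F) :
    knorm p (T.adj.comp T) = knorm p T ^ 2 := by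
  refine le_antisymm ?_ ?_
  · refine (knorm_comp_le p _ _).trans ?_
    rw [knorm_adj, sq]
  · have h : knorm p T ≤ √(knorm p (T.adj.comp T)) := knorm_le (Real.sqrt_nonneg _) fun ξ => by
      have h1 : modNorm p.toCStarSeminorm (T.1 ξ) ^ 2 ≤
          modNorm p.toCStarSeminorm ξ * modNorm p.toCStarSeminorm (T.1.adj (T.1 ξ)) := by
        rw [modNorm_sq, inner_apply_left]
        exact cauchy_schwarz _ _ _
      refine abs_le_of_sq_le_sq' ?_ (mul_nonneg (Real.sqrt_nonneg _) (modNorm_nonneg _ _)) |>.2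
      rw [mul_pow, Real.sq_sqrt (knorm_nonneg _ _)]
      refine h1.trans ?_
      have h2 := mul_le_mul_of_nonneg_left (le_knorm p (T.adj.comp T) ξ)
        (modNorm_nonneg p.toCStarSeminorm ξ)
      refine h2.trans (le_of_eq (by ring))
    calc knorm p T ^ 2 ≤ √(knorm p (T.adj.comp T)) ^ 2 := pow_le_pow_left₀ (knorm_nonneg _ _) h 2
      _ = _ := Real.sq_sqrt (knorm_nonneg _ _)

/-- `knorm p` as a seminorm. -/
def kSeminorm (p : ContCStarSeminorm A) : Seminorm ℂ (CompactOp A E F) :=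
  Seminorm.ofSMulLE (knorm p)
    (le_antisymm (knorm_le le_rfl fun ξ => by
      rw [zero_mul]
      exact (modNorm_zero _).le)
      (knorm_nonneg _ _)) (knorm_add_le p) (knorm_smul_le p)

/-- Compact operators have finite operator seminorms, so the extended and the real valued seminorms
determine each other, and `ENNReal.toReal` and `ENNReal.ofReal` are both continuous at `0`. -/
theorem nhds_zero_eq : 𝓝 (0 : CompactOp A E F) =
    ⨅ p : ContCStarSeminorm A, comap (knorm p) (𝓝 0) := by
  rw [nhds_subtype_eq_comap]
  change comap _ (𝓝 (0 : Adjointable A E F)) = _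
  rw [Adjointable.nhds_zero_eq, Filter.comap_iInf]
  refine iInf_congr fun p => ?_
  rw [Filter.comap_comap]
  have h1 : (opNorm p.toCStarSeminorm ∘ Subtype.val : CompactOp A E F → ENNReal) =
      ENNReal.ofReal ∘ knorm p := funext fun T => (ofReal_knorm p T).symm
  have h2 : (knorm p : CompactOp A E F → ℝ) =
      ENNReal.toReal ∘ (opNorm p.toCStarSeminorm ∘ Subtype.val) := rfl
  refine le_antisymm ?_ ?_
  · rw [h2, ← tendsto_iff_comap]
    exact (ENNReal.tendsto_toReal ENNReal.zero_ne_top).comp tendsto_comap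
  · rw [← tendsto_iff_comap, h1]
    simpa using (ENNReal.continuous_ofReal.tendsto 0).comp (tendsto_comap (f := knorm p))

theorem tendsto_zero_iff {ι : Type*} {l : Filter ι} {f : ι → CompactOp A E F} :
    Tendsto f l (𝓝 0) ↔ ∀ p : ContCStarSeminorm A, Tendsto (fun i => knorm p (f i)) l (𝓝 0) := by
  rw [nhds_zero_eq, tendsto_iInf]
  simp only [tendsto_comap_iff, Function.comp_def]

theorem continuous_knorm (p : ContCStarSeminorm A) :
    Continuous (knorm p : CompactOp A E F → ℝ) := by
  refine Seminorm.continuous_of_continuousAt_zero (p := kSeminorm (E := E) (F := F) p) ?_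
  rw [ContinuousAt, _root_.map_zero]
  exact tendsto_zero_iff.1 tendsto_id p

variable (E) in
/-- The C⋆-seminorm on `K(E)` attached to a continuous C⋆-seminorm on `A`. -/
def kCStarSeminorm (p : ContCStarSeminorm A) : ContCStarSeminorm (CompactOp A E E) where
  __ := kSeminorm p
  mul_le := knorm_comp_le p
  star_mul_self := knorm_adj_comp_self p
  continuous_toFun := continuous_knorm p

instance : IsUniformAddGroup (CompactOp A E F) :=
  inferInstanceAs (IsUniformAddGroup (compacts A E F).toAddSubgroup)

instance : IsLocallyCStarAlgebra (CompactOp A E E) where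
  __ := (inferInstance : IsUniformAddGroup (CompactOp A E E))
  smul_assoc _ _ _ := ext fun _ => rfl
  smul_comm c S T := ext fun ξ => (S.1.map_smul c (T.1 ξ)).symm
  star_smul c T := Subtype.ext (adj_smul c T.1)
  nhds_zero := by
    refine le_antisymm (le_iInf fun q => ?_) ?_
    · rw [← tendsto_iff_comap]
      have h := q.continuous_toFun.tendsto 0
      rwa [show q.toFun 0 = 0 from _root_.map_zero q.toSeminorm] at h
    · rw [nhds_zero_eq]
      exact le_iInf fun p => iInf_le _ (kCStarSeminorm E p)

theorem modNorm_kCStarSeminorm (p : ContCStarSeminorm A) (T : CompactOp A E A) :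
    modNorm (kCStarSeminorm E p).toCStarSeminorm T = knorm p T := by
  change √(knorm p (T.adj.comp T)) = _
  rw [knorm_adj_comp_self, Real.sqrt_sq (knorm_nonneg p T)]

/-- If `p` is dominated by a multiple of `q` on the module, then the operator seminorm of `p` is
dominated by that of `q`. -/
theorem knorm_mono {p q : ContCStarSeminorm A} {C : ℝ}
    (h : ∀ ξ : E, modNorm p.toCStarSeminorm ξ ≤ C * modNorm q.toCStarSeminorm ξ)
    (T : CompactOp A E F) : knorm p T ≤ knorm q T := by
  -- `S n` is `(T⋆T)^(2^n)`. It is self-adjoint, so the C⋆-identity gives the exact value `‖S n‖_q =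
  -- ‖T⋆T‖_q^(2^n)`.
  let S : ℕ → CompactOp A E E := fun n => Nat.rec (T.adj.comp T) (fun _ S => S * S) n
  have hS0 : S 0 = T.adj.comp T := rfl
  have hS1 : ∀ n, S (n + 1) = S n * S n := fun _ => rfl
  have hstar : ∀ n, star (S n) = S n := by
    intro n
    induction n with
    | zero => exact star_adj_comp_self T
    | succ n ih => rw [hS1, star_mul, ih]
  have hsq : ∀ n, knorm q (S (n + 1)) = knorm q (S n) ^ 2 := fun n => by
    rw [hS1, ← knorm_adj_comp_self q (S n)]
    exact congrArg (fun R => knorm q (R * S n)) (hstar n).symm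
  have hpow : ∀ n, knorm q (S n) = knorm q (S 0) ^ 2 ^ n := by
    intro n
    induction n with
    | zero => simp
    | succ n ih => rw [hsq, ih, pow_succ 2, pow_mul]
  have hC : ∀ ξ : E, modNorm p.toCStarSeminorm ξ ≤ |C| * modNorm q.toCStarSeminorm ξ := fun ξ =>
    (h ξ).trans (mul_le_mul_of_nonneg_right (le_abs_self C) (modNorm_nonneg _ _))
  have key : knorm p (S 0) ≤ knorm q (S 0) := knorm_le (knorm_nonneg _ _) fun ξ => by
    -- With `x n = ‖S n ξ‖_p`, Cauchy–Schwarz gives `x n ^ 2 ≤ ‖ξ‖_p x (n + 1)`, while passing to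
    -- `q` gives growth at most `‖T⋆T‖_q^(2^n)`. The factor `|C|` enters only through `D`, so it
    -- disappears.
    refine le_mul_of_sq_le_of_le_pow (x := fun n => modNorm p.toCStarSeminorm ((S n).1 ξ))
      (D := |C| * modNorm q.toCStarSeminorm ξ) (fun n => modNorm_nonneg _ _) (modNorm_nonneg _ _)
      (knorm_nonneg _ _) (fun n => ?_) fun n => ?_
    · rw [modNorm_sq, inner_apply_left]
      have e : (S n).1.adj ((S n).1 ξ) = (S (n + 1)).1 ξ :=
        congrArg (fun R : CompactOp A E E => R.1 ((S n).1 ξ)) (hstar n)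
      rw [e]
      exact cauchy_schwarz _ _ _
    · refine (hC _).trans ?_
      rw [mul_assoc, ← hpow, mul_comm (modNorm _ _)]
      exact mul_le_mul_of_nonneg_left (le_knorm q (S n) ξ) (abs_nonneg C)
  rw [hS0, knorm_adj_comp_self, knorm_adj_comp_self] at key
  exact abs_le_of_sq_le_sq' key (knorm_nonneg _ _) |>.2

end CompactOp

/-! ### Positive elements of C⋆-algebras. -/

section CStar

variable {B : Type*} [NonUnitalCStarAlgebra B]

theorem isClosed_setOf_star_mul_self : IsClosed {x : B | ∃ b, x = star b * b} := by
  let _ := CStarAlgebra.spectralOrder B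
  have := CStarAlgebra.spectralOrderedRing B
  have h : {x : B | ∃ b, x = star b * b} = {x : B | 0 ≤ x} := by
    ext x
    exact (CStarAlgebra.nonneg_iff_eq_star_mul_self).symm
  rw [h]
  exact CStarAlgebra.isClosed_nonneg

theorem exists_positive_sqrt {x : B} (hx : ∃ b, x = star b * b) :
    ∃ s : B, (∃ c, s = star c * c) ∧ s * s = x := by
  let _ := CStarAlgebra.spectralOrder B
  have := CStarAlgebra.spectralOrderedRing B
  have hx' := (CStarAlgebra.nonneg_iff_eq_star_mul_self).2 hx
  exact ⟨CFC.sqrt x, (CStarAlgebra.nonneg_iff_eq_star_mul_self).1 (CFC.sqrt_nonneg x),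
    CFC.sqrt_mul_sqrt_self x hx'⟩

theorem positive_sqrt_unique {s t : B} (hs : ∃ c, s = star c * c) (ht : ∃ c, t = star c * c)
    (h : s * s = t * t) : s = t := by
  let _ := CStarAlgebra.spectralOrder B
  have := CStarAlgebra.spectralOrderedRing B
  have hs' := (CStarAlgebra.nonneg_iff_eq_star_mul_self).2 hs
  have ht' := (CStarAlgebra.nonneg_iff_eq_star_mul_self).2 ht
  rw [← CFC.sqrt_unique h hs', CFC.sqrt_mul_self t ht']

/-- Testing the hypothesis on the negative part `n` of `y` forces `n ^ 3 = 0`. The criterion uses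
only norms and algebraic operations, so it can be checked on a dense subalgebra. -/
theorem exists_eq_star_mul_self {y : B} (hy : star y = y)
    (h : ∀ b c : B, ‖star c * c‖ ≤ ‖star b * (y * b) + star c * c‖) : ∃ b, y = star b * b := by
  let _ := CStarAlgebra.spectralOrder B
  have := CStarAlgebra.spectralOrderedRing B
  rw [← CStarAlgebra.nonneg_iff_eq_star_mul_self, ← CFC.negPart_eq_zero_iff y hy]
  have hn := CFC.negPart_nonneg y
  set n := y⁻ with hndef
  have hns : star n = n := hn.isSelfAdjoint
  set s := CFC.sqrt n
  have hss : star s = s := (CFC.sqrt_nonneg n).isSelfAdjoint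
  have hsn : s * s = n := CFC.sqrt_mul_sqrt_self n hn
  -- The positive and negative parts annihilate each other, so only `-n` survives in `y`.
  have e : n * (y * n) = -(n * (n * n)) := by
    conv_lhs => rw [← CFC.posPart_sub_negPart y hy]
    rw [sub_mul, mul_sub, ← mul_assoc n y⁺, CFC.negPart_mul_posPart]
    simp [← hndef]
  have e2 : star (s * n) * (s * n) = n * (n * n) := by
    rw [star_mul, hss, hns, mul_assoc, ← mul_assoc s, hsn]
  -- With `b = n` and `c = n^(1/2) n`, the two terms on the right are `-n³` and `n³` and cancel.
  have h1 := h n (s * n)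
  rw [e2, hns, e, neg_add_cancel, norm_zero, norm_le_zero_iff] at h1
  have h2 : star (n * n) * (n * n) = 0 := by
    rw [star_mul, hns, mul_assoc, h1, mul_zero]
  rw [CStarRing.star_mul_self_eq_zero_iff] at h2
  rw [← CStarRing.star_mul_self_eq_zero_iff, hns, h2]

end CStar

/-! ### Complete groups as inverse limits of normed groups. -/

section Limit

theorem tendsto_zero_iff_of_nhds_zero_eq {X Λ ι : Type*} [Zero X] [TopologicalSpace X]
    {p : Λ → X → ℝ} (h : 𝓝 (0 : X) = ⨅ i, comap (p i) (𝓝 0)) {l : Filter ι} {f : ι → X} :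
    Tendsto f l (𝓝 0) ↔ ∀ i, Tendsto (fun k => p i (f k)) l (𝓝 0) := by
  rw [h, tendsto_iInf]
  simp only [tendsto_comap_iff, Function.comp_def]

theorem eq_zero_of_nhds_zero_eq {X Λ : Type*} [Zero X] [TopologicalSpace X] [T2Space X]
    {p : Λ → X → ℝ} (h : 𝓝 (0 : X) = ⨅ i, comap (p i) (𝓝 0)) {x : X} (hx : ∀ i, p i x = 0) :
    x = 0 :=
  tendsto_nhds_unique (tendsto_const_nhds (f := (atTop : Filter ℕ)))
    ((tendsto_zero_iff_of_nhds_zero_eq h).2 fun i => by simp [hx])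

/-- A complete Hausdorff group whose topology is given by a directed family of homomorphisms with
dense range into normed groups is the inverse limit of these. -/
theorem existsUnique_of_coherent {Λ X : Type*} [Preorder Λ] [IsDirectedOrder Λ] [Nonempty Λ]
    [AddCommGroup X] [UniformSpace X] [IsUniformAddGroup X] [CompleteSpace X] [T2Space X]
    {Y : Λ → Type*} [∀ i, NormedAddCommGroup (Y i)] (f : ∀ i, X →+ Y i)
    (hd : ∀ i, DenseRange (f i)) (hX : 𝓝 (0 : X) = ⨅ i, comap (fun x => ‖f i x‖) (𝓝 0))
    (t : ∀ {i j : Λ}, i ≤ j → Y j →+ Y i) (htf : ∀ {i j} (hij : i ≤ j) x, t hij (f j x) = f i x)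
    (ht : ∀ {i j} (hij : i ≤ j) y, ‖t hij y‖ ≤ ‖y‖)
    (y : ∀ i, Y i) (hy : ∀ i j (hij : i ≤ j), t hij (y j) = y i) : ∃! x, ∀ i, f i x = y i := by
  have hcont : ∀ i, Continuous (f i) := fun i =>
    continuous_of_continuousAt_zero (f i) (by
      rw [ContinuousAt, map_zero, tendsto_zero_iff_norm_tendsto_zero]
      exact (tendsto_zero_iff_of_nhds_zero_eq hX).1 tendsto_id i)
  have huniq : ∀ x x', (∀ i, f i x = f i x') → x = x' := fun x x' h => by
    exact sub_eq_zero.1 (eq_zero_of_nhds_zero_eq hX fun i => by simp [h])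
  -- The filter of approximate solutions; the sought element is its limit.
  let l : Filter X := ⨅ i, comap (fun x => ‖f i x - y i‖) (𝓝 0)
  have hl : ∀ i, Tendsto (fun x => ‖f i x - y i‖) l (𝓝 0) := fun i =>
    tendsto_iff_comap.2 (iInf_le _ i)
  have hmono : ∀ {i j : Λ}, i ≤ j → comap (fun x => ‖f j x - y j‖) (𝓝 0) ≤
      comap (fun x => ‖f i x - y i‖) (𝓝 0) := fun {i j} hij => by
    rw [← tendsto_iff_comap]
    refine squeeze_zero (fun _ => norm_nonneg _) (fun x => ?_) tendsto_comap
    rw [← htf hij, ← hy i j hij, ← map_sub]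
    exact ht hij _
  -- Density solves each single condition approximately. Contractivity of the connecting maps and
  -- directedness reduce finitely many conditions to one.
  have hne : l.NeBot := by
    have : ∀ i, (comap (fun x => ‖f i x - y i‖) (𝓝 0)).NeBot := fun i => by
      rw [comap_neBot_iff]
      intro s hs
      obtain ⟨ε, hε, hs⟩ := Metric.mem_nhds_iff.1 hs
      obtain ⟨x, hx⟩ := (hd i).exists_dist_lt (y i) hε
      refine ⟨x, hs ?_⟩
      rw [dist_comm, dist_eq_norm] at hx
      simpa using hx
    refine iInf_neBot_of_directed (fun i j => ?_) this
    obtain ⟨k, hik, hjk⟩ := exists_ge_ge i j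
    exact ⟨k, hmono hik, hmono hjk⟩
  have hc : Cauchy l := by
    refine ⟨hne, ?_⟩
    rw [uniformity_eq_comap_nhds_zero, ← tendsto_iff_comap,
      tendsto_zero_iff_of_nhds_zero_eq hX]
    intro i
    have h1 := ((hl i).comp tendsto_snd).add ((hl i).comp (tendsto_fst (f := l) (g := l)))
    rw [add_zero] at h1
    refine squeeze_zero (fun _ => norm_nonneg _) (fun x => ?_) h1
    have e : f i (x.2 - x.1) = (f i x.2 - y i) - (f i x.1 - y i) := by rw [map_sub]; abel
    rw [e]
    exact norm_sub_le _ _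
  obtain ⟨x, hx⟩ := CompleteSpace.complete hc
  have hxy : ∀ i, f i x = y i := fun i =>
    tendsto_nhds_unique (((hcont i).tendsto x).mono_left hx)
      (tendsto_iff_norm_sub_tendsto_zero.2 (hl i))
  exact ⟨x, hxy, fun x' hx' => huniq _ _ fun i => (hx' i).trans (hxy i).symm⟩

end Limit

/-! ### Completions with respect to C⋆-seminorms and maps between them. -/

namespace CStarSeminorm

variable {A B : Type*} [NonUnitalRing A] [StarRing A] [Module ℂ A]
  [NonUnitalRing B] [StarRing B] [Module ℂ B]

/-- The canonical map of `A` into its completion. -/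
def toComplHom (p : CStarSeminorm A) : A →⋆ₙₐ[ℂ] p.Compl where
  toFun a := ((show p.WithSeminorm from a : p.WithSeminorm) : p.Compl)
  map_smul' c a := Completion.coe_smul c (show p.WithSeminorm from a)
  map_zero' := Completion.coe_zero
  map_add' a b := Completion.coe_add (show p.WithSeminorm from a) b
  map_mul' a b := p.coe_mul_compl a b
  map_star' a := p.coe_star_compl a

theorem norm_toComplHom (p : CStarSeminorm A) (a : A) : ‖p.toComplHom a‖ = p a :=
  Completion.norm_coe (show p.WithSeminorm from a)

theorem denseRange_toComplHom (p : CStarSeminorm A) : DenseRange p.toComplHom :=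
  Completion.denseRange_coe (α := p.WithSeminorm)

@[elab_as_elim]
theorem compl_induction {p : CStarSeminorm A} {P : p.Compl → Prop} (x : p.Compl)
    (hc : IsClosed {x | P x}) (h : ∀ a : A, P (p.toComplHom a)) : P x :=
  Completion.induction_on x hc h

@[elab_as_elim]
theorem compl_induction₂ {p : CStarSeminorm A} {P : p.Compl → p.Compl → Prop} (x y : p.Compl)
    (hc : IsClosed {x : p.Compl × p.Compl | P x.1 x.2})
    (h : ∀ a b : A, P (p.toComplHom a) (p.toComplHom b)) : P x y :=
  Completion.induction_on₂ x y hc h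

section Map

variable {p : CStarSeminorm A} {q : CStarSeminorm B} (f : A →⋆ₙₐ[ℂ] B) (hf : ∀ a, q (f a) ≤ p a)

/-- A contractive morphism, as a homomorphism of seminormed groups. -/
def normedHom : NormedAddGroupHom p.WithSeminorm q.WithSeminorm where
  toFun a := f a
  map_add' a b := map_add f a b
  bound' := ⟨1, fun a => by rw [one_mul]; exact hf a⟩

/-- The extension to the completions. -/
def complMapFun : p.Compl → q.Compl := (normedHom f hf).completion

theorem continuous_complMapFun : Continuous (complMapFun f hf) :=
  (normedHom f hf).completion.continuous

theorem complMapFun_coe (a : A) : complMapFun f hf (p.toComplHom a) = q.toComplHom (f a) :=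
  NormedAddGroupHom.completion_coe (normedHom f hf) a

/-- The extension of a contractive morphism to the completions. -/
def complMap : p.Compl →⋆ₙₐ[ℂ] q.Compl where
  toFun := complMapFun f hf
  map_smul' c x := by
    have := continuous_complMapFun f hf
    exact compl_induction x (isClosed_eq (this.comp (continuous_const_smul c))
      (this.const_smul c)) fun a => by
        rw [← map_smul, complMapFun_coe, complMapFun_coe, map_smul, map_smul]; rfl
  map_zero' := by rw [← map_zero p.toComplHom, complMapFun_coe, map_zero, map_zero]
  map_add' x y := by
    have := continuous_complMapFun f hf
    exact compl_induction₂ x y (isClosed_eq (by fun_prop) (by fun_prop)) fun a b => by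
      rw [← map_add, complMapFun_coe, complMapFun_coe, complMapFun_coe, map_add, map_add]
  map_mul' x y := by
    have := continuous_complMapFun f hf
    exact compl_induction₂ x y (isClosed_eq (by fun_prop) (by fun_prop)) fun a b => by
      rw [← map_mul, complMapFun_coe, complMapFun_coe, complMapFun_coe, map_mul, map_mul]
  map_star' x := by
    have := continuous_complMapFun f hf
    exact compl_induction x (isClosed_eq (by fun_prop) (by fun_prop)) fun a => by
      rw [← map_star, complMapFun_coe, complMapFun_coe, map_star, map_star]

theorem continuous_complMap : Continuous (complMap f hf) := continuous_complMapFun f hf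

theorem complMap_coe (a : A) : complMap f hf (p.toComplHom a) = q.toComplHom (f a) :=
  complMapFun_coe f hf a

theorem norm_complMap_le (x : p.Compl) : ‖complMap f hf x‖ ≤ ‖x‖ := by
  have := continuous_complMap f hf
  exact compl_induction x (isClosed_le (by fun_prop) (by fun_prop)) fun a => by
    rw [complMap_coe, norm_toComplHom, norm_toComplHom]; exact hf a

end Map

/-- The map between completions induced by an inequality of seminorms. -/
def complId {p q : CStarSeminorm A} (h : ∀ a, q a ≤ p a) : p.Compl →⋆ₙₐ[ℂ] q.Compl :=
  complMap (NonUnitalStarAlgHom.id ℂ A) h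

theorem complId_coe {p q : CStarSeminorm A} (h : ∀ a, q a ≤ p a) (a : A) :
    complId h (p.toComplHom a) = q.toComplHom a := complMap_coe (NonUnitalStarAlgHom.id ℂ A) h a

theorem continuous_complId {p q : CStarSeminorm A} (h : ∀ a, q a ≤ p a) :
    Continuous (complId h) := continuous_complMap (NonUnitalStarAlgHom.id ℂ A) h

theorem norm_complId_le {p q : CStarSeminorm A} (h : ∀ a, q a ≤ p a) (x : p.Compl) :
    ‖complId h x‖ ≤ ‖x‖ := norm_complMap_le (NonUnitalStarAlgHom.id ℂ A) h x

/-- The norm criterion for positivity is a closed condition on `(b, c)`, so it passes from `A` to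
the completion. -/
theorem exists_toComplHom_eq_star_mul_self [IsScalarTower ℂ A A] [SMulCommClass ℂ A A]
    [StarModule ℂ A] (p : CStarSeminorm A) {y : A} (hy : star y = y)
    (h : ∀ b c : A, p (star c * c) ≤ p (star b * (y * b) + star c * c)) :
    ∃ b : p.Compl, p.toComplHom y = star b * b := by
  refine exists_eq_star_mul_self (by rw [← map_star, hy]) fun b c => ?_
  refine compl_induction₂ b c (isClosed_le (by fun_prop) (by fun_prop)) fun b c => ?_
  simp only [← map_star, ← map_mul, ← map_add, norm_toComplHom]
  exact h b c

end CStarSeminorm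

/-! ### Locally C⋆-algebras as inverse limits; gluing of square roots. -/

namespace IsLocallyCStarAlgebra

variable {A : Type*} [NonUnitalRing A] [StarRing A] [Module ℂ A] [UniformSpace A]
  [IsLocallyCStarAlgebra A]

theorem nhds_zero_norm_toComplHom {Λ : Type*} {r : Λ → ContCStarSeminorm A}
    (hgen : 𝓝 (0 : A) = ⨅ i, comap (r i).toCStarSeminorm (𝓝 0)) :
    𝓝 (0 : A) = ⨅ i, comap (fun a => ‖(r i).toCStarSeminorm.toComplHom a‖) (𝓝 0) := by
  simpa only [CStarSeminorm.norm_toComplHom] using hgen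

/-- A locally C⋆-algebra is the inverse limit of its completions with respect to a directed
generating family of continuous C⋆-seminorms. -/
theorem existsUnique_toComplHom_eq {Λ : Type*} [Preorder Λ] [IsDirectedOrder Λ] [Nonempty Λ]
    (r : Λ → ContCStarSeminorm A)
    (hr : ∀ {i j}, i ≤ j → ∀ a, (r i).toCStarSeminorm a ≤ (r j).toCStarSeminorm a)
    (hgen : 𝓝 (0 : A) = ⨅ i, comap (r i).toCStarSeminorm (𝓝 0))
    (x : ∀ i, (r i).toCStarSeminorm.Compl)
    (hx : ∀ i j (hij : i ≤ j), CStarSeminorm.complId (hr hij) (x j)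
      = x i) : ∃! a : A, ∀ i, (r i).toCStarSeminorm.toComplHom a = x i :=
  existsUnique_of_coherent (fun i => ((r i).toCStarSeminorm.toComplHom : A →+ _))
    (fun i => (r i).toCStarSeminorm.denseRange_toComplHom) (nhds_zero_norm_toComplHom hgen)
    (fun {i j} hij => (CStarSeminorm.complId (hr hij) :
      (r j).toCStarSeminorm.Compl →+ (r i).toCStarSeminorm.Compl))
    (fun hij a => CStarSeminorm.complId_coe (hr hij) a)
    (fun hij => CStarSeminorm.norm_complId_le (hr hij)) x hx

/-- An arbitrary choice of `b` in each completion need not be coherent. The positive square root is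
unique and connecting morphisms preserve positivity, so these roots are coherent and define one
element. -/
theorem exists_eq_star_mul_self {Λ : Type*} [Preorder Λ] [IsDirectedOrder Λ] [Nonempty Λ]
    (r : Λ → ContCStarSeminorm A)
    (hr : ∀ {i j}, i ≤ j → ∀ a, (r i).toCStarSeminorm a ≤ (r j).toCStarSeminorm a)
    (hgen : 𝓝 (0 : A) = ⨅ i, comap (r i).toCStarSeminorm (𝓝 0)) {x : A}
    (hx : ∀ i, ∃ b, (r i).toCStarSeminorm.toComplHom x = star b * b) : ∃ b, x = star b * b := by
  choose s hs hsx using fun i => exists_positive_sqrt (hx i)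
  obtain ⟨b, hb, -⟩ := existsUnique_toComplHom_eq r hr hgen s fun i j hij => by
    refine positive_sqrt_unique ?_ (hs i) ?_
    · obtain ⟨c, hc⟩ := hs j
      exact ⟨_, by rw [hc, map_mul, map_star]⟩
    · rw [← map_mul, hsx, hsx, CStarSeminorm.complId_coe]
  have hstar : ∀ i, star (s i) = s i := fun i => by
    obtain ⟨c, hc⟩ := hs i
    rw [hc, star_mul, star_star]
  obtain ⟨_, _, huniq⟩ := existsUnique_toComplHom_eq r hr hgen
    (fun i => (r i).toCStarSeminorm.toComplHom x)
    fun i j hij => CStarSeminorm.complId_coe (hr hij) x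
  refine ⟨b, (huniq x fun _ => rfl).trans (huniq _ fun i => ?_).symm⟩
  rw [map_mul, map_star, hb, hstar, hsx]

end IsLocallyCStarAlgebra

/-! ### The directed set of continuous C⋆-seminorms. -/

namespace ContCStarSeminorm

variable {A : Type*} [NonUnitalRing A] [StarRing A] [Module ℂ A] [TopologicalSpace A]

instance : Preorder (ContCStarSeminorm A) :=
  Preorder.lift fun p => (p.toCStarSeminorm : A → ℝ)

instance : Nonempty (ContCStarSeminorm A) :=
  ⟨{ (0 : Seminorm ℂ A) with
     mul_le := fun _ _ => (mul_zero (0 : ℝ)).ge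
     star_mul_self := fun _ => (zero_pow two_ne_zero : (0 : ℝ) ^ 2 = 0).symm
     continuous_toFun := continuous_const }⟩

/-- The C⋆-identity survives the maximum because squaring is monotone on nonnegative reals. -/
instance : Max (ContCStarSeminorm A) :=
  ⟨fun p q =>
    { p.toSeminorm ⊔ q.toSeminorm with
      mul_le := fun a b => max_le
        ((p.mul_le' a b).trans (mul_le_mul (le_max_left _ _) (le_max_left _ _) (p.nonneg _)
          ((p.nonneg a).trans (le_max_left _ _))))
        ((q.mul_le' a b).trans (mul_le_mul (le_max_right _ _) (le_max_right _ _) (q.nonneg _)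
          ((p.nonneg a).trans (le_max_left _ _))))
      star_mul_self := fun a => by
        change max (p.toCStarSeminorm (star a * a)) (q.toCStarSeminorm (star a * a)) =
          (max (p.toCStarSeminorm a) (q.toCStarSeminorm a)) ^ 2
        rw [p.star_mul_self', q.star_mul_self']
        rcases le_total (p.toCStarSeminorm a) (q.toCStarSeminorm a) with h | h
        · rw [max_eq_right h, max_eq_right (pow_le_pow_left₀ (p.nonneg a) h 2)]
        · rw [max_eq_left h, max_eq_left (pow_le_pow_left₀ (q.nonneg a) h 2)]
      continuous_toFun := p.continuous_toFun.max q.continuous_toFun }⟩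

theorem max_apply (p q : ContCStarSeminorm A) (a : A) :
    (p ⊔ q).toCStarSeminorm a = max (p.toCStarSeminorm a) (q.toCStarSeminorm a) := rfl

instance : IsDirectedOrder (ContCStarSeminorm A) :=
  ⟨fun p q => ⟨p ⊔ q, fun _ => le_max_left _ _, fun _ => le_max_right _ _⟩⟩

end ContCStarSeminorm

/-! ### `K(E, A)` as a Hilbert `K(E)`-module. -/

namespace CompactOp

open IsHilbertModule Adjointable

variable {A E F : Type*} [NonUnitalRing A] [StarRing A] [Module ℂ A] [UniformSpace A]
  [IsLocallyCStarAlgebra A]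
  [AddCommGroup E] [Module ℂ E] [SMul Aᵐᵒᵖ E] [Inner A E] [UniformSpace E] [IsHilbertModule A E]
  [AddCommGroup F] [Module ℂ F] [SMul Aᵐᵒᵖ F] [Inner A F] [UniformSpace F] [IsHilbertModule A F]

theorem modNorm_mono {p q : ContCStarSeminorm A} (h : p ≤ q) (ξ : E) :
    modNorm p.toCStarSeminorm ξ ≤ modNorm q.toCStarSeminorm ξ :=
  Real.sqrt_le_sqrt (h _)

/-- With `R = b⋆T⋆Tb + c⋆c`, one has `⟨ξ, Rξ⟩ = ⟨Tbξ, Tbξ⟩ + ⟨cξ, cξ⟩`, a sum of two positive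
elements of `A`, whose seminorm dominates that of each summand. Cauchy–Schwarz then bounds `‖cξ‖²`
by `‖R‖ ‖ξ‖²`. -/
theorem knorm_star_mul_self_le (p : ContCStarSeminorm A) (T : CompactOp A E F)
    (b c : CompactOp A E E) :
    knorm p (star c * c) ≤ knorm p (star b * (T.adj.comp T * b) + star c * c) := by
  set R := star b * (T.adj.comp T * b) + star c * c
  have e : star c * c = c.adj.comp c := rfl
  rw [e, knorm_adj_comp_self]
  have h : knorm p c ≤ √(knorm p R) := knorm_le (Real.sqrt_nonneg _) fun ξ => by
    obtain ⟨x, hx⟩ := inner_self_pos (A := A) (c.1 ξ)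
    obtain ⟨y, hy⟩ := inner_self_pos (A := A) (T.1 (b.1 ξ))
    have e1 : inner A ξ (R.1 ξ) = star x * x + star y * y := by
      rw [← hx, ← hy, add_comm]
      change inner A ξ (b.1.adj (T.1.adj (T.1 (b.1 ξ))) + c.1.adj (c.1 ξ)) = _
      rw [ip_add_right, ← inner_apply_left, ← inner_apply_left, ← inner_apply_left]
    have h1 : modNorm p.toCStarSeminorm (c.1 ξ) ^ 2 ≤
        modNorm p.toCStarSeminorm ξ * (knorm p R * modNorm p.toCStarSeminorm ξ) := by
      rw [modNorm_sq, hx]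
      refine (p.le_add_of_star_mul_self x y).trans ?_
      rw [← e1]
      exact (cauchy_schwarz _ _ _).trans
        (mul_le_mul_of_nonneg_left (le_knorm p R ξ) (modNorm_nonneg _ _))
    refine abs_le_of_sq_le_sq' ?_ (mul_nonneg (Real.sqrt_nonneg _) (modNorm_nonneg _ _)) |>.2
    rw [mul_pow, Real.sq_sqrt (knorm_nonneg _ _)]
    exact h1.trans_eq (by ring)
  exact (pow_le_pow_left₀ (knorm_nonneg _ _) h 2).trans_eq (Real.sq_sqrt (knorm_nonneg _ _))

/-- `T⋆ T` is a positive element of `K(E)`. -/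
theorem exists_adj_comp_self_eq (T : CompactOp A E F) :
    ∃ b : CompactOp A E E, T.adj.comp T = star b * b :=
  IsLocallyCStarAlgebra.exists_eq_star_mul_self (kCStarSeminorm E)
    -- Monotonicity in `p` is not immediate: a larger seminorm increases the size of `Tξ` but also
    -- shrinks the unit ball.
    (fun {p q} hpq => knorm_mono (C := 1) fun ξ => by rw [one_mul]; exact modNorm_mono hpq ξ)
    nhds_zero_eq fun p =>
      (kCStarSeminorm E p).exists_toComplHom_eq_star_mul_self (star_adj_comp_self T)
        (knorm_star_mul_self_le p T)

/-- The algebraic identities are formal and positivity is `exists_adj_comp_self_eq`. For the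
topology, the seminorms `kCStarSeminorm E p` induce exactly `knorm p` on `K(E, A)`, and any other
continuous C⋆-seminorm adds nothing because `T ↦ T⋆T` is continuous at `0`. -/
instance : IsHilbertModule (CompactOp A E E) (CompactOp A E A) where
  isUniformAddGroup := inferInstance
  completeSpace := inferInstance
  add_rsmul _ _ _ := rfl
  rsmul_add S k l := ext fun ξ => S.1.map_add (k.1 ξ) (l.1 ξ)
  rsmul_mul _ _ _ := rfl
  smul_rsmul _ _ _ := rfl
  rsmul_smul c S k := ext fun ξ => S.1.map_smul c (k.1 ξ)
  ip_add_right S T R := ext fun ξ => S.1.adj.map_add (T.1 ξ) (R.1 ξ)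
  ip_smul_right c S T := ext fun ξ => S.1.adj.map_smul c (T.1 ξ)
  inner_rsmul_right _ _ _ := rfl
  star_inner S T := Subtype.ext
    ((Adjointable.adj_comp S.1.adj T.1).trans (by rw [Adjointable.adj_adj]; rfl))
  inner_self_pos := exists_adj_comp_self_eq
  inner_self_eq_zero T := by
    refine ⟨fun h => ext fun ξ => ?_, fun h => ?_⟩
    · have h1 : T.1.adj (T.1 ξ) = 0 := congrArg (fun R : CompactOp A E E => R.1 ξ) h
      change T.1 ξ = 0
      rw [← inner_self_eq_zero (A := A), inner_apply_left, h1]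
      simpa using ip_smul_right (A := A) 0 ξ (0 : E)
    · rw [h]
      exact ext fun ξ => (0 : CompactOp A E A).1.adj.1.map_zero
  nhds_zero := by
    refine le_antisymm (le_iInf fun q => ?_) ?_
    · rw [← tendsto_iff_comap]
      have h : Tendsto (fun T : CompactOp A E A => T.adj.comp T) (𝓝 0) (𝓝 0) := by
        rw [tendsto_zero_iff]
        intro p
        simp only [knorm_adj_comp_self]
        simpa using (tendsto_zero_iff.1 (tendsto_id (x := 𝓝 (0 : CompactOp A E A))) p).pow 2
      have h2 := (Real.continuous_sqrt.tendsto _).comp ((q.continuous_toFun.tendsto 0).comp h)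
      rwa [show q.toFun 0 = 0 from _root_.map_zero q.toSeminorm, Real.sqrt_zero] at h2
    · rw [nhds_zero_eq]
      refine le_iInf fun p => (iInf_le _ (kCStarSeminorm E p)).trans_eq ?_
      exact congrArg (Filter.comap · _) (funext (modNorm_kCStarSeminorm p))

end CompactOp

/-! ### Covariant maps and the induced action on `A`. -/

/-- The pull-back of a continuous C⋆-seminorm along a continuous morphism. -/
def ContCStarSeminorm.pullback {A B : Type*} [NonUnitalRing A] [StarRing A] [Module ℂ A]
    [TopologicalSpace A] [NonUnitalRing B] [StarRing B] [Module ℂ B] [TopologicalSpace B]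
    (p : ContCStarSeminorm B) (α : A →⋆ₙₐ[ℂ] B) (hα : Continuous α) : ContCStarSeminorm A where
  __ := p.toSeminorm.comp (α : A →ₗ[ℂ] B)
  mul_le a b := by
    change p.toCStarSeminorm (α (a * b)) ≤ _
    rw [map_mul]
    exact p.mul_le' _ _
  star_mul_self a := by
    change p.toCStarSeminorm (α (star a * a)) = _
    rw [map_mul, map_star]
    exact p.star_mul_self' _
  continuous_toFun := p.continuous_toFun.comp hα

theorem ContCStarSeminorm.pullback_apply {A B : Type*} [NonUnitalRing A] [StarRing A] [Module ℂ A]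
    [TopologicalSpace A] [NonUnitalRing B] [StarRing B] [Module ℂ B] [TopologicalSpace B]
    (p : ContCStarSeminorm B) (α : A →⋆ₙₐ[ℂ] B) (hα : Continuous α) (a : A) :
    (p.pullback α hα).toCStarSeminorm a = p.toCStarSeminorm (α a) := rfl

section Covariant

open IsHilbertModule

variable {A E F : Type*} [NonUnitalRing A] [StarRing A] [Module ℂ A] [UniformSpace A]
  [IsLocallyCStarAlgebra A]
  [AddCommGroup E] [Module ℂ E] [SMul Aᵐᵒᵖ E] [Inner A E] [UniformSpace E] [IsHilbertModule A E]
  [AddCommGroup F] [Module ℂ F] [SMul Aᵐᵒᵖ F] [Inner A F] [UniformSpace F] [IsHilbertModule A F]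

/-- A map of a Hilbert `A`-module that multiplies inner products by the morphism `α`. -/
def IsCovariant (α : A →⋆ₙₐ[ℂ] A) (u : E → E) : Prop :=
  ∀ ξ η : E, inner A (u ξ) (u η) = α (inner A ξ η)

namespace IsCovariant

variable {α : A →⋆ₙₐ[ℂ] A} {u : Equiv.Perm E} (h : IsCovariant α u)

include h

/-- Since `u` is surjective, testing against its values separates points; linearity of `u` and its
compatibility with the right action follow from this alone. -/
theorem ext_apply {ξ η : E} (hξη : ∀ ζ, inner A (u ζ) ξ = inner A (u ζ) η) : ξ = η :=
  ext_inner (A := A) fun ζ => by simpa using hξη (u.symm ζ)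

theorem map_add (ξ η : E) : u (ξ + η) = u ξ + u η :=
  h.ext_apply fun ζ => by rw [h, ip_add_right, ip_add_right, h, h, _root_.map_add]

theorem map_smul (c : ℂ) (ξ : E) : u (c • ξ) = c • u ξ :=
  h.ext_apply fun ζ => by rw [h, ip_smul_right, ip_smul_right, h, _root_.map_smul]

theorem map_rsmul (ξ : E) (a : A) : u (ξ <• a) = u ξ <• α a :=
  h.ext_apply fun ζ => by rw [h, inner_rsmul_right, inner_rsmul_right, h, map_mul]

theorem modNorm_apply (hα : Continuous α) (p : ContCStarSeminorm A) (ξ : E) :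
    modNorm p.toCStarSeminorm (u ξ) = modNorm (p.pullback α hα).toCStarSeminorm ξ := by
  rw [modNorm, h, modNorm, p.pullback_apply]

/-- A covariant bijection, as a linear map. -/
def toLinearMap : E →ₗ[ℂ] E where
  toFun := u
  map_add' := h.map_add
  map_smul' := h.map_smul

theorem continuous (hα : Continuous α) : Continuous u := by
  have := isUniformAddGroup (A := A) (E := E)
  refine continuous_of_continuousAt_zero h.toLinearMap.toAddMonoidHom ?_
  rw [ContinuousAt, map_zero, tendsto_zero_iff (A := A)]
  intro p
  refine Tendsto.congr (fun ξ => (h.modNorm_apply hα p ξ).symm) ?_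
  exact (tendsto_zero_iff (A := A)).1 tendsto_id (p.pullback α hα)

end IsCovariant

theorem IsFull.hom_ext (hE : IsFull A E) {α β : A →⋆ₙₐ[ℂ] A} (hα : Continuous α)
    (hβ : Continuous β) (h : ∀ ξ η : E, α (inner A ξ η) = β (inner A ξ η)) (a : A) :
    α a = β a := by
  refine congrFun (Continuous.ext_on hE hα hβ ?_) a
  refine LinearMap.eqOn_span (f := (α : A →ₗ[ℂ] A)) (g := (β : A →ₗ[ℂ] A)) ?_
  rintro _ ⟨ξ, η, rfl⟩
  exact h ξ η

/-- The morphisms attached to `u` and `u⁻¹` are inverse to each other on inner products, hence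
everywhere by fullness. -/
theorem IsFull.exists_algAut (hE : IsFull A E) (u : HilbertAut A E) :
    ∃ α : AlgAut A, ∀ ξ η : E, α.1 (inner A ξ η) = inner A (u.1 ξ) (u.1 η) := by
  obtain ⟨⟨α, hα, h⟩, β, hβ, k⟩ := u.2
  have h1 : ∀ a, β (α a) = a :=
    hE.hom_ext (α := β.comp α) (β := NonUnitalStarAlgHom.id ℂ A) (hβ.comp hα) continuous_id
      fun ξ η => by
        change β (α (inner A ξ η)) = inner A ξ η
        rw [← h, ← k, Equiv.symm_apply_apply, Equiv.symm_apply_apply]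
  have h2 : ∀ a, α (β a) = a :=
    hE.hom_ext (α := α.comp β) (β := NonUnitalStarAlgHom.id ℂ A) (hα.comp hβ) continuous_id
      fun ξ η => by
        change α (β (inner A ξ η)) = inner A ξ η
        rw [← k, ← h, Equiv.apply_symm_apply, Equiv.apply_symm_apply]
  exact ⟨⟨{ α with invFun := β, left_inv := h1, right_inv := h2, map_smul' := _root_.map_smul α },
    hα, hβ⟩, fun ξ η => (h ξ η).symm⟩

theorem IsFull.algAut_ext (hE : IsFull A E) {α β : AlgAut A}
    (h : ∀ ξ η : E, α.1 (inner A ξ η) = β.1 (inner A ξ η)) : α = β :=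
  Subtype.ext (StarAlgEquiv.ext (hE.hom_ext (α := (α.1 : A →⋆ₙₐ[ℂ] A)) (β := (β.1 : A →⋆ₙₐ[ℂ] A))
    α.2.1 β.2.1 h))

theorem IsFull.exists_algAction {G : Type*} [Group G] (hE : IsFull A E) (u : HilbertAction A E G) :
    ∃ α : AlgAction G A, (∀ g ξ η, (α g).1 (inner A ξ η) = inner A ((u g).1 ξ) ((u g).1 η)) ∧
      ∀ α' : AlgAction G A,
        (∀ g ξ η, (α' g).1 (inner A ξ η) = inner A ((u g).1 ξ) ((u g).1 η)) → α' = α := by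
  choose α hα using fun g => hE.exists_algAut (u g)
  -- The automorphisms are chosen separately for each `g`; fullness makes each unique, and
  -- multiplicativity follows.
  refine ⟨MonoidHom.mk' α fun g k => hE.algAut_ext fun ξ η => ?_, hα, fun α' hα' =>
    MonoidHom.ext fun g => hE.algAut_ext fun ξ η => (hα' g ξ η).trans (hα g ξ η).symm⟩
  rw [hα, map_mul]
  change _ = (α g).1 ((α k).1 _)
  rw [hα, hα]
  rfl

end Covariant

/-! ### Conjugation of operators by covariant bijections. -/

/-- The bijections of `E` that are covariant for the automorphism `α` of `A`. -/
structure CovariantPerm {A : Type*} [NonUnitalRing A] [StarRing A] [Module ℂ A]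
    [TopologicalSpace A] (α : AlgAut A) (E : Type*) [Inner A E] where
  perm : Equiv.Perm E
  inner_perm : ∀ ξ η, inner A (perm ξ) (perm η) = α.1 (inner A ξ η)

namespace CovariantPerm

open IsHilbertModule Adjointable

variable {A E F F' : Type*} [NonUnitalRing A] [StarRing A] [Module ℂ A] [UniformSpace A]
  [IsLocallyCStarAlgebra A]
  [AddCommGroup E] [Module ℂ E] [SMul Aᵐᵒᵖ E] [Inner A E] [UniformSpace E] [IsHilbertModule A E]
  [AddCommGroup F] [Module ℂ F] [SMul Aᵐᵒᵖ F] [Inner A F] [UniformSpace F] [IsHilbertModule A F]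
  [AddCommGroup F'] [Module ℂ F'] [SMul Aᵐᵒᵖ F'] [Inner A F'] [UniformSpace F']
  [IsHilbertModule A F'] {α : AlgAut A}

theorem isCovariant (u : CovariantPerm α E) : IsCovariant (α.1 : A →⋆ₙₐ[ℂ] A) u.perm :=
  u.inner_perm

/-- The inverse of a covariant bijection. -/
def symm (u : CovariantPerm α E) : CovariantPerm α⁻¹ E where
  perm := u.perm.symm
  inner_perm ξ η := by
    change _ = α.1.symm _
    rw [StarAlgEquiv.eq_symm_apply, ← u.inner_perm, Equiv.apply_symm_apply, Equiv.apply_symm_apply]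

variable (α) in
/-- The automorphism `α`, as a covariant bijection of `A`. -/
def self : CovariantPerm α A where
  perm := α.1.toEquiv
  inner_perm a b := by
    change star (α.1 a) * α.1 b = α.1 (star a * b)
    rw [_root_.map_mul, map_star]

theorem map_rsmul (u : CovariantPerm α E) (ξ : E) (a : A) :
    u.perm (ξ <• a) = u.perm ξ <• α.1 a := u.isCovariant.map_rsmul ξ a

theorem symm_rsmul (u : CovariantPerm α E) (ξ : E) (a : A) :
    u.perm.symm (ξ <• a) = u.perm.symm ξ <• α.1.symm a := u.symm.map_rsmul ξ a

theorem inner_perm_left (u : CovariantPerm α E) (ξ η : E) :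
    inner A (u.perm ξ) η = α.1 (inner A ξ (u.perm.symm η)) := by
  rw [← u.inner_perm, Equiv.apply_symm_apply]

theorem inner_perm_right (u : CovariantPerm α E) (ξ η : E) :
    inner A ξ (u.perm η) = α.1 (inner A (u.perm.symm ξ) η) := by
  rw [← u.inner_perm, Equiv.apply_symm_apply]

/-- The operator `w T u⁻¹`. -/
def conj (w : CovariantPerm α F) (u : CovariantPerm α E) (T : Adjointable A E F) :
    Adjointable A E F :=
  ⟨w.isCovariant.toLinearMap ∘ₗ T.1 ∘ₗ u.symm.isCovariant.toLinearMap, fun ξ a => by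
    change w.perm (T (u.perm.symm (ξ <• a))) = w.perm (T (u.perm.symm ξ)) <• a
    rw [symm_rsmul, Adjointable.map_rsmul, map_rsmul, StarAlgEquiv.apply_symm_apply],
   u.isCovariant.toLinearMap ∘ₗ T.adj.1 ∘ₗ w.symm.isCovariant.toLinearMap, fun η a => by
    change u.perm (T.adj (w.perm.symm (η <• a))) = u.perm (T.adj (w.perm.symm η)) <• a
    rw [symm_rsmul, Adjointable.map_rsmul, map_rsmul, StarAlgEquiv.apply_symm_apply],
   fun ξ η => by
    change inner A (w.perm (T (u.perm.symm ξ))) η = inner A ξ (u.perm (T.adj (w.perm.symm η)))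
    rw [inner_perm_left, inner_perm_right, inner_apply_left]⟩

theorem conj_apply (w : CovariantPerm α F) (u : CovariantPerm α E) (T : Adjointable A E F)
    (ξ : E) : conj w u T ξ = w.perm (T (u.perm.symm ξ)) := rfl

theorem adj_conj (w : CovariantPerm α F) (u : CovariantPerm α E) (T : Adjointable A E F) :
    (conj w u T).adj = conj u w T.adj :=
  (eq_adj fun ξ η => by
    rw [conj_apply, conj_apply, inner_perm_left, inner_perm_right, inner_apply_left]).symm

theorem conj_comp (w' : CovariantPerm α F') (w : CovariantPerm α F) (u : CovariantPerm α E)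
    (S : Adjointable A F F') (T : Adjointable A E F) :
    conj w' u (S.comp T) = (conj w' w S).comp (conj w u T) :=
  Adjointable.ext fun ξ => by
    rw [comp_apply, conj_apply, conj_apply, conj_apply, comp_apply, Equiv.symm_apply_apply]

theorem conj_add (w : CovariantPerm α F) (u : CovariantPerm α E) (S T : Adjointable A E F) :
    conj w u (S + T) = conj w u S + conj w u T :=
  Adjointable.ext fun ξ => w.isCovariant.map_add (S (u.perm.symm ξ)) (T (u.perm.symm ξ))

theorem conj_smul (w : CovariantPerm α F) (u : CovariantPerm α E) (c : ℂ)
    (T : Adjointable A E F) : conj w u (c • T) = c • conj w u T :=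
  Adjointable.ext fun ξ => w.isCovariant.map_smul c (T (u.perm.symm ξ))

theorem conj_theta (w : CovariantPerm α F) (u : CovariantPerm α E) (η : F) (ξ : E) :
    conj w u (theta η ξ) = theta (w.perm η) (u.perm ξ) :=
  Adjointable.ext fun ζ => by
    rw [conj_apply, theta_apply, theta_apply, map_rsmul, inner_perm_left]

/-- Conjugation as a linear map. -/
def conjₗ (w : CovariantPerm α F) (u : CovariantPerm α E) :
    Adjointable A E F →ₗ[ℂ] Adjointable A E F where
  toFun := conj w u
  map_add' := conj_add w u
  map_smul' := conj_smul w u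

/-- The map `u⁻¹` carries the `p`-unit ball into the unit ball of `p ∘ α`, and `w` carries the
seminorm of `p ∘ α` back to that of `p`. Conjugation is therefore continuous even when it preserves
no given seminorm. -/
theorem opNorm_conj_le (w : CovariantPerm α F) (u : CovariantPerm α E) (p : ContCStarSeminorm A)
    (T : Adjointable A E F) : opNorm p.toCStarSeminorm (conj w u T) ≤
      opNorm (p.pullback (α.1 : A →⋆ₙₐ[ℂ] A) α.2.1).toCStarSeminorm T :=
  iSup₂_le fun ξ hξ => by
    rw [conj_apply, w.isCovariant.modNorm_apply α.2.1]
    refine ofReal_modNorm_le_opNorm T ?_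
    rwa [← u.isCovariant.modNorm_apply α.2.1, Equiv.apply_symm_apply]

theorem continuous_conj (w : CovariantPerm α F) (u : CovariantPerm α E) :
    Continuous (conj w u) := by
  refine continuous_of_continuousAt_zero (conjₗ w u).toAddMonoidHom ?_
  rw [ContinuousAt, map_zero, Adjointable.tendsto_zero_iff]
  intro p
  exact tendsto_of_tendsto_of_tendsto_of_le_of_le tendsto_const_nhds
    (Adjointable.tendsto_zero_iff.1 tendsto_id (p.pullback (α.1 : A →⋆ₙₐ[ℂ] A) α.2.1))
    (fun _ => zero_le) (opNorm_conj_le w u p)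

theorem conj_mem_compacts (w : CovariantPerm α F) (u : CovariantPerm α E) {T : Adjointable A E F}
    (hT : T ∈ compacts A E F) : conj w u T ∈ compacts A E F := by
  refine map_mem_closure (continuous_conj w u) hT fun R hR => ?_
  have : finiteRank A E F ≤ (finiteRank A E F).comap (conjₗ w u) := by
    refine Submodule.span_le.2 ?_
    rintro _ ⟨η, ξ, rfl⟩
    exact Submodule.subset_span ⟨_, _, conj_theta w u η ξ⟩
  exact this hR

/-- Conjugation on the compact operators. -/
def conjK (w : CovariantPerm α F) (u : CovariantPerm α E) (T : CompactOp A E F) :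
    CompactOp A E F := ⟨conj w u T.1, conj_mem_compacts w u T.2⟩

theorem conjK_apply (w : CovariantPerm α F) (u : CovariantPerm α E) (T : CompactOp A E F)
    (ξ : E) : (conjK w u T).1 ξ = w.perm (T.1 (u.perm.symm ξ)) := rfl

theorem continuous_conjK (w : CovariantPerm α F) (u : CovariantPerm α E) :
    Continuous (conjK w u) :=
  ((continuous_conj w u).comp continuous_subtype_val).subtype_mk _

theorem conjK_theta (w : CovariantPerm α F) (u : CovariantPerm α E) (η : F) (ξ : E) :
    conjK w u (CompactOp.theta η ξ) = CompactOp.theta (w.perm η) (u.perm ξ) :=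
  Subtype.ext (conj_theta w u η ξ)

theorem conjK_symm_conjK (w : CovariantPerm α F) (u : CovariantPerm α E) (T : CompactOp A E F) :
    conjK w.symm u.symm (conjK w u T) = T :=
  CompactOp.ext fun ξ => by
    rw [conjK_apply, conjK_apply]
    exact (Equiv.symm_apply_apply _ _).trans (congrArg T.1 (Equiv.symm_apply_apply _ _))

theorem conjK_conjK_symm (w : CovariantPerm α F) (u : CovariantPerm α E) (T : CompactOp A E F) :
    conjK w u (conjK w.symm u.symm T) = T :=
  CompactOp.ext fun ξ => by
    rw [conjK_apply, conjK_apply]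
    exact (Equiv.apply_symm_apply _ _).trans (congrArg T.1 (Equiv.apply_symm_apply _ _))

/-- Conjugation as a bijection of `K(E, F)`. -/
def conjPerm (w : CovariantPerm α F) (u : CovariantPerm α E) : Equiv.Perm (CompactOp A E F) where
  toFun := conjK w u
  invFun := conjK w.symm u.symm
  left_inv := conjK_symm_conjK w u
  right_inv := conjK_conjK_symm w u

/-- Conjugation as a ⋆-homomorphism of `K(E)`. -/
def conjHom (u : CovariantPerm α E) : CompactOp A E E →⋆ₙₐ[ℂ] CompactOp A E E where
  toFun := conjK u u
  map_smul' c T := Subtype.ext (conj_smul u u c T.1)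
  map_zero' := Subtype.ext (conjₗ u u).map_zero
  map_add' S T := Subtype.ext (conj_add u u S.1 T.1)
  map_mul' S T := Subtype.ext (conj_comp u u u S.1 T.1)
  map_star' T := Subtype.ext (adj_conj u u T.1).symm

theorem inner_conjK (w : CovariantPerm α A) (u : CovariantPerm α E) (S T : CompactOp A E A) :
    inner (CompactOp A E E) (conjK w u S) (conjK w u T) =
      conjHom u (inner (CompactOp A E E) S T) :=
  Subtype.ext <| by
    change (conj w u S.1).adj.comp (conj w u T.1) = conj u u (S.1.adj.comp T.1)
    rw [adj_conj, conj_comp]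

theorem conjPerm_mem_hilbertAut (w : CovariantPerm α A) (u : CovariantPerm α E) :
    conjPerm w u ∈ HilbertAut (CompactOp A E E) (CompactOp A E A) :=
  ⟨⟨conjHom u, continuous_conjK u u, inner_conjK w u⟩,
    conjHom u.symm, continuous_conjK u.symm u.symm, inner_conjK w.symm u.symm⟩

theorem knorm_conjK_le (w : CovariantPerm α F) (u : CovariantPerm α E) {p : ContCStarSeminorm A}
    (hp : ∀ a, p.toCStarSeminorm (α.1 a) = p.toCStarSeminorm a) (T : CompactOp A E F) :
    CompactOp.knorm p (conjK w u T) ≤ CompactOp.knorm p T := by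
  have hw : ∀ η, modNorm p.toCStarSeminorm (w.perm η) = modNorm p.toCStarSeminorm η := fun η => by
    rw [modNorm, w.inner_perm, hp, modNorm]
  have hu : ∀ ξ, modNorm p.toCStarSeminorm (u.perm.symm ξ) = modNorm p.toCStarSeminorm ξ :=
    fun ξ => by rw [modNorm, ← hp, ← u.inner_perm, Equiv.apply_symm_apply, modNorm]
  refine CompactOp.knorm_le (CompactOp.knorm_nonneg _ _) fun ξ => ?_
  rw [conjK_apply, hw, ← hu ξ]
  exact CompactOp.le_knorm p T _

theorem knorm_conjK (w : CovariantPerm α F) (u : CovariantPerm α E) {p : ContCStarSeminorm A}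
    (hp : ∀ a, p.toCStarSeminorm (α.1 a) = p.toCStarSeminorm a) (T : CompactOp A E F) :
    CompactOp.knorm p (conjK w u T) = CompactOp.knorm p T := by
  refine le_antisymm (knorm_conjK_le w u hp T) ?_
  have h := knorm_conjK_le w.symm u.symm (p := p) (fun a => ?_) (conjK w u T)
  · rwa [conjK_symm_conjK] at h
  · change p.toCStarSeminorm (α.1.symm a) = _
    rw [← hp, StarAlgEquiv.apply_symm_apply]

end CovariantPerm

/-! ### Density of rank one operators and the induced action. -/

namespace CompactOp

variable {A E F : Type*} [NonUnitalRing A] [StarRing A] [Module ℂ A] [UniformSpace A]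
  [IsLocallyCStarAlgebra A]
  [AddCommGroup E] [Module ℂ E] [SMul Aᵐᵒᵖ E] [Inner A E] [UniformSpace E] [IsHilbertModule A E]
  [AddCommGroup F] [Module ℂ F] [SMul Aᵐᵒᵖ F] [Inner A F] [UniformSpace F] [IsHilbertModule A F]

@[elab_as_elim]
theorem induction {P : CompactOp A E F → Prop} (T : CompactOp A E F) (hc : IsClosed {T | P T})
    (theta : ∀ η ξ, P (theta η ξ)) (zero : P 0) (add : ∀ S T, P S → P T → P (S + T))
    (smul : ∀ (c : ℂ) T, P T → P (c • T)) : P T := by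
  have h1 : ∀ T ∈ finiteRank A E F, ∀ hT : T ∈ compacts A E F, P ⟨T, hT⟩ := by
    have hle : finiteRank A E F ≤ compacts A E F := Submodule.le_topologicalClosure _
    intro T hT
    refine Submodule.span_induction
      (p := fun T _ => ∀ hT : T ∈ compacts A E F, P ⟨T, hT⟩) ?_ ?_ ?_ ?_ hT
    · rintro _ ⟨η, ξ, rfl⟩ _
      exact theta η ξ
    · exact fun _ => zero
    · exact fun S T hS hT h h' _ => add ⟨S, hle hS⟩ ⟨T, hle hT⟩ (h _) (h' _)
    · exact fun c T hT h _ => smul c ⟨T, hle hT⟩ (h _)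
  -- `K(E, F)` is a closure taken in `L(E, F)`; the subspace topology transfers density to the
  -- subtype.
  have h2 : T ∈ closure {T : CompactOp A E F | T.1 ∈ finiteRank A E F} := by
    rw [IsInducing.subtypeVal.closure_eq_preimage_closure_image]
    refine closure_mono (fun R hR => ?_) T.2
    exact ⟨⟨R, Submodule.le_topologicalClosure _ hR⟩, hR, rfl⟩
  exact closure_minimal (fun R hR => h1 R.1 hR R.2) hc h2

/-- Covariance makes both automorphisms linear and continuous, and rank one operators span a dense
subspace. This yields both the uniqueness of the action and its multiplicativity. -/
theorem hilbertAut_ext {v w : HilbertAut (CompactOp A E E) (CompactOp A E A)}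
    (h : ∀ (a : A) (ξ : E), v.1 (theta a ξ) = w.1 (theta a ξ)) : v = w := by
  obtain ⟨α, hα, hv⟩ := v.2.1
  obtain ⟨β, hβ, hw⟩ := w.2.1
  have hv : IsCovariant α v.1 := hv
  have hw : IsCovariant β w.1 := hw
  refine Subtype.ext (Equiv.ext fun T => ?_)
  induction T using CompactOp.induction with
  | hc => exact isClosed_eq (hv.continuous hα) (hw.continuous hβ)
  | theta a ξ => exact h a ξ
  | zero => exact hv.toLinearMap.map_zero.trans hw.toLinearMap.map_zero.symm
  | add S T hS hT => rw [hv.map_add, hw.map_add, hS, hT]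
  | smul c T hT => rw [hv.map_smul, hw.map_smul, hT]

/-- The action of `G` on `K(E, A)` induced by an action on `E`. -/
def inducedAction {G : Type*} [Group G] (u : HilbertAction A E G) (α : AlgAction G A)
    (h : ∀ g ξ η, (α g).1 (inner A ξ η) = inner A ((u g).1 ξ) ((u g).1 η)) :
    HilbertAction (CompactOp A E E) (CompactOp A E A) G :=
  MonoidHom.mk' (fun g => ⟨CovariantPerm.conjPerm (CovariantPerm.self (α g))
      ⟨(u g).1, fun ξ η => (h g ξ η).symm⟩, CovariantPerm.conjPerm_mem_hilbertAut _ _⟩)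
    fun g k => hilbertAut_ext fun a ξ => by
      change CovariantPerm.conjK _ _ _ = CovariantPerm.conjK _ _ (CovariantPerm.conjK _ _ _)
      rw [CovariantPerm.conjK_theta, CovariantPerm.conjK_theta, CovariantPerm.conjK_theta]
      change theta ((α (g * k)).1 a) ((u (g * k)).1 ξ) = _
      rw [map_mul, map_mul]
      rfl

/-- The action of `G` on `K(E)` induced by an action on `E`. -/
def inducedHom {G : Type*} [Group G] (u : HilbertAction A E G) (α : AlgAction G A)
    (h : ∀ g ξ η, (α g).1 (inner A ξ η) = inner A ((u g).1 ξ) ((u g).1 η)) (g : G) :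
    CompactOp A E E →⋆ₙₐ[ℂ] CompactOp A E E :=
  CovariantPerm.conjHom (α := α g) ⟨(u g).1, fun ξ η => (h g ξ η).symm⟩

end CompactOp

/-! ### Extension of biadditive maps to completions. -/

section BiExtend

variable {X Y Z : Type*} [SeminormedAddCommGroup X] [SeminormedAddCommGroup Y]
  [SeminormedAddCommGroup Z] (φ : X →+ Y →+ Z)

/-- The extension of a biadditive map to the completions. -/
def biExtend : Completion X → Completion Y → Completion Z :=
  Function.curry <| (Completion.isDenseInducing_coe.prodMap Completion.isDenseInducing_coe).extend
    fun x : X × Y => (φ x.1 x.2 : Completion Z)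

variable {φ} (hφ : ∀ x y, ‖φ x y‖ ≤ ‖x‖ * ‖y‖)

include hφ

theorem continuous_of_norm_le_mul : Continuous fun x : X × Y => φ x.1 x.2 := by
  refine continuous_iff_continuousAt.2 fun ⟨x₀, y₀⟩ => ?_
  rw [ContinuousAt, tendsto_iff_norm_sub_tendsto_zero]
  have h1 : Tendsto (fun x : X × Y => ‖x.1 - x₀‖ * ‖x.2‖ + ‖x₀‖ * ‖x.2 - y₀‖) (𝓝 (x₀, y₀))
      (𝓝 (‖x₀ - x₀‖ * ‖y₀‖ + ‖x₀‖ * ‖y₀ - y₀‖)) := by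
    refine Continuous.tendsto (f := fun x : X × Y =>
      ‖x.1 - x₀‖ * ‖x.2‖ + ‖x₀‖ * ‖x.2 - y₀‖) (by fun_prop) (x₀, y₀)
  simp only [sub_self, norm_zero, zero_mul, mul_zero, add_zero] at h1
  refine squeeze_zero (fun _ => norm_nonneg _) (fun x => ?_) h1
  have e : φ x.1 x.2 - φ x₀ y₀ = φ (x.1 - x₀) x.2 + φ x₀ (x.2 - y₀) := by
    rw [map_sub, map_sub, AddMonoidHom.sub_apply]
    abel
  rw [e]
  exact (norm_add_le _ _).trans (add_le_add (hφ _ _) (hφ _ _))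

theorem biExtend_coe (x : X) (y : Y) : biExtend φ x y = (φ x y : Completion Z) :=
  (Completion.isDenseInducing_coe.prodMap Completion.isDenseInducing_coe).extend_eq
    ((Completion.continuous_coe _).comp (continuous_of_norm_le_mul hφ)) (x, y)

/-- A biadditive map need not be uniformly continuous, so joint continuity comes from the extension
theorem for biadditive maps on dense subgroups. -/
theorem continuous_biExtend : Continuous fun x : Completion X × Completion Y =>
    biExtend φ x.1 x.2 := by
  have dX : IsDenseInducing (Completion.toCompl : X → Completion X) :=
    Completion.isDenseInducing_coe
  have dY : IsDenseInducing (Completion.toCompl : Y → Completion Y) :=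
    Completion.isDenseInducing_coe
  have : Continuous fun x : X × Y => (φ.compr₂ (Completion.toCompl : Z →+ Completion Z)) x.1 x.2 :=
    (Completion.continuous_coe _).comp (continuous_of_norm_le_mul hφ)
  exact (dX.extend_Z_bilin dY this :)

end BiExtend

/-! ### Completions of a Hilbert module as Hilbert C⋆-modules. -/

/-- The norm of a C⋆-algebra, as a continuous C⋆-seminorm. -/
def normContCStarSeminorm (B : Type*) [NonUnitalCStarAlgebra B] : ContCStarSeminorm B where
  __ := normSeminorm ℂ B
  mul_le := norm_mul_le
  star_mul_self b := by
    change ‖star b * b‖ = ‖b‖ ^ 2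
    rw [CStarRing.norm_star_mul_self, sq]
  continuous_toFun := continuous_norm

open IsHilbertModule

section ModCompl

variable {A E F : Type*} [NonUnitalRing A] [StarRing A] [Module ℂ A] [UniformSpace A]
  [IsLocallyCStarAlgebra A]
  [AddCommGroup E] [Module ℂ E] [SMul Aᵐᵒᵖ E] [Inner A E] [UniformSpace E] [IsHilbertModule A E]

/-- The module `E`, equipped with the seminorm `modNorm p`. -/
def WithModSeminorm (_ : CStarSeminorm A) (E : Type*) : Type _ := E

instance (p : CStarSeminorm A) : AddCommGroup (WithModSeminorm p E) :=
  inferInstanceAs (AddCommGroup E)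

instance (p : CStarSeminorm A) : Module ℂ (WithModSeminorm p E) := inferInstanceAs (Module ℂ E)

instance (p : CStarSeminorm A) : SeminormedAddCommGroup (WithModSeminorm p E) :=
  AddGroupSeminorm.toSeminormedAddCommGroup (E := WithModSeminorm p E)
    (modSeminorm (E := E) p).toAddGroupSeminorm

instance (p : CStarSeminorm A) : NormedSpace ℂ (WithModSeminorm p E) where
  norm_smul_le c ξ := (modNorm_smul (E := E) p c ξ).le

/-- The Hausdorff completion of `E` with respect to `modNorm p`. -/
abbrev ModCompl (p : CStarSeminorm A) (E : Type*) [AddCommGroup E] [Module ℂ E] [SMul Aᵐᵒᵖ E]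
    [Inner A E] [UniformSpace E] [IsHilbertModule A E] : Type _ :=
  Completion (WithModSeminorm p E)

variable (E) in
/-- The canonical map of `E` into its completion. -/
def toModCompl (p : CStarSeminorm A) : E →ₗ[ℂ] ModCompl p E where
  toFun ξ := ((show WithModSeminorm p E from ξ : WithModSeminorm p E) : ModCompl p E)
  map_add' ξ η := Completion.coe_add (show WithModSeminorm p E from ξ) η
  map_smul' c ξ := Completion.coe_smul c (show WithModSeminorm p E from ξ)

theorem norm_toModCompl (p : CStarSeminorm A) (ξ : E) : ‖toModCompl E p ξ‖ = modNorm p ξ :=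
  Completion.norm_coe (show WithModSeminorm p E from ξ)

theorem denseRange_toModCompl (p : CStarSeminorm A) : DenseRange (toModCompl E p) :=
  Completion.denseRange_coe (α := WithModSeminorm p E)

namespace ModCompl

@[elab_as_elim]
theorem induction {p : CStarSeminorm A} {P : ModCompl p E → Prop} (x : ModCompl p E)
    (hc : IsClosed {x | P x}) (h : ∀ ξ : E, P (toModCompl E p ξ)) : P x :=
  Completion.induction_on x hc h

@[elab_as_elim]
theorem induction₂ {p : CStarSeminorm A} {P : ModCompl p E → ModCompl p E → Prop}
    (x y : ModCompl p E) (hc : IsClosed {x : ModCompl p E × ModCompl p E | P x.1 x.2})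
    (h : ∀ ξ η : E, P (toModCompl E p ξ) (toModCompl E p η)) : P x y :=
  Completion.induction_on₂ x y hc h

variable (E) in
/-- The right action as a biadditive map. -/
def rsmulHom (p : CStarSeminorm A) :
    WithModSeminorm p E →+ p.WithSeminorm →+ WithModSeminorm p E :=
  AddMonoidHom.mk' (fun ξ => AddMonoidHom.mk' (fun a => (show E from ξ) <• (show A from a))
    (rsmul_add (A := A) (show E from ξ))) fun ξ η => AddMonoidHom.ext fun a =>
      add_rsmul (A := A) (show E from ξ) (show E from η) (show A from a)

theorem norm_rsmulHom_le (p : CStarSeminorm A) (ξ : WithModSeminorm p E) (a : p.WithSeminorm) :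
    ‖rsmulHom E p ξ a‖ ≤ ‖ξ‖ * ‖a‖ := modNorm_rsmul_le (E := E) p ξ a

variable (E) in
/-- The inner product as a biadditive map. -/
def innerHom (p : CStarSeminorm A) :
    WithModSeminorm p E →+ WithModSeminorm p E →+ p.WithSeminorm :=
  AddMonoidHom.mk' (fun ξ => AddMonoidHom.mk' (fun η => inner A (show E from ξ) (show E from η))
    (ip_add_right (A := A) (show E from ξ))) fun ξ η => AddMonoidHom.ext fun ζ =>
      ip_add_left (A := A) (show E from ξ) (show E from η) (show E from ζ)

theorem norm_innerHom_le (p : CStarSeminorm A) (ξ η : WithModSeminorm p E) :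
    ‖innerHom E p ξ η‖ ≤ ‖ξ‖ * ‖η‖ := cauchy_schwarz (E := E) p ξ η

instance (p : CStarSeminorm A) : SMul p.Complᵐᵒᵖ (ModCompl p E) :=
  ⟨fun a x => biExtend (rsmulHom E p) x a.unop⟩

instance (p : CStarSeminorm A) : Inner p.Compl (ModCompl p E) := ⟨biExtend (innerHom E p)⟩

variable {p : CStarSeminorm A}

theorem rsmul_coe (ξ : E) (a : A) :
    toModCompl E p ξ <• p.toComplHom a = toModCompl E p (ξ <• a) :=
  biExtend_coe (norm_rsmulHom_le p) _ _

theorem inner_coe (ξ η : E) :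
    inner p.Compl (toModCompl E p ξ) (toModCompl E p η) = p.toComplHom (inner A ξ η) :=
  biExtend_coe (norm_innerHom_le p) _ _

theorem continuous_rsmul {Z : Type*} [TopologicalSpace Z] {f : Z → ModCompl p E}
    {g : Z → p.Compl} (hf : Continuous f) (hg : Continuous g) :
    Continuous fun z => f z <• g z :=
  (continuous_biExtend (norm_rsmulHom_le p)).comp (hf.prodMk hg)

theorem continuous_inner {Z : Type*} [TopologicalSpace Z] {f g : Z → ModCompl p E}
    (hf : Continuous f) (hg : Continuous g) :
    Continuous fun z => inner p.Compl (f z) (g z) :=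
  (continuous_biExtend (norm_innerHom_le p)).comp (hf.prodMk hg)

theorem continuous_const_rsmul (x : ModCompl p E) : Continuous fun a : p.Compl => x <• a :=
  continuous_rsmul continuous_const continuous_id

theorem add_rsmul' (x y : ModCompl p E) (a : p.Compl) : (x + y) <• a = x <• a + y <• a := by
  induction a using CStarSeminorm.compl_induction with
  | hc =>
    exact isClosed_eq (continuous_const_rsmul _)
      ((continuous_const_rsmul x).add (continuous_const_rsmul y))
  | h a =>
    refine induction₂ x y (isClosed_eq (continuous_rsmul (by fun_prop) continuous_const)
      ((continuous_rsmul continuous_fst continuous_const).add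
        (continuous_rsmul continuous_snd continuous_const))) fun ξ η => ?_
    rw [← map_add, rsmul_coe, rsmul_coe, rsmul_coe, add_rsmul, map_add]

theorem norm_inner_self (x : ModCompl p E) : ‖inner p.Compl x x‖ = ‖x‖ ^ 2 :=
  induction x (isClosed_eq (continuous_inner continuous_id continuous_id).norm (by fun_prop))
    fun ξ => by
      rw [inner_coe, CStarSeminorm.norm_toComplHom, norm_toModCompl, modNorm_sq]

/-- The identities are closed conditions that hold on the image of `E`. Positivity survives because
the positive cone of a C⋆-algebra is closed, and definiteness follows from `‖⟨x, x⟩‖ = ‖x‖²`. For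
the topology, the C⋆-norm already recovers the norm of the completion, and all other continuous
C⋆-seminorms give continuous functions. -/
instance : IsHilbertModule p.Compl (ModCompl p E) where
  isUniformAddGroup := inferInstance
  completeSpace := inferInstance
  add_rsmul := add_rsmul'
  rsmul_add x a b := by
    induction x using induction with
    | hc =>
      exact isClosed_eq (continuous_rsmul continuous_id continuous_const)
        ((continuous_rsmul continuous_id continuous_const).add
          (continuous_rsmul continuous_id continuous_const))
    | h ξ =>
      refine CStarSeminorm.compl_induction₂ a b
        (isClosed_eq (continuous_rsmul continuous_const (by fun_prop))
        (((continuous_const_rsmul (toModCompl E p ξ)).comp continuous_fst).add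
          ((continuous_const_rsmul (toModCompl E p ξ)).comp continuous_snd))) fun a b => ?_
      rw [← map_add, rsmul_coe, rsmul_coe, rsmul_coe, rsmul_add, map_add]
  rsmul_mul x a b := by
    induction x using induction with
    | hc =>
      exact isClosed_eq (continuous_rsmul continuous_id continuous_const)
        (continuous_rsmul (continuous_rsmul continuous_id continuous_const) continuous_const)
    | h ξ =>
      refine CStarSeminorm.compl_induction₂ a b
        (isClosed_eq (continuous_rsmul continuous_const (by fun_prop))
        (continuous_rsmul (continuous_rsmul continuous_const continuous_fst) continuous_snd))
        fun a b => ?_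
      rw [← map_mul, rsmul_coe, rsmul_coe, rsmul_coe, rsmul_mul]
  smul_rsmul c x a := by
    induction x using induction with
    | hc =>
      exact isClosed_eq (continuous_rsmul (continuous_const_smul c) continuous_const)
        ((continuous_rsmul continuous_id continuous_const).const_smul c)
    | h ξ =>
      refine CStarSeminorm.compl_induction a
        (isClosed_eq (continuous_rsmul continuous_const continuous_id)
        ((continuous_const_rsmul (toModCompl E p ξ)).const_smul c)) fun a => ?_
      rw [← map_smul, rsmul_coe, rsmul_coe, smul_rsmul, map_smul]
  rsmul_smul c x a := by
    induction x using induction with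
    | hc =>
      exact isClosed_eq (continuous_rsmul continuous_id continuous_const)
        ((continuous_rsmul continuous_id continuous_const).const_smul c)
    | h ξ =>
      refine CStarSeminorm.compl_induction a
        (isClosed_eq (continuous_rsmul continuous_const (continuous_const_smul c))
        ((continuous_const_rsmul (toModCompl E p ξ)).const_smul c)) fun a => ?_
      rw [← map_smul p.toComplHom, rsmul_coe, rsmul_coe, rsmul_smul, map_smul]
  ip_add_right x y z := by
    induction x using induction with
    | hc =>
      exact isClosed_eq (continuous_inner continuous_id continuous_const)
        ((continuous_inner continuous_id continuous_const).add
          (continuous_inner continuous_id continuous_const))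
    | h ξ =>
      refine induction₂ y z
        (isClosed_eq (continuous_inner continuous_const (by fun_prop))
        ((continuous_inner continuous_const continuous_fst).add
          (continuous_inner continuous_const continuous_snd))) fun η ζ => ?_
      rw [← map_add, inner_coe, inner_coe, inner_coe, ip_add_right, map_add]
  ip_smul_right c x y := induction₂ x y
    (isClosed_eq (continuous_inner continuous_fst (continuous_snd.const_smul c))
      ((continuous_inner continuous_fst continuous_snd).const_smul c)) fun ξ η => by
        rw [← map_smul, inner_coe, inner_coe, ip_smul_right, map_smul]
  inner_rsmul_right x y a := by
    induction a using CStarSeminorm.compl_induction with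
    | hc =>
      exact isClosed_eq
        (continuous_inner continuous_const (continuous_rsmul continuous_const continuous_id))
        (continuous_const.mul continuous_id)
    | h a =>
      refine induction₂ x y (isClosed_eq
        (continuous_inner continuous_fst (continuous_rsmul continuous_snd continuous_const))
        ((continuous_inner continuous_fst continuous_snd).mul continuous_const)) fun ξ η => ?_
      rw [rsmul_coe, inner_coe, inner_coe, inner_rsmul_right, map_mul]
  star_inner x y := induction₂ x y
    (isClosed_eq (continuous_inner continuous_fst continuous_snd).star
      (continuous_inner continuous_snd continuous_fst)) fun ξ η => by
        rw [inner_coe, inner_coe, ← map_star, star_inner]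
  inner_self_pos x := induction x
    ((isClosed_setOf_star_mul_self (B := p.Compl)).preimage
      (continuous_inner (E := E) (p := p) continuous_id continuous_id))
    fun ξ => by
      obtain ⟨b, hb⟩ := inner_self_pos (A := A) ξ
      exact ⟨p.toComplHom b, by rw [inner_coe, hb, map_mul, map_star]⟩
  inner_self_eq_zero x := by
    rw [← norm_eq_zero, norm_inner_self, sq_eq_zero_iff, norm_eq_zero]
  nhds_zero := by
    have h : ∀ x : ModCompl p E,
        modNorm (normContCStarSeminorm p.Compl).toCStarSeminorm x = ‖x‖ := fun x => by
      change √‖inner p.Compl x x‖ = _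
      rw [norm_inner_self, Real.sqrt_sq (norm_nonneg x)]
    refine le_antisymm (le_iInf fun r => ?_) ?_
    · rw [← tendsto_iff_comap]
      have h1 : Continuous (modNorm r.toCStarSeminorm : ModCompl p E → ℝ) :=
        (r.continuous_toFun.comp (continuous_inner continuous_id continuous_id)).sqrt
      have h2 := h1.tendsto 0
      have h3 : modNorm r.toCStarSeminorm (0 : ModCompl p E) = 0 := by
        have : inner p.Compl (0 : ModCompl p E) 0 = 0 := by
          rw [← norm_eq_zero, norm_inner_self, norm_zero, zero_pow two_ne_zero]
        rw [modNorm, this, map_zero, Real.sqrt_zero]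
      rwa [h3] at h2
    · refine (iInf_le _ (normContCStarSeminorm p.Compl)).trans ?_
      rw [funext h, comap_norm_nhds_zero]

section Map

variable {q r : CStarSeminorm A} (f : E →ₗ[ℂ] E) (hf : ∀ ξ, modNorm q (f ξ) ≤ modNorm p ξ)

/-- A contractive linear map, as a homomorphism of seminormed groups. -/
def normedHom : NormedAddGroupHom (WithModSeminorm p E) (WithModSeminorm q E) where
  toFun ξ := f ξ
  map_add' ξ η := map_add f ξ η
  bound' := ⟨1, fun ξ => by rw [one_mul]; exact hf ξ⟩

/-- The extension of a contractive linear map to the completions. -/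
def map : ModCompl p E →ₗ[ℂ] ModCompl q E where
  toFun := (normedHom f hf).completion
  map_add' := map_add _
  map_smul' c x := by
    have := (normedHom f hf).completion.continuous
    exact induction x (isClosed_eq (this.comp (continuous_const_smul c)) (this.const_smul c))
      fun ξ => by
        have h (η : E) : (normedHom f hf).completion (toModCompl E p η) = toModCompl E q (f η) :=
          NormedAddGroupHom.completion_coe (normedHom f hf) η
        rw [RingHom.id_apply, ← map_smul, h, h, map_smul, map_smul]

theorem continuous_map : Continuous (map f hf) := (normedHom f hf).completion.continuous

theorem map_coe (ξ : E) : map f hf (toModCompl E p ξ) = toModCompl E q (f ξ) :=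
  NormedAddGroupHom.completion_coe (normedHom f hf) ξ

theorem norm_map_le (x : ModCompl p E) : ‖map f hf x‖ ≤ ‖x‖ := by
  have := continuous_map f hf
  exact induction x (isClosed_le (by fun_prop) (by fun_prop)) fun ξ => by
    rw [map_coe, norm_toModCompl, norm_toModCompl]; exact hf ξ

theorem map_map {g : E →ₗ[ℂ] E} {hg : ∀ ξ, modNorm r (g ξ) ≤ modNorm q ξ} {k : E →ₗ[ℂ] E}
    {hk : ∀ ξ, modNorm r (k ξ) ≤ modNorm p ξ} (h : ∀ ξ, g (f ξ) = k ξ) (x : ModCompl p E) :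
    map g hg (map f hf x) = map k hk x := by
  refine induction x (isClosed_eq ((continuous_map g hg).comp (continuous_map f hf))
    (continuous_map k hk)) fun ξ => ?_
  rw [map_coe, map_coe, map_coe, h]

theorem map_eq_self {k : E →ₗ[ℂ] E} {hk : ∀ ξ, modNorm p (k ξ) ≤ modNorm p ξ}
    (h : ∀ ξ, k ξ = ξ) (x : ModCompl p E) : map k hk x = x := by
  refine induction x (isClosed_eq (continuous_map k hk) continuous_id) fun ξ => ?_
  rw [map_coe, h]

/-- The general pair `(f, α)` covers two uses: identities give the connecting maps, and `(v g, β g)`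
gives the action on a completion. -/
theorem inner_map {α : A →⋆ₙₐ[ℂ] A} {hα : ∀ a, q (α a) ≤ p a}
    (h : ∀ ξ η, inner A (f ξ) (f η) = α (inner A ξ η)) (x y : ModCompl p E) :
    inner q.Compl (map f hf x) (map f hf y) = CStarSeminorm.complMap α hα (inner p.Compl x y) := by
  have h1 := continuous_map f hf
  have h2 := CStarSeminorm.continuous_complMap α hα
  refine induction₂ x y (isClosed_eq
    (continuous_inner (h1.comp continuous_fst) (h1.comp continuous_snd))
    (h2.comp (continuous_inner continuous_fst continuous_snd))) fun ξ η => ?_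
  rw [map_coe, map_coe, inner_coe, inner_coe, CStarSeminorm.complMap_coe, h]

theorem map_rsmul {α : A →⋆ₙₐ[ℂ] A} {hα : ∀ a, q (α a) ≤ p a}
    (h : ∀ ξ a, f (ξ <• a) = f ξ <• α a) (x : ModCompl p E) (a : p.Compl) :
    map f hf (x <• a) = map f hf x <• CStarSeminorm.complMap α hα a := by
  have h1 := continuous_map f hf
  have h2 := CStarSeminorm.continuous_complMap α hα
  induction x using induction with
  | hc =>
    exact isClosed_eq (h1.comp (continuous_rsmul continuous_id continuous_const))
      (continuous_rsmul h1 continuous_const)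
  | h ξ =>
    refine CStarSeminorm.compl_induction a (isClosed_eq
      (h1.comp (continuous_rsmul continuous_const continuous_id))
      (continuous_rsmul continuous_const h2)) fun a => ?_
    rw [rsmul_coe, map_coe, map_coe, CStarSeminorm.complMap_coe, rsmul_coe, h]

end Map

end ModCompl

end ModCompl

/-! ### Directed generating families of seminorms. -/

section Directed

/-- A continuous seminorm is dominated by a member of any directed generating family. -/
theorem exists_le_mul_of_nhds_zero_eq {X Λ : Type*} [AddCommGroup X] [Module ℂ X]
    [TopologicalSpace X] [Preorder Λ] [IsDirectedOrder Λ] [Nonempty Λ] {r : Λ → Seminorm ℂ X}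
    (hr : ∀ {i j}, i ≤ j → ∀ x, r i x ≤ r j x) (hgen : 𝓝 (0 : X) = ⨅ i, comap (r i) (𝓝 0))
    {p : Seminorm ℂ X} (hp : Continuous p) : ∃ i, ∃ C : ℝ, 0 ≤ C ∧ ∀ x, p x ≤ C * r i x := by
  have h1 : {x | p x < 1} ∈ 𝓝 (0 : X) :=
    hp.continuousAt.eventually_lt continuousAt_const (by simp)
  have hdir : Directed (· ≥ ·) fun i => comap (r i) (𝓝 0) := fun i j => by
    obtain ⟨k, hik, hjk⟩ := exists_ge_ge i j
    have : ∀ {i}, i ≤ k → comap (r k) (𝓝 0) ≤ comap (r i) (𝓝 0) := fun {i} hik => by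
      rw [← tendsto_iff_comap]
      exact squeeze_zero (fun _ => apply_nonneg _ _) (hr hik) tendsto_comap
    exact ⟨k, this hik, this hjk⟩
  rw [hgen, mem_iInf_of_directed hdir] at h1
  obtain ⟨i, s, hs, hsub⟩ := h1
  obtain ⟨ε, hε, hs⟩ := Metric.mem_nhds_iff.1 hs
  refine ⟨i, 2 / ε, by positivity, fun x => ?_⟩
  -- By homogeneity `x` may be rescaled to `p x = 1`; the rescaled point then lies in the ball of
  -- radius `ε`, where `p < 1`. Any constant at least `1 / ε` would do.
  by_contra! hlt
  have hpos : 0 < p x := lt_of_le_of_lt (by positivity) hlt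
  have h2 : ((((p x)⁻¹ : ℝ) : ℂ) • x) ∈ {x | p x < 1} := by
    refine hsub (hs ?_)
    rw [mem_ball_zero_iff, map_smul_eq_mul, Complex.norm_real, norm_mul, norm_norm,
      Real.norm_of_nonneg (inv_nonneg.2 hpos.le), Real.norm_of_nonneg (apply_nonneg _ _),
      inv_mul_lt_iff₀ hpos]
    rw [div_mul_eq_mul_div, div_lt_iff₀ hε] at hlt
    linarith [apply_nonneg (r i) x]
  change p _ < 1 at h2
  rw [map_smul_eq_mul, Complex.norm_real,
    Real.norm_of_nonneg (inv_nonneg.2 hpos.le), inv_mul_cancel₀ hpos.ne'] at h2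
  exact lt_irrefl _ h2

theorem comap_nhds_zero_le_of_le_mul {X : Type*} {p q : X → ℝ} {C : ℝ} (hp : ∀ x, 0 ≤ p x)
    (h : ∀ x, p x ≤ C * q x) : comap q (𝓝 0) ≤ comap p (𝓝 0) := by
  rw [← tendsto_iff_comap]
  refine squeeze_zero hp h ?_
  simpa using (tendsto_comap (f := q) (x := 𝓝 0)).const_mul C

variable {A E F : Type*} [NonUnitalRing A] [StarRing A] [Module ℂ A] [UniformSpace A]
  [IsLocallyCStarAlgebra A]
  [AddCommGroup E] [Module ℂ E] [SMul Aᵐᵒᵖ E] [Inner A E] [UniformSpace E] [IsHilbertModule A E]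
  [AddCommGroup F] [Module ℂ F] [SMul Aᵐᵒᵖ F] [Inner A F] [UniformSpace F] [IsHilbertModule A F]
  {Λ : Type*} [Preorder Λ] [IsDirectedOrder Λ] [Nonempty Λ] {r : Λ → ContCStarSeminorm A}

variable (E) in
theorem exists_modNorm_le_mul
    (hr : ∀ {i j}, i ≤ j → ∀ a, (r i).toCStarSeminorm a ≤ (r j).toCStarSeminorm a)
    (hgen : 𝓝 (0 : A) = ⨅ i, comap (r i).toCStarSeminorm (𝓝 0)) (p : ContCStarSeminorm A) :
    ∃ i, ∃ C : ℝ, ∀ ξ : E,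
      modNorm p.toCStarSeminorm ξ ≤ C * modNorm (r i).toCStarSeminorm ξ := by
  obtain ⟨i, C, hC, h⟩ := exists_le_mul_of_nhds_zero_eq (r := fun i => (r i).toSeminorm)
    (fun hij => hr hij) hgen (p := p.toSeminorm) p.continuous_toFun
  refine ⟨i, √C, fun ξ => ?_⟩
  rw [modNorm, modNorm, ← Real.sqrt_mul hC]
  exact Real.sqrt_le_sqrt (h _)

theorem IsHilbertModule.nhds_zero_eq_of_directed
    (hr : ∀ {i j}, i ≤ j → ∀ a, (r i).toCStarSeminorm a ≤ (r j).toCStarSeminorm a)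
    (hgen : 𝓝 (0 : A) = ⨅ i, comap (r i).toCStarSeminorm (𝓝 0)) :
    𝓝 (0 : E) = ⨅ i, comap (modNorm (r i).toCStarSeminorm) (𝓝 0) := by
  rw [nhds_zero (A := A)]
  refine le_antisymm (le_iInf fun i => iInf_le _ (r i)) (le_iInf fun p => ?_)
  obtain ⟨i, C, h⟩ := exists_modNorm_le_mul E hr hgen p
  exact (iInf_le _ i).trans (comap_nhds_zero_le_of_le_mul (modNorm_nonneg _) h)

/-- A continuous seminorm on `A` is dominated by some `r i` only up to a constant; `knorm_mono`
turns this into a domination of operator seminorms with constant `1`. -/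
theorem CompactOp.nhds_zero_eq_of_directed
    (hr : ∀ {i j}, i ≤ j → ∀ a, (r i).toCStarSeminorm a ≤ (r j).toCStarSeminorm a)
    (hgen : 𝓝 (0 : A) = ⨅ i, comap (r i).toCStarSeminorm (𝓝 0)) :
    𝓝 (0 : CompactOp A E F) = ⨅ i, comap (knorm (r i)) (𝓝 0) := by
  rw [nhds_zero_eq]
  refine le_antisymm (le_iInf fun i => iInf_le _ (r i)) (le_iInf fun p => ?_)
  obtain ⟨i, C, h⟩ := exists_modNorm_le_mul E hr hgen p
  exact (iInf_le _ i).trans (comap_nhds_zero_le_of_le_mul (C := 1) (knorm_nonneg p)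
    fun T => by rw [one_mul]; exact knorm_mono h T)

theorem isInducing_of_nhds_zero_eq {X Λ : Type*} [AddCommGroup X] [TopologicalSpace X]
    [IsTopologicalAddGroup X] {Y : Λ → Type*} [∀ i, NormedAddCommGroup (Y i)] (f : ∀ i, X →+ Y i)
    (hX : 𝓝 (0 : X) = ⨅ i, comap (fun x => ‖f i x‖) (𝓝 0)) :
    IsInducing fun x i => f i x := by
  refine (IsTopologicalAddGroup.isInducing_iff_nhds_zero (f := AddMonoidHom.pi f)).2 ?_
  rw [hX, nhds_pi, Filter.pi, Filter.comap_iInf]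
  refine iInf_congr fun i => ?_
  rw [Filter.comap_comap, Pi.zero_apply, ← comap_norm_nhds_zero (E := Y i), Filter.comap_comap]
  rfl

end Directed

/-! ### Actions whose invariant seminorms generate the topology. -/

section InverseLimit

variable {A E G : Type*} [NonUnitalRing A] [StarRing A] [Module ℂ A] [UniformSpace A]
  [IsLocallyCStarAlgebra A]
  [AddCommGroup E] [Module ℂ E] [SMul Aᵐᵒᵖ E] [Inner A E] [UniformSpace E] [IsHilbertModule A E]
  [Group G]

/-- The continuous C⋆-seminorms that are invariant under a family of morphisms. -/
abbrev InvariantSeminorm (β : G → A →⋆ₙₐ[ℂ] A) : Type _ :=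
  {q : ContCStarSeminorm A // ∀ g a, q.toCStarSeminorm (β g a) = q.toCStarSeminorm a}

instance (β : G → A →⋆ₙₐ[ℂ] A) : Nonempty (InvariantSeminorm β) :=
  ⟨{ (0 : Seminorm ℂ A) with
     mul_le := fun _ _ => (mul_zero (0 : ℝ)).ge
     star_mul_self := fun _ => (zero_pow two_ne_zero : (0 : ℝ) ^ 2 = 0).symm
     continuous_toFun := continuous_const }, fun _ _ => rfl⟩

instance (β : G → A →⋆ₙₐ[ℂ] A) : IsDirectedOrder (InvariantSeminorm β) :=
  ⟨fun p q => ⟨⟨p.1 ⊔ q.1, fun g a => by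
      rw [ContCStarSeminorm.max_apply, ContCStarSeminorm.max_apply, p.2, q.2]⟩,
    fun _ => le_max_left _ _, fun _ => le_max_right _ _⟩⟩

variable (E) in
/-- The inverse system of completions of `E` with respect to the invariant seminorms. -/
def invariantSystem (β : G → A →⋆ₙₐ[ℂ] A) : HilbertSystem (InvariantSeminorm β) where
  alg q := q.1.toCStarSeminorm.Compl
  mod q := ModCompl q.1.toCStarSeminorm E
  algMap h := CStarSeminorm.complId h
  modMap h := ModCompl.map LinearMap.id (CompactOp.modNorm_mono h)
  algMap_refl q a := by
    induction a using CStarSeminorm.compl_induction with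
    | hc => exact isClosed_eq (CStarSeminorm.continuous_complId _) continuous_id
    | h a => exact CStarSeminorm.complId_coe _ a
  algMap_comp {i j k} hij hjk a := by
    induction a using CStarSeminorm.compl_induction with
    | hc =>
      exact isClosed_eq ((CStarSeminorm.continuous_complId _).comp
        (CStarSeminorm.continuous_complId _)) (CStarSeminorm.continuous_complId _)
    | h a =>
      refine (congrArg _ (CStarSeminorm.complId_coe _ a)).trans ?_
      exact (CStarSeminorm.complId_coe _ a).trans (CStarSeminorm.complId_coe _ a).symm
  modMap_refl q ξ := ModCompl.map_eq_self (fun _ => rfl) ξ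
  modMap_comp _ _ ξ := ModCompl.map_map _ _ (fun _ => rfl) ξ
  -- `complId` is by definition the extension of the identity morphism, so the general lemma applies
  -- with `α` the identity.
  modMap_rsmul h ξ a := ModCompl.map_rsmul (α := NonUnitalStarAlgHom.id ℂ A) (hα := h) _ _
    (fun _ _ => rfl) ξ a
  inner_modMap h ξ η := ModCompl.inner_map (α := NonUnitalStarAlgHom.id ℂ A) (hα := h) _ _
    (fun _ _ => rfl) ξ η

variable (E) in
/-- If the invariant seminorms generate the topology, `E` is the inverse limit of the system of
completions. -/
def invariantLimit (β : G → A →⋆ₙₐ[ℂ] A)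
    (hgen : 𝓝 (0 : A) = ⨅ q : InvariantSeminorm β, comap q.1.toCStarSeminorm (𝓝 0)) :
    (invariantSystem E β).Limit A E where
  π q := q.1.toCStarSeminorm.toComplHom
  σ q := toModCompl E q.1.toCStarSeminorm
  algMap_π h a := CStarSeminorm.complId_coe h a
  modMap_σ h ξ := ModCompl.map_coe LinearMap.id (CompactOp.modNorm_mono h) ξ
  σ_rsmul q ξ a := (ModCompl.rsmul_coe ξ a).symm
  inner_σ q ξ η := ModCompl.inner_coe ξ η
  existsUnique_alg x hx := IsLocallyCStarAlgebra.existsUnique_toComplHom_eq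
    (fun q : InvariantSeminorm β => q.1) (fun h => h) hgen x hx
  existsUnique_mod x hx := by
    have := isUniformAddGroup (A := A) (E := E)
    have := completeSpace (A := A) (E := E)
    have := t2Space A E
    refine existsUnique_of_coherent
      (fun q : InvariantSeminorm β => (toModCompl E q.1.toCStarSeminorm).toAddMonoidHom)
      (fun q => denseRange_toModCompl q.1.toCStarSeminorm) ?_
      (fun h => (ModCompl.map LinearMap.id (CompactOp.modNorm_mono h)).toAddMonoidHom)
      (fun h ξ => ModCompl.map_coe LinearMap.id (CompactOp.modNorm_mono h) ξ)
      (fun h => ModCompl.norm_map_le _ (CompactOp.modNorm_mono h)) x hx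
    simp only [LinearMap.toAddMonoidHom_coe, norm_toModCompl]
    exact nhds_zero_eq_of_directed (fun h => h) hgen
  isInducing_alg := isInducing_of_nhds_zero_eq
    (fun q : InvariantSeminorm β =>
      (q.1.toCStarSeminorm.toComplHom : A →+ q.1.toCStarSeminorm.Compl))
    (IsLocallyCStarAlgebra.nhds_zero_norm_toComplHom hgen)
  isInducing_mod := by
    have := isUniformAddGroup (A := A) (E := E)
    refine isInducing_of_nhds_zero_eq
      (fun q : InvariantSeminorm β => (toModCompl E q.1.toCStarSeminorm).toAddMonoidHom) ?_
    simp only [LinearMap.toAddMonoidHom_coe, norm_toModCompl]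
    exact nhds_zero_eq_of_directed (fun h => h) hgen

variable {v : HilbertAction A E G} {β : G → A →⋆ₙₐ[ℂ] A}

/-- The map induced by `v g` on a completion with respect to an invariant seminorm. -/
def invariantMap (hβ : ∀ g, IsCovariant (β g) (v g).1) (q : InvariantSeminorm β) (g : G) :
    ModCompl q.1.toCStarSeminorm E →ₗ[ℂ] ModCompl q.1.toCStarSeminorm E :=
  ModCompl.map (hβ g).toLinearMap fun ξ => (by
    change modNorm _ ((v g).1 ξ) ≤ _
    rw [modNorm, hβ g, q.2, modNorm])

theorem invariantMap_coe (hβ : ∀ g, IsCovariant (β g) (v g).1) (q : InvariantSeminorm β) (g : G)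
    (ξ : E) : invariantMap hβ q g (toModCompl E q.1.toCStarSeminorm ξ) =
      toModCompl E q.1.toCStarSeminorm ((v g).1 ξ) := ModCompl.map_coe _ _ ξ

theorem invariantMap_mul (hβ : ∀ g, IsCovariant (β g) (v g).1) (q : InvariantSeminorm β) (g k : G)
    (x : ModCompl q.1.toCStarSeminorm E) :
    invariantMap hβ q g (invariantMap hβ q k x) = invariantMap hβ q (g * k) x :=
  ModCompl.map_map _ _ (fun ξ => by
    change (v g).1 ((v k).1 ξ) = (v (g * k)).1 ξ
    rw [map_mul]
    rfl) x

theorem invariantMap_one (hβ : ∀ g, IsCovariant (β g) (v g).1) (q : InvariantSeminorm β)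
    (x : ModCompl q.1.toCStarSeminorm E) : invariantMap hβ q 1 x = x :=
  ModCompl.map_eq_self (fun ξ => by
    change (v 1).1 ξ = ξ
    rw [map_one]
    rfl) x

theorem isHilbertMorphism_invariantMap (hβ : ∀ g, IsCovariant (β g) (v g).1)
    (q : InvariantSeminorm β) (g : G) : IsHilbertMorphism q.1.toCStarSeminorm.Compl
      q.1.toCStarSeminorm.Compl (invariantMap hβ q g) :=
  ⟨CStarSeminorm.complMap (β g) fun a => (q.2 g a).le, CStarSeminorm.continuous_complMap _ _,
    ModCompl.inner_map _ _ (hβ g)⟩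

/-- The action on a completion with respect to an invariant seminorm. -/
def invariantAction (hβ : ∀ g, IsCovariant (β g) (v g).1) (q : InvariantSeminorm β) :
    HilbertAction q.1.toCStarSeminorm.Compl (ModCompl q.1.toCStarSeminorm E) G :=
  MonoidHom.mk' (fun g => ⟨
    { toFun := invariantMap hβ q g
      invFun := invariantMap hβ q g⁻¹
      left_inv := fun x => by rw [invariantMap_mul, inv_mul_cancel, invariantMap_one]
      right_inv := fun x => by rw [invariantMap_mul, mul_inv_cancel, invariantMap_one] },
    isHilbertMorphism_invariantMap hβ q g, isHilbertMorphism_invariantMap hβ q g⁻¹⟩)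
    fun g k => Subtype.ext (Equiv.ext fun x => (invariantMap_mul hβ q g k x).symm)

/-- An action for which the invariant continuous C⋆-seminorms generate the topology is an inverse
limit action. -/
theorem isInverseLimitAction_of_invariant (hβ : ∀ g, IsCovariant (β g) (v g).1)
    (hgen : 𝓝 (0 : A) = ⨅ q : InvariantSeminorm β, comap q.1.toCStarSeminorm (𝓝 0)) :
    IsInverseLimitAction v := by
  refine ⟨InvariantSeminorm β, inferInstance, inferInstance, inferInstance, invariantSystem E β,
    invariantLimit E β hgen, invariantAction hβ, fun {i j} hij g x => ?_, fun q g ξ =>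
      (invariantMap_coe hβ q g ξ).symm⟩
  -- Both composites extend `v g`, viewed as a contraction from the seminorm of `j` to that of `i`.
  exact (ModCompl.map_map (k := (hβ g).toLinearMap) (hk := fun ξ => by
      change modNorm _ ((v g).1 ξ) ≤ _
      rw [modNorm, hβ g, i.2]
      exact CompactOp.modNorm_mono hij ξ) _ _ (fun ξ => rfl) x).trans
    (ModCompl.map_map _ _ (fun ξ => rfl) x).symm

end InverseLimit

/-! ### Continuity of orbit maps. -/

/-- For a family of maps that preserve a generating family of seminorms, the points with continuous
orbit maps form a closed set. -/
theorem isClosed_setOf_continuous_orbit {X Λ G : Type*} [AddCommGroup X] [Module ℂ X]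
    [TopologicalSpace X] [IsTopologicalAddGroup X] [TopologicalSpace G] {p : Λ → Seminorm ℂ X}
    (hX : 𝓝 (0 : X) = ⨅ i, comap (p i) (𝓝 0)) {v : G → X → X}
    (hv : ∀ g x y, v g (x - y) = v g x - v g y) (hp : ∀ i g x, p i (v g x) = p i x) :
    IsClosed {x | Continuous fun g => v g x} := by
  refine isClosed_of_closure_subset fun x hx => ?_
  refine continuous_iff_continuousAt.2 fun g₀ => ?_
  rw [ContinuousAt, ← tendsto_sub_nhds_zero_iff, tendsto_zero_iff_of_nhds_zero_eq hX]
  intro i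
  rw [Metric.tendsto_nhds]
  intro ε hε
  have hcont : Continuous (p i) := Seminorm.continuous_of_continuousAt_zero (by
    rw [ContinuousAt, map_zero]
    exact (tendsto_zero_iff_of_nhds_zero_eq hX).1 tendsto_id i)
  have hU : {y | p i (x - y) < ε / 3} ∈ 𝓝 x :=
    ((hcont.comp (continuous_const.sub continuous_id)).tendsto x).eventually
      (gt_mem_nhds (by simpa using by positivity))
  obtain ⟨y, hy, hyc⟩ := mem_closure_iff_nhds.1 hx _ hU
  have hy : p i (x - y) < ε / 3 := hy
  have hyc : Continuous fun g => v g y := hyc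
  have h1 : Tendsto (fun g => v g y - v g₀ y) (𝓝 g₀) (𝓝 0) :=
    tendsto_sub_nhds_zero_iff.2 (hyc.tendsto g₀)
  have h2 := ((tendsto_zero_iff_of_nhds_zero_eq hX).1 h1 i).eventually
    (gt_mem_nhds (show (0 : ℝ) < ε / 3 by positivity))
  filter_upwards [h2] with g hg
  rw [Real.dist_0_eq_abs, abs_of_nonneg (apply_nonneg _ _)]
  -- Invariance bounds the outer two terms by `ε / 3` uniformly in `g`; continuity of the orbit of
  -- `y` bounds the middle one near `g₀`.
  have e : v g x - v g₀ x = v g (x - y) + (v g y - v g₀ y) - v g₀ (x - y) := by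
    rw [hv, hv]
    abel
  rw [e]
  have h3 := map_sub_le_add (p i) (v g (x - y) + (v g y - v g₀ y)) (v g₀ (x - y))
  have h4 := map_add_le_add (p i) (v g (x - y)) (v g y - v g₀ y)
  rw [hp] at h3 h4
  linarith

namespace Adjointable

variable {A E : Type*} [NonUnitalRing A] [StarRing A] [Module ℂ A] [UniformSpace A]
  [IsLocallyCStarAlgebra A]
  [AddCommGroup E] [Module ℂ E] [SMul Aᵐᵒᵖ E] [Inner A E] [UniformSpace E] [IsHilbertModule A E]

/-- The operator `ξ ↦ ⟨ζ, ξ⟩` from `E` to `A`. -/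
def innerLeft (ζ : E) : Adjointable A E A :=
  ⟨{ toFun := fun ξ => inner A ζ ξ
     map_add' := ip_add_right ζ
     map_smul' := fun c ξ => ip_smul_right c ζ ξ },
   fun ξ a => inner_rsmul_right ζ ξ a,
   { toFun := fun a => ζ <• a
     map_add' := rsmul_add ζ
     map_smul' := fun c a => rsmul_smul c ζ a },
   fun a b => rsmul_mul ζ a b,
   fun ξ a => by
    change star (inner A ζ ξ) * a = inner A ξ (ζ <• a)
    rw [inner_rsmul_right, star_inner]⟩

/-- Merging `a` and `ξ` into the single vector `ξa⋆` reduces continuity of the orbit of `θ_{a,ξ}` to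
that of one orbit in `E`. -/
theorem theta_eq_innerLeft (a : A) (ξ : E) :
    (theta a ξ : Adjointable A E A) = innerLeft (ξ <• star a) :=
  ext fun ζ => by
    change a * inner A ξ ζ = inner A (ξ <• star a) ζ
    rw [inner_rsmul_left, star_star]

theorem continuous_innerLeft : Continuous (innerLeft : E → Adjointable A E A) := by
  have := isUniformAddGroup (A := A) (E := E)
  refine continuous_of_continuousAt_zero
    (AddMonoidHom.mk' (innerLeft : E → Adjointable A E A)
      fun ζ ζ' => ext fun ξ => ip_add_left ζ ζ' ξ) ?_
  rw [ContinuousAt, map_zero, tendsto_zero_iff]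
  intro p
  have h1 := (ENNReal.continuous_ofReal.tendsto 0).comp
    ((IsHilbertModule.tendsto_zero_iff (A := A) (E := E)).1 tendsto_id p)
  rw [ENNReal.ofReal_zero] at h1
  refine tendsto_of_tendsto_of_tendsto_of_le_of_le tendsto_const_nhds h1 (fun _ => zero_le)
    fun ζ => opNorm_le (modNorm_nonneg _ _) fun ξ => ?_
  rw [modNorm_self]
  exact cauchy_schwarz _ ζ ξ

end Adjointable

/-! ### Invariant seminorms from an inverse limit action, and the induced action on `K(E, A)`. -/

section InvariantFamily

universe uA

variable {A : Type uA} {E G : Type*} [NonUnitalRing A] [StarRing A] [Module ℂ A] [UniformSpace A]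
  [IsLocallyCStarAlgebra A]
  [AddCommGroup E] [Module ℂ E] [SMul Aᵐᵒᵖ E] [Inner A E] [UniformSpace E] [IsHilbertModule A E]
  [Group G]

/-- For an inverse limit action on a full module, the topology of the algebra is generated by a
directed family of seminorms that are invariant under the induced action. -/
theorem IsInverseLimitAction.exists_invariant_family (hE : IsFull A E) {u : HilbertAction A E G}
    (hu : IsInverseLimitAction u) {α : AlgAction G A}
    (hα : ∀ g ξ η, (α g).1 (inner A ξ η) = inner A ((u g).1 ξ) ((u g).1 η)) :
    ∃ (Λ : Type uA) (_ : Preorder Λ) (_ : IsDirectedOrder Λ) (_ : Nonempty Λ)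
      (r : Λ → ContCStarSeminorm A),
      (∀ {i j}, i ≤ j → ∀ a, (r i).toCStarSeminorm a ≤ (r j).toCStarSeminorm a) ∧
      𝓝 (0 : A) = ⨅ i, comap (r i).toCStarSeminorm (𝓝 0) ∧
      ∀ i g a, (r i).toCStarSeminorm ((α g).1 a) = (r i).toCStarSeminorm a := by
  obtain ⟨Λ, _, _, _, D, L, v, -, hv⟩ := hu
  have hπ : ∀ i, Continuous (L.π i) := fun i =>
    (continuous_apply i).comp L.isInducing_alg.continuous
  -- The morphism `β` accompanying `v i g` satisfies `π_i α_g = β π_i` on inner products, hence on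
  -- `A` by fullness, and morphisms of C⋆-algebras are contractive. Equality then comes from the
  -- same bound for `g⁻¹`.
  have hle : ∀ i g a, ‖L.π i ((α g).1 a)‖ ≤ ‖L.π i a‖ := by
    intro i g a
    obtain ⟨β, hβ, h⟩ := (v i g).2.1
    have : L.π i ((α g).1 a) = β (L.π i a) := by
      refine congrFun (Continuous.ext_on hE ((hπ i).comp (α g).2.1) (hβ.comp (hπ i)) ?_) a
      refine LinearMap.eqOn_span
        (f := ((L.π i).comp ((α g).1 : A →⋆ₙₐ[ℂ] A) : A →ₗ[ℂ] D.alg i))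
        (g := (β.comp (L.π i) : A →ₗ[ℂ] D.alg i)) ?_
      rintro _ ⟨ξ, η, rfl⟩
      change L.π i ((α g).1 (inner A ξ η)) = β (L.π i (inner A ξ η))
      rw [hα, ← L.inner_σ, ← L.inner_σ, hv, hv, h]
    rw [this]
    exact NonUnitalStarAlgHom.norm_apply_le β _
  refine ⟨Λ, inferInstance, inferInstance, inferInstance,
    fun i => (normContCStarSeminorm (D.alg i)).pullback (L.π i) (hπ i), fun {i j} hij a => ?_,
    ?_, fun i g a => le_antisymm (hle i g a) ?_⟩
  · change ‖L.π i a‖ ≤ ‖L.π j a‖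
    rw [← L.algMap_π hij]
    exact NonUnitalStarAlgHom.norm_apply_le _ _
  · rw [L.isInducing_alg.nhds_eq_comap, nhds_pi, Filter.pi, Filter.comap_iInf]
    refine iInf_congr fun i => ?_
    rw [Filter.comap_comap, map_zero, ← comap_norm_nhds_zero (E := D.alg i), Filter.comap_comap]
    rfl
  · have h := hle i g⁻¹ ((α g).1 a)
    have e : (α g⁻¹).1 ((α g).1 a) = a := by
      change (α g⁻¹ * α g).1 a = a
      rw [← map_mul, inv_mul_cancel, map_one]
      rfl
    rwa [e] at h

namespace CompactOp

variable {u : HilbertAction A E G} {α : AlgAction G A}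
  (hα : ∀ g ξ η, (α g).1 (inner A ξ η) = inner A ((u g).1 ξ) ((u g).1 η))

theorem inducedAction_theta (g : G) (a : A) (ξ : E) :
    (inducedAction u α hα g).1 (theta a ξ) = theta ((α g).1 a) ((u g).1 ξ) :=
  CovariantPerm.conjK_theta _ _ a ξ

theorem isCovariant_inducedAction (g : G) :
    IsCovariant (inducedHom u α hα g) (inducedAction u α hα g).1 :=
  CovariantPerm.inner_conjK _ _

variable {Λ : Type*} [Preorder Λ] [IsDirectedOrder Λ] [Nonempty Λ] {r : Λ → ContCStarSeminorm A}
  (hr : ∀ {i j}, i ≤ j → ∀ a, (r i).toCStarSeminorm a ≤ (r j).toCStarSeminorm a)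
  (hgen : 𝓝 (0 : A) = ⨅ i, comap (r i).toCStarSeminorm (𝓝 0))
  (hinv : ∀ i g a, (r i).toCStarSeminorm ((α g).1 a) = (r i).toCStarSeminorm a)

include hr hgen hinv

/-- Conjugation preserves the operator seminorm of each `r i`, because `r i` is invariant under `α`.
These seminorms already generate the topology of `K(E)`, so the invariant ones do. -/
theorem isInverseLimitAction_inducedAction : IsInverseLimitAction (inducedAction u α hα) := by
  refine isInverseLimitAction_of_invariant (isCovariant_inducedAction hα) (le_antisymm ?_ ?_)
  · rw [IsLocallyCStarAlgebra.nhds_zero]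
    exact le_iInf fun q => iInf_le _ q.1
  · rw [nhds_zero_eq_of_directed hr hgen]
    exact le_iInf fun i => iInf_le _ (⟨kCStarSeminorm E (r i), fun g T =>
      CovariantPerm.knorm_conjK (α := α g) _ _ (hinv i g) T⟩ :
        InvariantSeminorm (inducedHom u α hα))

theorem isContinuousAction_inducedAction [TopologicalSpace G] (hu : IsContinuousAction u) :
    IsContinuousAction (inducedAction u α hα) := by
  intro T
  have hadd := fun g => (isCovariant_inducedAction hα g).map_add
  have hsmul := fun g => (isCovariant_inducedAction hα g).map_smul
  induction T using CompactOp.induction with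
  | hc =>
    exact isClosed_setOf_continuous_orbit (p := fun i => kSeminorm (r i))
      (nhds_zero_eq_of_directed hr hgen)
      (fun g => (isCovariant_inducedAction hα g).toLinearMap.map_sub)
      fun i g T => CovariantPerm.knorm_conjK (α := α g) _ _ (hinv i g) T
  | theta a ξ =>
    simp only [inducedAction_theta]
    refine continuous_induced_rng.2 ?_
    refine (Adjointable.continuous_innerLeft.comp (hu (ξ <• star a))).congr fun g => ?_
    have h1 : IsCovariant ((α g).1 : A →⋆ₙₐ[ℂ] A) (u g).1 := fun ξ η => (hα g ξ η).symm
    change Adjointable.innerLeft ((u g).1 (ξ <• star a)) = Adjointable.theta _ _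
    rw [Adjointable.theta_eq_innerLeft, h1.map_rsmul, map_star]
    rfl
  | zero =>
    refine continuous_const (y := (0 : CompactOp A E A)) |>.congr fun g => ?_
    exact (isCovariant_inducedAction hα g).toLinearMap.map_zero.symm
  | add S T hS hT =>
    simp only [hadd]
    exact hS.add hT
  | smul c T hT =>
    have := continuousConstSMul (CompactOp A E E) (CompactOp A E A)
    simp only [hsmul]
    exact hT.const_smul c

end CompactOp

end InvariantFamily

theorem proposition4p8 {A E G : Type*}
    [NonUnitalRing A] [StarRing A] [Module ℂ A] [UniformSpace A] [IsLocallyCStarAlgebra A]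
    [AddCommGroup E] [Module ℂ E] [SMul Aᵐᵒᵖ E] [Inner A E] [UniformSpace E]
    [IsHilbertModule A E] (hE : IsFull A E)
    [Group G] [TopologicalSpace G] [IsTopologicalGroup G] [LocallyCompactSpace G]
    (u : HilbertAction A E G) :
    -- `K(E)` is a locally C⋆-algebra and `K(E, A)` is a Hilbert `K(E)`-module
    IsLocallyCStarAlgebra (CompactOp A E E) ∧
    IsHilbertModule (CompactOp A E E) (CompactOp A E A) ∧
    -- the action of `G` on `A` induced by `u`
    ∃ α : AlgAction G A, (∀ g ξ η, (α g).1 (inner A ξ η) = inner A ((u g).1 ξ) ((u g).1 η)) ∧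
      (∀ α' : AlgAction G A,
        (∀ g ξ η, (α' g).1 (inner A ξ η) = inner A ((u g).1 ξ) ((u g).1 η)) → α' = α) ∧
      -- the action of `G` on `K(E, A)` induced by `u`
      ∃ v : HilbertAction (CompactOp A E E) (CompactOp A E A) G,
        (∀ g (a : A) (ξ : E),
          (v g).1 (CompactOp.theta a ξ) = CompactOp.theta ((α g).1 a) ((u g).1 ξ)) ∧
        (∀ v' : HilbertAction (CompactOp A E E) (CompactOp A E A) G,
          (∀ g (a : A) (ξ : E),
            (v' g).1 (CompactOp.theta a ξ) = CompactOp.theta ((α g).1 a) ((u g).1 ξ)) → v' = v) ∧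
        (IsContinuousAction u ∧ IsInverseLimitAction u →
          IsContinuousAction v ∧ IsInverseLimitAction v) := by
  obtain ⟨α, hα, huniq⟩ := hE.exists_algAction u
  refine ⟨inferInstance, inferInstance, α, hα, huniq, CompactOp.inducedAction u α hα,
    CompactOp.inducedAction_theta hα, fun v' hv' => MonoidHom.ext fun g =>
      CompactOp.hilbertAut_ext fun a ξ =>
        (hv' g a ξ).trans (CompactOp.inducedAction_theta hα g a ξ).symm, ?_⟩
  rintro ⟨hc, hl⟩
  -- The same invariant generating family serves both conclusions; in particular, continuity of the
  -- new action also uses the inverse limit hypothesis on `u`.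
  obtain ⟨Λ, _, _, _, r, hr, hgen, hinv⟩ := hl.exists_invariant_family hE hα
  exact ⟨CompactOp.isContinuousAction_inducedAction hα hr hgen hinv hc,
    CompactOp.isInverseLimitAction_inducedAction hα hr hgen hinv⟩
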